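/- Let $k$ be an algebraically closed field. A $k$-linear category is called finite if it is equivalent, as a $k$-linear category, to the category of finite-dimensional modules over some finite-dimensional $k$-algebra. For a finite-dimensional vector space $V$ and an object $x$ of a finite linear category $\mathcal X$, let $V\otimes x$ be the object representing the functor $V\otimes_k\mathrm{Hom}_{\mathcal X}(-,x)$. The Nakayama functors $N^l_{\mathcal X},N^r_{\mathcal X}\colon\mathcal X\to\mathcal X$ are $$N^l_{\mathcal X}(y)=\int_{x\in\mathcal X}\mathrm{Hom}_{\mathcal X}(x,y)\otimes x,\qquad N^r_{\mathcal X}(y)=\int^{x\in\mathcal X}\mathrm{Hom}_{\mathcal X}(y,x)^*\otimes x .$$ Let $\mathcal A$ be a finite linear category. (i) Let $\mathcal B$ be a finite linear category and let $\boxtimes\colon\mathcal A\times\mathcal B\to\mathcal A\boxtimes\mathcal B$ be a Deligne product, that is, a bilinear functor to a finite linear category, exact in each variable, such that for every finite linear category $\mathcal X$ precomposition with $\boxtimes$ is an equivalence from the category of right exact linear functors $\mathcal A\boxtimes\mathcal B\to\mathcal X$ to the category of bilinear functors $\mathcal A\times\mathcal B\to\mathcal X$ that are right exact in each variable. For left exact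 (respectively right exact) linear endofunctors $F$ of $\mathcal A$ and $G$ of $\mathcal B$, let $F\boxtimes G$ be the left exact (respectively right exact) linear endofunctor of $\mathcal A\boxtimes\mathcal B$ with $(F\boxtimes G)(a\boxtimes b)\cong F(a)\boxtimes G(b)$ naturally in $a$ and $b$. Then the ends and coends defining the Nakayama functors of $\mathcal A$, $\mathcal B$ and $\mathcal A\boxtimes\mathcal B$ exist, the functors $N^l$ are linear and left exact, the functors $N^r$ are linear and right exact, and there are isomorphisms of functors $$N^l_{\mathcal A\boxtimes\mathcal B}\cong N^l_{\mathcal A}\boxtimes N^l_{\mathcal B},\qquad N^r_{\mathcal A\boxtimes\mathcal B}\cong N^r_{\mathcal A}\boxtimes N^r_{\mathcal B};$$ here each right-hand side is unique up to isomorphism. (ii) The ends and coends defining the Nakayama functors of $\mathcal A^{\mathrm{op}}$ exist as well, and there are isomorphisms of functors $$N^l_{\mathcal A^{\mathrm{op}}}\cong (N^r_{\mathcal A})^{\mathrm{op}},\qquad N^r_{\mathcal A^{\mathrm{op}}}\cong (N^l_{\mathcal A})^{\mathrm{op}} .$$ -/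

import Mathlib

open CategoryTheory CategoryTheory.Limits Opposite
open scoped TensorProduct

universe w v v₁ v₂ v₃ v₄ u u₁ u₂ u₃ u₄

namespace FiniteLinear

noncomputable section

/-! ### Linear categories and finite linear categories -/

/-- The opposite of a `k`-linear category is `k`-linear. -/
instance linearOpposite (k : Type w) [Field k] (X : Type u) [Category.{v} X] [Preadditive X]
    [Linear k X] : Linear k Xᵒᵖ where
  homModule _ _ :=
    { smul := fun r f => (r • f.unop).op
      one_smul := fun f => Quiver.Hom.unop_inj (one_smul k f.unop)
      mul_smul := fun r s f => Quiver.Hom.unop_inj (mul_smul r s f.unop)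
      smul_zero := fun r => Quiver.Hom.unop_inj (smul_zero r)
      smul_add := fun r f g => Quiver.Hom.unop_inj (smul_add r f.unop g.unop)
      add_smul := fun r s f => Quiver.Hom.unop_inj (add_smul r s f.unop)
      zero_smul := fun f => Quiver.Hom.unop_inj (zero_smul k f.unop) }
  smul_comp _ _ _ r f g := Quiver.Hom.unop_inj (Linear.comp_smul _ _ _ g.unop r f.unop)
  comp_smul _ _ _ f r g := Quiver.Hom.unop_inj (Linear.smul_comp _ _ _ r g.unop f.unop)

/-- A `k`-linear category is *finite* if it is equivalent, as a linear category, to the category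
of finite-dimensional modules over a finite-dimensional `k`-algebra. (Over such an algebra the
finitely generated modules are exactly the finite-dimensional ones.) -/
class IsFiniteLinear (k : Type w) [Field k] (X : Type u) [Category.{v} X] [Preadditive X]
    [Linear k X] : Prop where
  exists_equivalence : ∃ (R : Type w) (_ : Ring R) (_ : Algebra k R) (_ : Module.Finite k R)
    (e : X ≌ FGModuleCat.{w} R), e.functor.Additive ∧ e.functor.Linear k

/-- A `k`-linear category with finite-dimensional morphism spaces and finite direct sums. -/
class IsHomFiniteAdditive (k : Type w) [Field k] (X : Type u) [Category.{v} X] [Preadditive X]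
    [Linear k X] : Prop where
  finite_hom : ∀ x y : X, Module.Finite k (x ⟶ y)
  hasFiniteBiproducts : HasFiniteBiproducts X

theorem finite_hom_fgModuleCat (k : Type w) [Field k] (R : Type w) [Ring R] [Algebra k R]
    [Module.Finite k R] (M N : FGModuleCat.{w} R) : Module.Finite k (M ⟶ N) := by
  let : Module k M.obj := Module.restrictScalars k R M.obj
  let : Module k N.obj := Module.restrictScalars k R N.obj
  have : IsScalarTower k R M.obj := IsScalarTower.restrictScalars k R M.obj
  have : IsScalarTower k R N.obj := IsScalarTower.restrictScalars k R N.obj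
  have : Module.Finite R M.obj := M.property
  have : Module.Finite R N.obj := N.property
  have : Module.Finite k M.obj := Module.Finite.trans R M.obj
  have : Module.Finite k N.obj := Module.Finite.trans R N.obj
  let φ : (M ⟶ N) →ₗ[k] (M.obj →ₗ[k] N.obj) :=
    { toFun := fun f => f.hom.hom.restrictScalars k
      map_add' := fun _ _ => rfl
      map_smul' := fun _ _ => rfl }
  refine Module.Finite.of_injective φ ?_
  intro f g h
  apply FGModuleCat.hom_ext
  ext x
  exact LinearMap.congr_fun h x

instance (priority := 100) IsFiniteLinear.isHomFiniteAdditive (k : Type w) [Field k] (X : Type u)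
    [Category.{v} X] [Preadditive X] [Linear k X] [IsFiniteLinear k X] :
    IsHomFiniteAdditive k X := by
  obtain ⟨R, _, _, _, e, _, _⟩ := IsFiniteLinear.exists_equivalence (k := k) (X := X)
  constructor
  · intro x y
    have := finite_hom_fgModuleCat k R (e.functor.obj x) (e.functor.obj y)
    exact Module.Finite.of_injective (e.functor.mapLinearMap k (X := x) (Y := y))
      e.functor.map_injective
  · have : IsNoetherianRing R := IsNoetherianRing.of_finite k R
    have : HasFiniteProducts X :=
      ⟨fun n => Adjunction.hasLimitsOfShape_of_equivalence e.functor⟩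
    exact HasFiniteBiproducts.of_hasFiniteProducts

instance IsHomFiniteAdditive.opposite (k : Type w) [Field k] (X : Type u) [Category.{v} X]
    [Preadditive X] [Linear k X] [IsHomFiniteAdditive k X] : IsHomFiniteAdditive k Xᵒᵖ := by
  constructor
  · intro x y
    have := IsHomFiniteAdditive.finite_hom (k := k) y.unop x.unop
    let φ : (x ⟶ y) →ₗ[k] (y.unop ⟶ x.unop) :=
      { toFun := fun f => f.unop
        map_add' := fun _ _ => rfl
        map_smul' := fun _ _ => rfl }
    exact Module.Finite.of_injective φ Quiver.Hom.unop_inj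
  · have : HasFiniteBiproducts X := IsHomFiniteAdditive.hasFiniteBiproducts (k := k)
    exact HasFiniteBiproducts.of_hasFiniteProducts

/-! ### The action of finite-dimensional vector spaces on a linear category -/

section Tensor

variable (k : Type w) [Field k] {X : Type u} [Category.{v} X] [Preadditive X] [Linear k X]

/-- An object `V ⊗ x`, for a vector space `V` and an object `x` of a `k`-linear category:
an object representing the functor `z ↦ V ⊗ Hom(z, x)`. -/
structure TensorObject (V : Type u₁) [AddCommGroup V] [Module k V] (x : X) where
  pt : X
  equiv (z : X) : (z ⟶ pt) ≃ₗ[k] V ⊗[k] (z ⟶ x)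
  equiv_comp {z z' : X} (f : z' ⟶ z) (g : z ⟶ pt) :
    equiv z' (f ≫ g) = (Linear.leftComp k x f).lTensor V (equiv z g)

theorem nonempty_tensorObject [IsHomFiniteAdditive k X] (V : Type u₁) [AddCommGroup V]
    [Module k V] [Module.Finite k V] (x : X) : Nonempty (TensorObject k V x) := by
  have : HasFiniteBiproducts X := IsHomFiniteAdditive.hasFiniteBiproducts (k := k)
  let b := Module.finBasis k V
  let p : X := ⨁ fun _ : Fin (Module.finrank k V) => x
  let e (z : X) : (z ⟶ p) ≃ₗ[k] (Fin (Module.finrank k V) → (z ⟶ x)) :=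
    { toFun := fun g i => g ≫ biproduct.π _ i
      map_add' := fun _ _ => by ext; simp
      map_smul' := fun _ _ => by ext; simp
      invFun := fun h => biproduct.lift h
      left_inv := fun g => by apply biproduct.hom_ext; simp
      right_inv := fun h => by ext; simp }
  refine ⟨⟨p, fun z => e z ≪≫ₗ (Finsupp.linearEquivFunOnFinite k _ _).symm ≪≫ₗ
    (TensorProduct.equivFinsuppOfBasisLeft b).symm, ?_⟩⟩
  intro z z' f g
  simp [e, Finsupp.sum_fintype]

variable [IsHomFiniteAdditive k X]

/-- The chosen object `V ⊗ x` with its representing isomorphisms. -/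
def tensorObject (V : Type u₁) [AddCommGroup V] [Module k V] [Module.Finite k V] (x : X) :
    TensorObject k V x :=
  (nonempty_tensorObject k V x).some

variable {V : Type u₁} [AddCommGroup V] [Module k V] [Module.Finite k V]
  {W : Type u₂} [AddCommGroup W] [Module k W] [Module.Finite k W]
  {U : Type u₃} [AddCommGroup U] [Module k U] [Module.Finite k U]

/-- The morphism `φ ⊗ g : V ⊗ x ⟶ W ⊗ y`, determined by the Yoneda lemma. -/
def tensorMap (φ : V →ₗ[k] W) {x y : X} (g : x ⟶ y) :
    (tensorObject k V x).pt ⟶ (tensorObject k W y).pt :=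
  ((tensorObject k W y).equiv _).symm
    (TensorProduct.map φ (Linear.rightComp k _ g) ((tensorObject k V x).equiv _ (𝟙 _)))

theorem equiv_comp_tensorMap (φ : V →ₗ[k] W) {x y z : X} (g : x ⟶ y)
    (h : z ⟶ (tensorObject k V x).pt) :
    (tensorObject k W y).equiv z (h ≫ tensorMap k φ g) =
      TensorProduct.map φ (Linear.rightComp k z g) ((tensorObject k V x).equiv z h) := by
  rw [TensorObject.equiv_comp, tensorMap, LinearEquiv.apply_symm_apply]
  conv_rhs => rw [← Category.comp_id h, TensorObject.equiv_comp]
  generalize (tensorObject k V x).equiv _ (𝟙 _) = t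
  induction t with
  | zero => simp
  | tmul a b => simp
  | add a b ha hb => simp only [map_add, ha, hb]

theorem tensorMap_id (x : X) :
    tensorMap k (LinearMap.id : V →ₗ[k] V) (𝟙 x) = 𝟙 (tensorObject k V x).pt := by
  apply ((tensorObject k V x).equiv _).injective
  have h := equiv_comp_tensorMap k (LinearMap.id : V →ₗ[k] V) (𝟙 x)
    (𝟙 (tensorObject k V x).pt)
  rw [Category.id_comp] at h
  rw [h]
  have : Linear.rightComp k (tensorObject k V x).pt (𝟙 x) = LinearMap.id := by
    ext f; simp
  rw [this, TensorProduct.map_id, LinearMap.id_apply]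

theorem tensorMap_comp (φ : V →ₗ[k] W) (ψ : W →ₗ[k] U) {x y z : X} (g : x ⟶ y) (h : y ⟶ z) :
    tensorMap k φ g ≫ tensorMap k ψ h = tensorMap k (ψ ∘ₗ φ) (g ≫ h) := by
  apply ((tensorObject k U z).equiv _).injective
  have h₂ := equiv_comp_tensorMap k (ψ ∘ₗ φ) (g ≫ h) (𝟙 (tensorObject k V x).pt)
  have h₁ := equiv_comp_tensorMap k φ g (𝟙 (tensorObject k V x).pt)
  rw [Category.id_comp] at h₁ h₂
  rw [equiv_comp_tensorMap, h₁, h₂]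
  have : Linear.rightComp k (tensorObject k V x).pt (g ≫ h) =
      Linear.rightComp k _ h ∘ₗ Linear.rightComp k _ g := by
    ext f; simp
  rw [this, TensorProduct.map_comp, LinearMap.comp_apply]

end Tensor

/-! ### Nakayama functors -/

section Nakayama

variable (k : Type w) [Field k] (X : Type u) [Category.{v} X] [Preadditive X] [Linear k X]
  [IsHomFiniteAdditive k X]

attribute [local instance] IsHomFiniteAdditive.finite_hom

/-- The functor `y ↦ ((x, x') ↦ Hom(x, y) ⊗ x')`, contravariant in `x`. -/
def homTensor : X ⥤ Xᵒᵖ ⥤ X ⥤ X where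
  obj y :=
    { obj := fun x =>
        { obj := fun x' => (tensorObject k (x.unop ⟶ y) x').pt
          map := fun g => tensorMap k LinearMap.id g
          map_id := fun _ => tensorMap_id k _
          map_comp := fun _ _ => by rw [tensorMap_comp, LinearMap.id_comp] }
      map := fun f =>
        { app := fun x' => tensorMap k (Linear.leftComp k y f.unop) (𝟙 x')
          naturality := fun _ _ g => by
            simp [tensorMap_comp] }
      map_id := fun x => by
        ext x'
        have : Linear.leftComp k y (𝟙 x.unop) = LinearMap.id := by ext f; simp
        simp [this, tensorMap_id]
      map_comp := fun {x₁ x₂ x₃} f g => by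
        ext x'
        have : Linear.leftComp k y (g.unop ≫ f.unop) =
          Linear.leftComp k y g.unop ∘ₗ Linear.leftComp k y f.unop := by ext f; simp
        simp [this, tensorMap_comp] }
  map h :=
    { app := fun x =>
        { app := fun x' => tensorMap k (Linear.rightComp k x.unop h) (𝟙 x')
          naturality := fun _ _ g => by
            simp [tensorMap_comp] }
      naturality := fun x₁ x₂ f => by
        ext x'
        have : Linear.rightComp k x₂.unop h ∘ₗ Linear.leftComp k _ f.unop =
          Linear.leftComp k _ f.unop ∘ₗ Linear.rightComp k x₁.unop h := by ext f; simp
        simp [tensorMap_comp, this] }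
  map_id y := by
    ext x x'
    have : Linear.rightComp k x.unop (𝟙 y) = LinearMap.id := by ext f; simp
    simp [this, tensorMap_id]
  map_comp h₁ h₂ := by
    ext x x'
    have : Linear.rightComp k x.unop (h₁ ≫ h₂) =
      Linear.rightComp k x.unop h₂ ∘ₗ Linear.rightComp k x.unop h₁ := by ext f; simp
    simp [this, tensorMap_comp]

/-- The functor `y ↦ ((x, x') ↦ Hom(y, x)^* ⊗ x')`, contravariant in `x`, where `^*` is the
dual vector space. -/
def dualHomTensor : X ⥤ Xᵒᵖ ⥤ X ⥤ X where
  obj y :=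
    { obj := fun x =>
        { obj := fun x' => (tensorObject k (Module.Dual k (y ⟶ x.unop)) x').pt
          map := fun g => tensorMap k LinearMap.id g
          map_id := fun _ => tensorMap_id k _
          map_comp := fun _ _ => by rw [tensorMap_comp, LinearMap.id_comp] }
      map := fun f =>
        { app := fun x' => tensorMap k (Linear.rightComp k y f.unop).dualMap (𝟙 x')
          naturality := fun _ _ g => by
            simp [tensorMap_comp] }
      map_id := fun x => by
        ext x'
        have : Linear.rightComp k y (𝟙 x.unop) = LinearMap.id := by ext f; simp
        simp [this, tensorMap_id]
      map_comp := fun {x₁ x₂ x₃} f g => by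
        ext x'
        have : Linear.rightComp k y (g.unop ≫ f.unop) =
          Linear.rightComp k y f.unop ∘ₗ Linear.rightComp k y g.unop := by ext f; simp
        simp [this, tensorMap_comp, LinearMap.dualMap_comp_dualMap] }
  map h :=
    { app := fun x =>
        { app := fun x' => tensorMap k (Linear.leftComp k x.unop h).dualMap (𝟙 x')
          naturality := fun _ _ g => by
            simp [tensorMap_comp] }
      naturality := fun x₁ x₂ f => by
        ext x'
        have : Linear.rightComp k _ f.unop ∘ₗ Linear.leftComp k x₂.unop h =
          Linear.leftComp k x₁.unop h ∘ₗ Linear.rightComp k _ f.unop := by ext f; simp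
        simp [tensorMap_comp, LinearMap.dualMap_comp_dualMap, this] }
  map_id y := by
    ext x x'
    have : Linear.leftComp k x.unop (𝟙 y) = LinearMap.id := by ext f; simp
    simp [this, tensorMap_id]
  map_comp h₁ h₂ := by
    ext x x'
    have : Linear.leftComp k x.unop (h₁ ≫ h₂) =
      Linear.leftComp k x.unop h₁ ∘ₗ Linear.leftComp k x.unop h₂ := by ext f; simp
    simp [this, tensorMap_comp, LinearMap.dualMap_comp_dualMap]

/-- The ends and coends in the definition of the two Nakayama functors of `X` exist. -/
class HasNakayamaFunctors : Prop where
  hasEnd : ∀ y : X, HasEnd ((homTensor k X).obj y)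
  hasCoend : ∀ y : X, HasCoend ((dualHomTensor k X).obj y)

attribute [instance] HasNakayamaFunctors.hasEnd HasNakayamaFunctors.hasCoend

variable [HasNakayamaFunctors k X]

/-- The left exact Nakayama functor `N^l(y) = ∫_x Hom(x, y) ⊗ x`. -/
def leftNakayama : X ⥤ X where
  obj y := end_ ((homTensor k X).obj y)
  map h := end_.map ((homTensor k X).map h)

/-- The (right exact) Nakayama functor `N^r(y) = ∫^x Hom(y, x)^* ⊗ x`. -/
def rightNakayama : X ⥤ X where
  obj y := coend ((dualHomTensor k X).obj y)
  map h := coend.map ((dualHomTensor k X).map h)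

end Nakayama

/-! ### Exact functors and the Deligne product -/

section Deligne

variable (k : Type w) [Field k]
  {A : Type u₁} [Category.{v₁} A] [Preadditive A] [Linear k A]
  {B : Type u₂} [Category.{v₂} B] [Preadditive B] [Linear k B]
  {D : Type u₃} [Category.{v₃} D] [Preadditive D] [Linear k D]
  {X : Type u₄} [Category.{v₄} X] [Preadditive X] [Linear k X]

/-- A left exact `k`-linear functor. -/
structure IsLeftExactLinear (F : A ⥤ X) : Prop where
  additive : F.Additive
  linear : F.Linear k
  preservesFiniteLimits : PreservesFiniteLimits F

/-- A right exact `k`-linear functor. -/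
structure IsRightExactLinear (F : A ⥤ X) : Prop where
  additive : F.Additive
  linear : F.Linear k
  preservesFiniteColimits : PreservesFiniteColimits F

/-- A `k`-bilinear functor that is left exact in each variable. -/
structure IsLeftExactBilinear (F : A × B ⥤ X) : Prop where
  left : ∀ b : B, IsLeftExactLinear k (Prod.sectL A b ⋙ F)
  right : ∀ a : A, IsLeftExactLinear k (Prod.sectR a B ⋙ F)

/-- A `k`-bilinear functor that is right exact in each variable. -/
structure IsRightExactBilinear (F : A × B ⥤ X) : Prop where
  left : ∀ b : B, IsRightExactLinear k (Prod.sectL A b ⋙ F)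
  right : ∀ a : A, IsRightExactLinear k (Prod.sectR a B ⋙ F)

/-- `T : A × B ⥤ D` exhibits `D` as the Deligne product of `A` and `B`: it is bilinear and exact
in each variable, and for every finite linear category `X`, precomposition with `T` is an
equivalence from the category of right exact linear functors `D ⥤ X` to the category of bilinear
functors `A × B ⥤ X` that are right exact in each variable, that is, it is essentially
surjective (`exists_factorization`) and fully faithful (`existsUnique_whiskerLeft`). -/
structure IsDeligneProduct (T : A × B ⥤ D) : Prop where
  leftExact : IsLeftExactBilinear k T
  rightExact : IsRightExactBilinear k T
  exists_factorization : ∀ (X : Type (w + 1)) [Category.{w} X] [Preadditive X] [Linear k X]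
    [IsFiniteLinear k X] (F : A × B ⥤ X), IsRightExactBilinear k F →
      ∃ G : D ⥤ X, IsRightExactLinear k G ∧ Nonempty (T ⋙ G ≅ F)
  existsUnique_whiskerLeft : ∀ (X : Type (w + 1)) [Category.{w} X] [Preadditive X] [Linear k X]
    [IsFiniteLinear k X] (G H : D ⥤ X), IsRightExactLinear k G → IsRightExactLinear k H →
      ∀ α : T ⋙ G ⟶ T ⋙ H, ∃! β : G ⟶ H, Functor.whiskerLeft T β = α

/-- For a Deligne product `T : A × B ⥤ D` and left exact linear endofunctors `F` of `A` and `G`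
of `B`, `H` is their Deligne product `F ⊠ G`: it is left exact, linear, and
`H (a ⊠ b) ≅ F a ⊠ G b` naturally in `a` and `b`. -/
structure IsLeftExactProduct (T : A × B ⥤ D) (F : A ⥤ A) (G : B ⥤ B) (H : D ⥤ D) : Prop where
  fst : IsLeftExactLinear k F
  snd : IsLeftExactLinear k G
  prod : IsLeftExactLinear k H
  iso : Nonempty (T ⋙ H ≅ F.prod G ⋙ T)

/-- For a Deligne product `T : A × B ⥤ D` and right exact linear endofunctors `F` of `A` and `G`
of `B`, `H` is their Deligne product `F ⊠ G`: it is right exact, linear, and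
`H (a ⊠ b) ≅ F a ⊠ G b` naturally in `a` and `b`. -/
structure IsRightExactProduct (T : A × B ⥤ D) (F : A ⥤ A) (G : B ⥤ B) (H : D ⥤ D) : Prop where
  fst : IsRightExactLinear k F
  snd : IsRightExactLinear k G
  prod : IsRightExactLinear k H
  iso : Nonempty (T ⋙ H ≅ F.prod G ⋙ T)

end Deligne

end

end FiniteLinear

open FiniteLinear

/-!
Both Nakayama functors are governed by the same spaces. For objects `z` and `y` let
`dinatural k z y` be the space of families of elements of `Hom(x, y) ⊗ Hom(z, x)` that are dinatural
in `x`. Wedges from `z` to `Hom(-, y) ⊗ -` and cowedges from `Hom(z, -)^* ⊗ -` to `y` are such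
families, so `N^l y` represents them in `z` and `N^r z` corepresents them in `y`
(`isLeftNakayama_leftNakayama`, `isRightNakayama_rightNakayama`). This description gives the
adjunction `N^r ⊣ N^l` (`nonempty_adjunction`), hence the exactness of the two functors, and it is
symmetric under passing to the opposite category (`IsRightNakayama.op`, `IsLeftNakayama.op`), which
gives the second part of the theorem.

Everything else rests on a *Serre pair* (`SerrePair`): a separator `P`, an object `I` and a linear
form on `Hom(P, I)` that makes the pairings `Hom(P, x) × Hom(x, I) → Hom(P, I) → k` perfect. For
modules over a finite-dimensional algebra `R` one takes `P = R`, `I = R^*` and the evaluation at `1`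
(`serrePairFGModuleCat`). Perfectness makes `P` a projective generator and `I` an injective
cogenerator, and the copairings form the universal dinatural family between `P` and `I`
(`SerrePair.exists_universal`). So `N^l I = P` and `N^r P = I`, and copresentations by copies of `I`
and presentations by copies of `P` yield the ends and coends at all objects
(`SerrePair.hasNakayamaFunctors`). Moreover the action of `e ∈ End P` on `N^r P = I` is determined
by `form (e ≫ u) = form (u ≫ N^r e)` (`SerrePair.exists_iso`).

For a Deligne product `⊠ : A × B ⥤ D` and Serre pairs `(P, I)`, `(P', I')` of the factors, the
functor `Hom(P, -) ⊗ Hom(P', -)` extends to `D` by the universal property, and the extension is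
represented by `P ⊠ P'` (`IsDeligneProduct.projective_and_bijective`). Therefore `P ⊠ P'` is
projective; it is a generator because the right exact functors `Hom(-, c)^*` on `D` are determined
by their values on pure tensors (`IsDeligneProduct.id_eq_zero`). Left exactness in both variables
then gives `Hom(a ⊠ b, a' ⊠ b') = Hom(a, a') ⊗ Hom(b, b')` in general
(`IsDeligneProduct.homTensorMap_bijective`), and `(P ⊠ P', I ⊠ I')` with the product of the two
forms is a Serre pair of `D` (`IsDeligneProduct.serrePair`).

A right exact functor is determined by its value on a projective generator with the action of
endomorphisms (`SerrePair.nonempty_iso_of_right`). Both `N^r` of `D` and the extension of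
`N^r a ⊠ N^r b` send `P ⊠ P'` to `I ⊠ I'`, with the same action of the endomorphisms `f ⊠ g`, which
span (`IsDeligneProduct.nonempty_iso_rightNakayama`). The statement for `N^l` follows by passing to
right adjoints (`IsDeligneProduct.nonempty_iso_rightAdjoint`), and its uniqueness from the dual fact
about left exact functors and injective cogenerators (`IsDeligneProduct.nonempty_iso_of_left`).
-/

namespace FiniteLinear

noncomputable section

/-! ### Morphisms out of `V ⊗ x` -/

section TensorOut

variable (k : Type w) [Field k] {X : Type u} [Category.{v} X] [Preadditive X] [Linear k X]
  [IsHomFiniteAdditive k X]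
  {V : Type u₁} [AddCommGroup V] [Module k V] [Module.Finite k V]
  {W : Type u₂} [AddCommGroup W] [Module k W] [Module.Finite k W]

variable (V) in
/-- The morphism `x ⟶ V ⊗ x` given by a vector of `V`. -/
def tensorInc (x : X) : V →ₗ[k] (x ⟶ (tensorObject k V x).pt) :=
  ((tensorObject k V x).equiv x).symm.toLinearMap ∘ₗ (TensorProduct.mk k V (x ⟶ x)).flip (𝟙 x)

theorem equiv_tensorInc (x : X) (v : V) :
    (tensorObject k V x).equiv x (tensorInc k V x v) = v ⊗ₜ 𝟙 x := by
  simp [tensorInc]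

theorem equiv_comp_tensorInc {z x : X} (f : z ⟶ x) (v : V) :
    (tensorObject k V x).equiv z (f ≫ tensorInc k V x v) = v ⊗ₜ f := by
  rw [TensorObject.equiv_comp, equiv_tensorInc]
  simp

/-- Evaluation of a family of morphisms `V → Hom(x, y)` on an element of `V ⊗ Hom(z, x)`. -/
def contractHom {x y : X} (φ : V →ₗ[k] (x ⟶ y)) (z : X) : V ⊗[k] (z ⟶ x) →ₗ[k] (z ⟶ y) :=
  TensorProduct.lift
    (LinearMap.mk₂ k (fun v g => g ≫ φ v) (by simp) (by simp) (by simp) (by simp))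

omit [IsHomFiniteAdditive k X] [Module.Finite k V] in
@[simp]
theorem contractHom_tmul {x y : X} (φ : V →ₗ[k] (x ⟶ y)) (z : X) (v : V) (g : z ⟶ x) :
    contractHom k φ z (v ⊗ₜ g) = g ≫ φ v := by
  simp [contractHom]

/-- The morphism `V ⊗ x ⟶ y` given by a linear map `V → Hom(x, y)`. -/
def tensorDesc {x y : X} (φ : V →ₗ[k] (x ⟶ y)) : (tensorObject k V x).pt ⟶ y :=
  contractHom k φ _ ((tensorObject k V x).equiv _ (𝟙 _))

theorem comp_tensorDesc {x y z : X} (φ : V →ₗ[k] (x ⟶ y)) (h : z ⟶ (tensorObject k V x).pt) :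
    h ≫ tensorDesc k φ = contractHom k φ z ((tensorObject k V x).equiv z h) := by
  rw [tensorDesc]
  conv_rhs => rw [← Category.comp_id h, TensorObject.equiv_comp]
  generalize (tensorObject k V x).equiv _ (𝟙 _) = t
  induction t with
  | zero => simp
  | tmul a b => simp
  | add a b ha hb => simp only [map_add, Preadditive.comp_add, ha, hb]

@[simp]
theorem tensorInc_tensorDesc {x y : X} (φ : V →ₗ[k] (x ⟶ y)) (v : V) :
    tensorInc k V x v ≫ tensorDesc k φ = φ v := by
  rw [comp_tensorDesc, equiv_tensorInc]
  simp

/-- `V ⊗ x` is a copower as well: morphisms out of it are detected on the morphisms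
`x ⟶ V ⊗ x` given by the vectors of `V`. -/
theorem tensor_hom_ext {x y : X} {f g : (tensorObject k V x).pt ⟶ y}
    (h : ∀ v, tensorInc k V x v ≫ f = tensorInc k V x v ≫ g) : f = g := by
  rw [← Category.id_comp f, ← Category.id_comp g,
    ← ((tensorObject k V x).equiv _).symm_apply_apply (𝟙 _)]
  generalize (tensorObject k V x).equiv _ (𝟙 _) = t
  induction t with
  | zero => simp
  | tmul a b =>
    have : ((tensorObject k V x).equiv _).symm (a ⊗ₜ b) = b ≫ tensorInc k V x a := by
      rw [LinearEquiv.symm_apply_eq, equiv_comp_tensorInc]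
    rw [this, Category.assoc, Category.assoc, h]
  | add a b ha hb => simp only [map_add, Preadditive.add_comp, ha, hb]

@[simp]
theorem tensorInc_tensorMap (φ : V →ₗ[k] W) {x y : X} (g : x ⟶ y) (v : V) :
    tensorInc k V x v ≫ tensorMap k φ g = g ≫ tensorInc k W y (φ v) := by
  apply ((tensorObject k W y).equiv _).injective
  rw [equiv_comp_tensorMap, equiv_tensorInc, equiv_comp_tensorInc]
  simp

theorem tensorInc_tensorMap_assoc (φ : V →ₗ[k] W) {x y z : X} (g : x ⟶ y) (v : V)
    (h : (tensorObject k W y).pt ⟶ z) :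
    tensorInc k V x v ≫ tensorMap k φ g ≫ h = g ≫ tensorInc k W y (φ v) ≫ h := by
  rw [← Category.assoc, tensorInc_tensorMap, Category.assoc]

end TensorOut

/-! ### Dinatural families -/

section Dinatural

variable (k : Type w) [Field k] {X : Type u} [Category.{v} X] [Preadditive X] [Linear k X]

/-- The space of families `t x ∈ Hom(x, y) ⊗ Hom(z, x)` that are dinatural in `x`. Both
`Hom(z, N^l y)` and `Hom(N^r z, y)` are identified with it. -/
def dinatural (z y : X) : Submodule k (∀ x : X, (x ⟶ y) ⊗[k] (z ⟶ x)) where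
  carrier := {t | ∀ ⦃x x' : X⦄ (f : x ⟶ x'),
    (Linear.leftComp k y f).rTensor _ (t x') = (Linear.rightComp k z f).lTensor _ (t x)}
  add_mem' hs ht _ _ f := by simp [hs f, ht f]
  zero_mem' _ _ f := by simp
  smul_mem' r _ ht _ _ f := by simp [ht f]

/-- The action of morphisms `z' ⟶ z` and `y ⟶ y'` on dinatural families. -/
def dinMap {z z' y y' : X} (g : z' ⟶ z) (h : y ⟶ y') :
    dinatural k z y →ₗ[k] dinatural k z' y' :=
  LinearMap.restrict
    (LinearMap.pi fun x =>
      TensorProduct.map (Linear.rightComp k x h) (Linear.leftComp k x g) ∘ₗ LinearMap.proj x)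
    (fun t ht x x' f => by
      have h₁ : (Linear.leftComp k y' f).rTensor (z' ⟶ x') ∘ₗ
          TensorProduct.map (Linear.rightComp k x' h) (Linear.leftComp k x' g) =
          TensorProduct.map (Linear.rightComp k x h) (Linear.leftComp k x' g) ∘ₗ
            (Linear.leftComp k y f).rTensor (z ⟶ x') := by
        ext; simp
      have h₂ : (Linear.rightComp k z' f).lTensor (x ⟶ y') ∘ₗ
          TensorProduct.map (Linear.rightComp k x h) (Linear.leftComp k x g) =
          TensorProduct.map (Linear.rightComp k x h) (Linear.leftComp k x' g) ∘ₗ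
            (Linear.rightComp k z f).lTensor (x ⟶ y) := by
        ext; simp
      have h₁' := LinearMap.congr_fun h₁ (t x')
      have h₂' := LinearMap.congr_fun h₂ (t x)
      simp only [LinearMap.comp_apply] at h₁' h₂'
      simp only [LinearMap.pi_apply, LinearMap.comp_apply, LinearMap.proj_apply]
      rw [h₁', h₂', ht f])

theorem dinMap_apply {z z' y y' : X} (g : z' ⟶ z) (h : y ⟶ y') (t : dinatural k z y) (x : X) :
    (dinMap k g h t).1 x =
      TensorProduct.map (Linear.rightComp k x h) (Linear.leftComp k x g) (t.1 x) := rfl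

theorem leftComp_id (x y : X) : Linear.leftComp k y (𝟙 x) = LinearMap.id := by
  ext f; simp

theorem rightComp_id (x y : X) : Linear.rightComp k x (𝟙 y) = LinearMap.id := by
  ext f; simp

theorem leftComp_comp {x x' x'' : X} (y : X) (f : x ⟶ x') (g : x' ⟶ x'') :
    Linear.leftComp k y (f ≫ g) = Linear.leftComp k y f ∘ₗ Linear.leftComp k y g := by
  ext; simp

theorem rightComp_comp (x : X) {y y' y'' : X} (f : y ⟶ y') (g : y' ⟶ y'') :
    Linear.rightComp k x (f ≫ g) = Linear.rightComp k x g ∘ₗ Linear.rightComp k x f := by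
  ext; simp

theorem dinMap_id {z y : X} (t : dinatural k z y) : dinMap k (𝟙 z) (𝟙 y) t = t := by
  ext x
  rw [dinMap_apply, leftComp_id, rightComp_id, TensorProduct.map_id, LinearMap.id_apply]

theorem dinMap_dinMap {z z' z'' y y' y'' : X} (g : z' ⟶ z) (h : y ⟶ y') (g' : z'' ⟶ z')
    (h' : y' ⟶ y'') (t : dinatural k z y) :
    dinMap k g' h' (dinMap k g h t) = dinMap k (g' ≫ g) (h ≫ h') t := by
  ext x
  simp only [dinMap_apply]
  rw [leftComp_comp, rightComp_comp, TensorProduct.map_comp, LinearMap.comp_apply]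

theorem dinMap_pre_post {z z' y y' : X} (g : z' ⟶ z) (h : y ⟶ y') (t : dinatural k z y) :
    dinMap k g (𝟙 _) (dinMap k (𝟙 _) h t) = dinMap k (𝟙 _) h (dinMap k g (𝟙 _) t) := by
  simp [dinMap_dinMap]

theorem dinMap_pre_pre {z z' z'' y : X} (g : z' ⟶ z) (g' : z'' ⟶ z') (t : dinatural k z y) :
    dinMap k g' (𝟙 _) (dinMap k g (𝟙 _) t) = dinMap k (g' ≫ g) (𝟙 _) t := by
  simp [dinMap_dinMap]

theorem dinMap_post_post {z y y' y'' : X} (h : y ⟶ y') (h' : y' ⟶ y'') (t : dinatural k z y) :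
    dinMap k (𝟙 _) h' (dinMap k (𝟙 _) h t) = dinMap k (𝟙 _) (h ≫ h') t := by
  simp [dinMap_dinMap]

theorem dinMap_add_left {z z' y y' : X} (g g' : z' ⟶ z) (h : y ⟶ y') (t : dinatural k z y) :
    dinMap k (g + g') h t = dinMap k g h t + dinMap k g' h t := by
  ext x
  have : Linear.leftComp k x (g + g') = Linear.leftComp k x g + Linear.leftComp k x g' := by
    ext; simp
  simp [dinMap_apply, this, TensorProduct.map_add_right]

theorem dinMap_add_right {z z' y y' : X} (g : z' ⟶ z) (h h' : y ⟶ y') (t : dinatural k z y) :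
    dinMap k g (h + h') t = dinMap k g h t + dinMap k g h' t := by
  ext x
  have : Linear.rightComp k x (h + h') = Linear.rightComp k x h + Linear.rightComp k x h' := by
    ext; simp
  simp [dinMap_apply, this, TensorProduct.map_add_left]

theorem dinMap_smul_left {z z' y y' : X} (r : k) (g : z' ⟶ z) (h : y ⟶ y')
    (t : dinatural k z y) : dinMap k (r • g) h t = r • dinMap k g h t := by
  ext x
  have : Linear.leftComp k x (r • g) = r • Linear.leftComp k x g := by
    ext; simp
  simp [dinMap_apply, this, TensorProduct.map_smul_right]

theorem dinMap_smul_right {z z' y y' : X} (r : k) (g : z' ⟶ z) (h : y ⟶ y')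
    (t : dinatural k z y) : dinMap k g (r • h) t = r • dinMap k g h t := by
  ext x
  have : Linear.rightComp k x (r • h) = r • Linear.rightComp k x h := by
    ext; simp
  simp [dinMap_apply, this, TensorProduct.map_smul_left]

/-- The linear map `g ↦ g^* ω` from `Hom(z, n)` to dinatural families. -/
def preMap {n y : X} (ω : dinatural k n y) (z : X) : (z ⟶ n) →ₗ[k] dinatural k z y where
  toFun g := dinMap k g (𝟙 y) ω
  map_add' _ _ := dinMap_add_left k _ _ _ _
  map_smul' _ _ := dinMap_smul_left k _ _ _ _

/-- The linear map `h ↦ h_* ω` from `Hom(n, y)` to dinatural families. -/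
def postMap {z n : X} (ω : dinatural k z n) (y : X) : (n ⟶ y) →ₗ[k] dinatural k z y where
  toFun h := dinMap k (𝟙 z) h ω
  map_add' _ _ := dinMap_add_right k _ _ _ _
  map_smul' _ _ := dinMap_smul_right k _ _ _ _

theorem preMap_apply {n y : X} (ω : dinatural k n y) {z : X} (g : z ⟶ n) :
    preMap k ω z g = dinMap k g (𝟙 y) ω := rfl

theorem postMap_apply {z n : X} (ω : dinatural k z n) {y : X} (h : n ⟶ y) :
    postMap k ω y h = dinMap k (𝟙 z) h ω := rfl

/-- The family `ω` exhibits `n` as a representing object of `z ↦ dinatural k z y`. -/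
def IsUniversalLeft {n y : X} (ω : dinatural k n y) : Prop :=
  ∀ z, Function.Bijective (preMap k ω z)

/-- The family `ω` exhibits `n` as a corepresenting object of `y ↦ dinatural k z y`. -/
def IsUniversalRight {z n : X} (ω : dinatural k z n) : Prop :=
  ∀ y, Function.Bijective (postMap k ω y)

/-- The functor `F` represents the dinatural families: `Hom(z, F y)` is naturally the space of
dinatural families from `z` to `y`. -/
def IsLeftNakayama (F : X ⥤ X) : Prop :=
  ∃ ω : ∀ y, dinatural k (F.obj y) y, (∀ y, IsUniversalLeft k (ω y)) ∧
    ∀ ⦃y y' : X⦄ (h : y ⟶ y'),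
      dinMap k (F.map h) (𝟙 y') (ω y') = dinMap k (𝟙 _) h (ω y)

/-- The functor `F` corepresents the dinatural families: `Hom(F z, y)` is naturally the space of
dinatural families from `z` to `y`. -/
def IsRightNakayama (F : X ⥤ X) : Prop :=
  ∃ ω : ∀ z, dinatural k z (F.obj z), (∀ z, IsUniversalRight k (ω z)) ∧
    ∀ ⦃z z' : X⦄ (g : z ⟶ z'),
      dinMap k (𝟙 z) (F.map g) (ω z) = dinMap k g (𝟙 _) (ω z')

end Dinatural

/-! ### Functors representing dinatural families -/

section Dinatural

variable (k : Type w) [Field k] {X : Type u} [Category.{v} X] [Preadditive X] [Linear k X]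

theorem IsUniversalLeft.injective {n y z : X} {ω : dinatural k n y} (hω : IsUniversalLeft k ω)
    {g g' : z ⟶ n} (h : dinMap k g (𝟙 y) ω = dinMap k g' (𝟙 y) ω) : g = g' :=
  (hω z).1 h

theorem IsUniversalLeft.exists_eq {n y z : X} {ω : dinatural k n y} (hω : IsUniversalLeft k ω)
    (t : dinatural k z y) : ∃ g : z ⟶ n, dinMap k g (𝟙 y) ω = t :=
  (hω z).2 t

theorem IsUniversalRight.injective {n y z : X} {ω : dinatural k z n}
    (hω : IsUniversalRight k ω) {h h' : n ⟶ y}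
    (e : dinMap k (𝟙 z) h ω = dinMap k (𝟙 z) h' ω) : h = h' :=
  (hω y).1 e

theorem IsUniversalRight.exists_eq {n y z : X} {ω : dinatural k z n}
    (hω : IsUniversalRight k ω) (t : dinatural k z y) :
    ∃ h : n ⟶ y, dinMap k (𝟙 z) h ω = t :=
  (hω y).2 t

variable {k}

theorem IsLeftNakayama.nonempty_iso {F F' : X ⥤ X} (hF : IsLeftNakayama k F)
    (hF' : IsLeftNakayama k F') : Nonempty (F ≅ F') := by
  obtain ⟨ω, hω, nat⟩ := hF
  obtain ⟨ω', hω', nat'⟩ := hF'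
  choose g hg using fun y => (hω' y).exists_eq k (ω y)
  choose g' hg' using fun y => (hω y).exists_eq k (ω' y)
  refine ⟨NatIso.ofComponents (fun y => ⟨g y, g' y, ?_, ?_⟩) ?_⟩
  · apply (hω y).injective
    rw [← dinMap_pre_pre, hg', hg, dinMap_id]
  · apply (hω' y).injective
    rw [← dinMap_pre_pre, hg, hg', dinMap_id]
  · intro y y' h
    apply (hω' y').injective
    dsimp only
    rw [← dinMap_pre_pre, ← dinMap_pre_pre, hg, nat, nat', dinMap_pre_post, hg]

theorem IsRightNakayama.nonempty_iso {F F' : X ⥤ X} (hF : IsRightNakayama k F)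
    (hF' : IsRightNakayama k F') : Nonempty (F ≅ F') := by
  obtain ⟨ω, hω, nat⟩ := hF
  obtain ⟨ω', hω', nat'⟩ := hF'
  choose g hg using fun y => (hω y).exists_eq k (ω' y)
  choose g' hg' using fun y => (hω' y).exists_eq k (ω y)
  refine ⟨NatIso.ofComponents (fun y => ⟨g y, g' y, ?_, ?_⟩) ?_⟩
  · apply (hω y).injective
    rw [← dinMap_post_post, hg, hg', dinMap_id]
  · apply (hω' y).injective
    rw [← dinMap_post_post, hg', hg, dinMap_id]
  · intro y y' h
    apply (hω y).injective
    dsimp only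
    rw [← dinMap_post_post, ← dinMap_post_post, hg, nat, nat', ← dinMap_pre_post, hg]

theorem IsLeftNakayama.additive {F : X ⥤ X} (hF : IsLeftNakayama k F) : F.Additive := by
  obtain ⟨ω, hω, nat⟩ := hF
  refine ⟨fun {y y' f g} => (hω y').injective k ?_⟩
  rw [dinMap_add_left, nat, nat, nat, dinMap_add_right]

theorem IsLeftNakayama.linear {F : X ⥤ X} (hF : IsLeftNakayama k F) : F.Linear k := by
  obtain ⟨ω, hω, nat⟩ := hF
  refine ⟨fun {y y'} f r => (hω y').injective k ?_⟩
  rw [dinMap_smul_left, nat, nat, dinMap_smul_right]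

theorem IsRightNakayama.additive {F : X ⥤ X} (hF : IsRightNakayama k F) : F.Additive := by
  obtain ⟨ω, hω, nat⟩ := hF
  refine ⟨fun {y y' f g} => (hω y).injective k ?_⟩
  rw [dinMap_add_right, nat, nat, nat, dinMap_add_left]

theorem IsRightNakayama.linear {F : X ⥤ X} (hF : IsRightNakayama k F) : F.Linear k := by
  obtain ⟨ω, hω, nat⟩ := hF
  refine ⟨fun {y y'} f r => (hω y).injective k ?_⟩
  rw [dinMap_smul_right, nat, nat, dinMap_smul_left]

/-- A functor corepresenting the dinatural families is left adjoint to one representing them. -/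
theorem nonempty_adjunction {R L : X ⥤ X} (hR : IsRightNakayama k R) (hL : IsLeftNakayama k L) :
    Nonempty (R ⊣ L) := by
  obtain ⟨ρ, hρ, natρ⟩ := hR
  obtain ⟨l, hl, natl⟩ := hL
  let e (z y : X) : (R.obj z ⟶ y) ≃ (z ⟶ L.obj y) :=
    (Equiv.ofBijective _ (hρ z y)).trans (Equiv.ofBijective _ (hl y z)).symm
  have he (z y : X) (h : R.obj z ⟶ y) :
      dinMap k (e z y h) (𝟙 y) (l y) = dinMap k (𝟙 z) h (ρ z) :=
    (Equiv.ofBijective _ (hl y z)).apply_symm_apply _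
  refine ⟨Adjunction.mkOfHomEquiv
    { homEquiv := e
      homEquiv_naturality_left_symm := ?_
      homEquiv_naturality_right := ?_ }⟩
  · intro z' z y f g
    obtain ⟨g, rfl⟩ := (e z y).surjective g
    rw [Equiv.symm_apply_eq, Equiv.symm_apply_apply]
    apply (hl y).injective
    rw [← dinMap_pre_pre, he, he, dinMap_pre_post, ← dinMap_post_post, natρ]
  · intro z y y' f g
    apply (hl y').injective
    rw [he, ← dinMap_pre_pre, natl, dinMap_pre_post, he, dinMap_post_post]

theorem IsLeftNakayama.isLeftExactLinear {R L : X ⥤ X} (hL : IsLeftNakayama k L)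
    (hR : IsRightNakayama k R) : IsLeftExactLinear k L := by
  obtain ⟨adj⟩ := nonempty_adjunction hR hL
  have := adj.rightAdjoint_preservesLimits
  exact ⟨hL.additive, hL.linear, inferInstance⟩

theorem IsRightNakayama.isRightExactLinear {R L : X ⥤ X} (hR : IsRightNakayama k R)
    (hL : IsLeftNakayama k L) : IsRightExactLinear k R := by
  obtain ⟨adj⟩ := nonempty_adjunction hR hL
  have := adj.leftAdjoint_preservesColimits
  exact ⟨hR.additive, hR.linear, inferInstance⟩

variable (k) in
/-- Passing to opposite morphisms, as a linear equivalence. -/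
def homOp (x y : X) : (x ⟶ y) ≃ₗ[k] (op y ⟶ op x) where
  toFun f := f.op
  invFun f := f.unop
  map_add' _ _ := rfl
  map_smul' _ _ := rfl
  left_inv _ := rfl
  right_inv _ := rfl

variable (k) in
/-- Dinatural families on the opposite category are obtained by exchanging the tensor factors. -/
def dinOp (z y : X) : dinatural k z y ≃ₗ[k] dinatural k (op y) (op z) where
  toFun t := ⟨fun x => TensorProduct.map (homOp k z x.unop).toLinearMap
      (homOp k x.unop y).toLinearMap (TensorProduct.comm k _ _ (t.1 x.unop)), by
    intro x x' f
    have ht := congrArg (fun s => TensorProduct.map (homOp k z x.unop).toLinearMap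
      (homOp k x'.unop y).toLinearMap (TensorProduct.comm k _ _ s)) (t.2 f.unop)
    dsimp only at ht ⊢
    have h₁ (s : (x.unop ⟶ y) ⊗[k] (z ⟶ x.unop)) :
        (Linear.rightComp k (op y) f).lTensor _ (TensorProduct.map (homOp k z x.unop).toLinearMap
          (homOp k x.unop y).toLinearMap (TensorProduct.comm k _ _ s)) =
        TensorProduct.map (homOp k z x.unop).toLinearMap (homOp k x'.unop y).toLinearMap
          (TensorProduct.comm k _ _ ((Linear.leftComp k y f.unop).rTensor _ s)) := by
      induction s with
      | zero => simp
      | tmul a b => rfl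
      | add a b ha hb => simp only [map_add, ha, hb]
    have h₂ (s : (x'.unop ⟶ y) ⊗[k] (z ⟶ x'.unop)) :
        (Linear.leftComp k (op z) f).rTensor _
          (TensorProduct.map (homOp k z x'.unop).toLinearMap
          (homOp k x'.unop y).toLinearMap (TensorProduct.comm k _ _ s)) =
        TensorProduct.map (homOp k z x.unop).toLinearMap (homOp k x'.unop y).toLinearMap
          (TensorProduct.comm k _ _ ((Linear.rightComp k z f.unop).lTensor _ s)) := by
      induction s with
      | zero => simp
      | tmul a b => rfl
      | add a b ha hb => simp only [map_add, ha, hb]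
    rw [h₁, h₂, ht]⟩
  invFun t := ⟨fun x => TensorProduct.comm k _ _ (TensorProduct.map
      (homOp k z x).symm.toLinearMap (homOp k x y).symm.toLinearMap (t.1 (op x))), by
    intro x x' f
    have ht := congrArg (fun s => TensorProduct.comm k _ _ (TensorProduct.map
      (homOp k z x').symm.toLinearMap (homOp k x y).symm.toLinearMap s)) (t.2 f.op)
    dsimp only at ht ⊢
    have h₁ (s : (op x ⟶ op z) ⊗[k] (op y ⟶ op x)) :
        (Linear.rightComp k z f).lTensor _ (TensorProduct.comm k _ _ (TensorProduct.map
          (homOp k z x).symm.toLinearMap (homOp k x y).symm.toLinearMap s)) =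
        TensorProduct.comm k _ _ (TensorProduct.map
          (homOp k z x').symm.toLinearMap (homOp k x y).symm.toLinearMap
          ((Linear.leftComp k (op z) f.op).rTensor _ s)) := by
      induction s with
      | zero => simp
      | tmul a b => rfl
      | add a b ha hb => simp only [map_add, ha, hb]
    have h₂ (s : (op x' ⟶ op z) ⊗[k] (op y ⟶ op x')) :
        (Linear.leftComp k y f).rTensor _ (TensorProduct.comm k _ _ (TensorProduct.map
          (homOp k z x').symm.toLinearMap (homOp k x' y).symm.toLinearMap s)) =
        TensorProduct.comm k _ _ (TensorProduct.map
          (homOp k z x').symm.toLinearMap (homOp k x y).symm.toLinearMap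
          ((Linear.rightComp k (op y) f.op).lTensor _ s)) := by
      induction s with
      | zero => simp
      | tmul a b => rfl
      | add a b ha hb => simp only [map_add, ha, hb]
    rw [h₁, h₂, ht]⟩
  map_add' s t := by ext x; simp
  map_smul' r t := by ext x; simp
  left_inv t := by
    ext x
    dsimp only
    generalize t.1 x = s
    induction s with
    | zero => simp
    | tmul a b => rfl
    | add a b ha hb => simp only [map_add, ha, hb]
  right_inv t := by
    ext x
    dsimp only
    change TensorProduct.map _ _ (TensorProduct.comm k _ _ (TensorProduct.comm k _ _
      (TensorProduct.map _ _ (t.1 x)))) = t.1 x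
    generalize t.1 x = s
    induction s with
    | zero => simp
    | tmul a b => rfl
    | add a b ha hb => simp only [map_add, ha, hb]

theorem dinOp_dinMap {z z' y y' : X} (g : z' ⟶ z) (h : y ⟶ y') (t : dinatural k z y) :
    dinOp k z' y' (dinMap k g h t) = dinMap k h.op g.op (dinOp k z y t) := by
  ext x
  change TensorProduct.map _ _ (TensorProduct.comm k _ _ (TensorProduct.map _ _ (t.1 x.unop))) =
    TensorProduct.map _ _ (TensorProduct.map _ _ (TensorProduct.comm k _ _ (t.1 x.unop)))
  generalize t.1 x.unop = s
  induction s with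
  | zero => simp
  | tmul a b => rfl
  | add a b ha hb => simp only [map_add, ha, hb]

theorem isUniversalRight_of_op {z n : X} {ω : dinatural k z n}
    (h : IsUniversalLeft k (dinOp k z n ω)) : IsUniversalRight k ω := by
  intro y
  have h₁ := h (op y)
  have : ⇑(preMap k (dinOp k z n ω) (op y)) ∘ homOp k n y =
      dinOp k z y ∘ postMap k ω y := by
    ext f
    simp only [Function.comp_apply, preMap_apply, postMap_apply, dinOp_dinMap]
    rfl
  have h₂ := h₁.comp (homOp k n y).bijective
  rw [this] at h₂
  exact (Function.Bijective.of_comp_iff' (dinOp k z y).bijective _).1 h₂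

theorem IsUniversalRight.op {z n : X} {ω : dinatural k z n}
    (h : IsUniversalRight k ω) : IsUniversalLeft k (dinOp k z n ω) := by
  intro y
  have : ⇑(preMap k (dinOp k z n ω) y) ∘ homOp k n y.unop =
      dinOp k z y.unop ∘ postMap k ω y.unop := by
    ext f
    simp only [Function.comp_apply, preMap_apply, postMap_apply, dinOp_dinMap]
    rfl
  have h₂ := (dinOp k z y.unop).bijective.comp (h y.unop)
  rw [← this] at h₂
  exact (Function.Bijective.of_comp_iff _ (homOp k n y.unop).bijective).1 h₂

theorem IsUniversalLeft.op {n y : X} {ω : dinatural k n y}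
    (h : IsUniversalLeft k ω) : IsUniversalRight k (dinOp k n y ω) := by
  intro z
  have : ⇑(postMap k (dinOp k n y ω) z) ∘ homOp k z.unop n =
      dinOp k z.unop y ∘ preMap k ω z.unop := by
    ext f
    simp only [Function.comp_apply, preMap_apply, postMap_apply, dinOp_dinMap]
    rfl
  have h₂ := (dinOp k z.unop y).bijective.comp (h z.unop)
  rw [← this] at h₂
  exact (Function.Bijective.of_comp_iff _ (homOp k z.unop n).bijective).1 h₂

theorem IsRightNakayama.op {F : X ⥤ X} (hF : IsRightNakayama k F) : IsLeftNakayama k F.op := by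
  obtain ⟨ω, hω, nat⟩ := hF
  refine ⟨fun z => dinOp k z.unop _ (ω z.unop), fun z => (hω z.unop).op, fun z z' h => ?_⟩
  have := congrArg (dinOp k _ _) (nat h.unop)
  rw [dinOp_dinMap, dinOp_dinMap] at this
  exact this

theorem IsLeftNakayama.op {F : X ⥤ X} (hF : IsLeftNakayama k F) : IsRightNakayama k F.op := by
  obtain ⟨ω, hω, nat⟩ := hF
  refine ⟨fun z => dinOp k _ z.unop (ω z.unop), fun z => (hω z.unop).op, fun z z' h => ?_⟩
  have := congrArg (dinOp k _ _) (nat h.unop)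
  rw [dinOp_dinMap, dinOp_dinMap] at this
  exact this

end Dinatural

/-! ### Ends and coends of dinatural families -/

section Nakayama

variable (k : Type w) [Field k] {X : Type u} [Category.{v} X] [Preadditive X] [Linear k X]
  [IsHomFiniteAdditive k X]

attribute [local instance] IsHomFiniteAdditive.finite_hom

/-- Morphisms `z ⟶ Hom(x, y) ⊗ x` form a wedge if and only if the corresponding elements of
`Hom(x, y) ⊗ Hom(z, x)` form a dinatural family. -/
theorem wedge_condition_iff {z y : X} (π : ∀ x, z ⟶ (tensorObject k (x ⟶ y) x).pt)
    {x x' : X} (f : x ⟶ x') :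
    π x ≫ tensorMap k LinearMap.id f = π x' ≫ tensorMap k (Linear.leftComp k y f) (𝟙 x') ↔
      (Linear.leftComp k y f).rTensor _ ((tensorObject k (x' ⟶ y) x').equiv z (π x')) =
        (Linear.rightComp k z f).lTensor _ ((tensorObject k (x ⟶ y) x).equiv z (π x)) := by
  rw [← ((tensorObject k (x ⟶ y) x').equiv z).injective.eq_iff, eq_comm, equiv_comp_tensorMap,
    equiv_comp_tensorMap, rightComp_id]
  rfl

theorem hasEnd_of_isUniversalLeft {n y : X} {ω : dinatural k n y} (hω : IsUniversalLeft k ω) :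
    HasEnd ((homTensor k X).obj y) := by
  let p (x : X) : n ⟶ (tensorObject k (x ⟶ y) x).pt :=
    ((tensorObject k (x ⟶ y) x).equiv n).symm (ω.1 x)
  have hp (x : X) : (tensorObject k (x ⟶ y) x).equiv n (p x) = ω.1 x :=
    LinearEquiv.apply_symm_apply _ _
  let c : Wedge ((homTensor k X).obj y) := Wedge.mk n p (fun x x' f => by
    refine (wedge_condition_iff k p f).2 ?_
    rw [hp, hp]
    exact ω.2 f)
  have key {z : X} (g : z ⟶ n) (x : X) : (tensorObject k (x ⟶ y) x).equiv z (g ≫ p x) =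
      (dinMap k g (𝟙 y) ω).1 x := by
    rw [TensorObject.equiv_comp, hp, dinMap_apply, rightComp_id]
    rfl
  let q (s : Wedge ((homTensor k X).obj y)) (x : X) : s.pt ⟶ (tensorObject k (x ⟶ y) x).pt :=
    s.ι x
  let fam (s : Wedge ((homTensor k X).obj y)) : dinatural k s.pt y :=
    ⟨fun x => (tensorObject k (x ⟶ y) x).equiv s.pt (q s x), fun x x' f =>
      (wedge_condition_iff k (q s) f).1 (Wedge.condition (J := X) s f)⟩
  choose l hl using fun s : Wedge ((homTensor k X).obj y) => hω.exists_eq k (fam s)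
  have hc : IsLimit c := by
    refine Multifork.IsLimit.mk c l ?_ ?_
    · intro s (x : X)
      apply ((tensorObject k (x ⟶ y) x).equiv s.pt).injective
      exact (key (l s) x).trans (congrArg (fun t => t.1 x) (hl s))
    · intro s m hm
      apply hω.injective
      rw [hl]
      ext x
      exact (key m x).symm.trans (congrArg ((tensorObject k (x ⟶ y) x).equiv s.pt) (hm x))
  exact ⟨⟨c, hc⟩⟩

theorem isLeftNakayama_leftNakayama [HasNakayamaFunctors k X] :
    IsLeftNakayama k (leftNakayama k X) := by
  let p (y x : X) : (leftNakayama k X).obj y ⟶ (tensorObject k (x ⟶ y) x).pt :=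
    end_.π ((homTensor k X).obj y) x
  let ω (y : X) : dinatural k ((leftNakayama k X).obj y) y :=
    ⟨fun x => (tensorObject k (x ⟶ y) x).equiv _ (p y x), fun x x' f =>
      (wedge_condition_iff k (p y) f).1 (end_.condition _ f)⟩
  have key {z y : X} (g : z ⟶ (leftNakayama k X).obj y) (x : X) :
      (tensorObject k (x ⟶ y) x).equiv z (g ≫ p y x) =
      (dinMap k g (𝟙 y) (ω y)).1 x := by
    rw [TensorObject.equiv_comp, dinMap_apply, rightComp_id]
    rfl
  refine ⟨ω, fun y z => ⟨fun g g' h => ?_, fun t => ?_⟩, fun y y' h => ?_⟩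
  · refine end_.hom_ext (F := (homTensor k X).obj y) fun x => ?_
    apply ((tensorObject k (x ⟶ y) x).equiv z).injective
    exact (key g x).trans ((congrArg (fun t => t.1 x) h).trans (key g' x).symm)
  · let q (x : X) : z ⟶ (tensorObject k (x ⟶ y) x).pt :=
      ((tensorObject k (x ⟶ y) x).equiv z).symm (t.1 x)
    have hq (x : X) : (tensorObject k (x ⟶ y) x).equiv z (q x) = t.1 x :=
      LinearEquiv.apply_symm_apply _ _
    refine ⟨end_.lift (F := (homTensor k X).obj y) q (fun x x' f => ?_), ?_⟩
    · refine (wedge_condition_iff k q f).2 ?_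
      rw [hq, hq]
      exact t.2 f
    · ext x
      refine Eq.trans ((key _ x).symm.trans ?_) (hq x)
      exact congrArg _ (end_.lift_π (F := (homTensor k X).obj y) _ _ _)
  · ext x
    have : (leftNakayama k X).map h ≫ p y' x =
        p y x ≫ tensorMap k (Linear.rightComp k x h) (𝟙 x) :=
      end_.map_π _ _
    refine (key _ x).symm.trans ?_
    rw [this, equiv_comp_tensorMap, rightComp_id, dinMap_apply, leftComp_id]

section DualTensor

variable {V : Type u₁} [AddCommGroup V] [Module k V] {V' : Type u₂} [AddCommGroup V'] [Module k V']
  {W : Type u₃} [AddCommGroup W] [Module k W] {W' : Type u₄} [AddCommGroup W'] [Module k W']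

/-- Evaluation of the second factor of `W ⊗ V` at functionals on `V`. -/
def evalRight : W ⊗[k] V →ₗ[k] (Module.Dual k V →ₗ[k] W) :=
  TensorProduct.lift (LinearMap.mk₂ k
    (fun g f => (Module.Dual.eval k V f).smulRight g)
    (fun _ _ _ => by ext; simp [smul_add]) (fun _ _ _ => by ext; simp [smul_smul, mul_comm])
    (fun _ _ _ => by ext; simp [add_smul]) (fun _ _ _ => by ext; simp [mul_smul]))

@[simp]
theorem evalRight_tmul (g : W) (f : V) (ξ : Module.Dual k V) :
    evalRight k (g ⊗ₜ f) ξ = ξ f • g := by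
  simp [evalRight]

theorem evalRight_lTensor (ψ : V →ₗ[k] V') (s : W ⊗[k] V) (ξ : Module.Dual k V') :
    evalRight k (ψ.lTensor W s) ξ = evalRight k s (ψ.dualMap ξ) := by
  induction s with
  | zero => simp
  | tmul a b => simp
  | add a b ha hb => simp only [map_add, LinearMap.add_apply, ha, hb]

theorem evalRight_rTensor (ψ : W →ₗ[k] W') (s : W ⊗[k] V) (ξ : Module.Dual k V) :
    evalRight k (ψ.rTensor V s) ξ = ψ (evalRight k s ξ) := by
  induction s with
  | zero => simp
  | tmul a b => simp
  | add a b ha hb => simp only [map_add, LinearMap.add_apply, ha, hb]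

/-- `W ⊗ V ≅ Hom(V^*, W)` for finite-dimensional `V`. -/
theorem evalRight_bijective [Module.Finite k V] :
    Function.Bijective (evalRight k : W ⊗[k] V →ₗ[k] _) := by
  let b := Module.finBasis k V
  constructor
  · refine (injective_iff_map_eq_zero (evalRight k)).2 fun s hs => ?_
    obtain ⟨c, rfl⟩ := (TensorProduct.equivFinsuppOfBasisRight b).symm.surjective s
    have h (i) : c i = 0 := by
      have := LinearMap.congr_fun hs (b.coord i)
      simpa [Finsupp.sum_fintype, Finsupp.single_apply] using this
    have : c = 0 := by ext i; exact h i
    simp [this]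
  · intro φ
    refine ⟨∑ i, φ (b.coord i) ⊗ₜ b i, ?_⟩
    ext ξ
    simp only [map_sum, LinearMap.sum_apply, evalRight_tmul, ← map_smul]
    rw [← map_sum]
    congr 1
    exact b.ext fun i => by simp

variable [Module.Finite k V] [Module.Finite k V']

/-- The morphism `V^* ⊗ x ⟶ y` given by an element of `Hom(x, y) ⊗ V`. -/
def dualTensorDesc {x y : X} (s : (x ⟶ y) ⊗[k] V) :
    (tensorObject k (Module.Dual k V) x).pt ⟶ y :=
  tensorDesc k (evalRight k s)

theorem dualTensorDesc_bijective (x y : X) :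
    Function.Bijective (dualTensorDesc k : (x ⟶ y) ⊗[k] V → _) := by
  constructor
  · intro s s' h
    apply (evalRight_bijective k).1
    ext ξ
    have := congrArg (fun f => tensorInc k (Module.Dual k V) x ξ ≫ f) h
    simpa [dualTensorDesc] using this
  · intro u
    let φ : Module.Dual k V →ₗ[k] (x ⟶ y) :=
      Linear.rightComp k x u ∘ₗ tensorInc k (Module.Dual k V) x
    obtain ⟨s, hs⟩ := (evalRight_bijective (V := V) k).2 φ
    refine ⟨s, tensor_hom_ext k fun ξ => ?_⟩
    simp [dualTensorDesc, hs, φ]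

theorem dualTensorDesc_comp {x y y' : X} (s : (x ⟶ y) ⊗[k] V) (h : y ⟶ y') :
    dualTensorDesc k s ≫ h = dualTensorDesc k ((Linear.rightComp k x h).rTensor V s) := by
  refine tensor_hom_ext k fun ξ => ?_
  rw [← Category.assoc]
  simp [dualTensorDesc, evalRight_rTensor]

theorem dualMap_dualTensorDesc {x y : X} (ψ : V →ₗ[k] V') (s : (x ⟶ y) ⊗[k] V) :
    tensorMap k ψ.dualMap (𝟙 x) ≫ dualTensorDesc k s =
      dualTensorDesc k (ψ.lTensor (x ⟶ y) s) := by
  refine tensor_hom_ext k fun ξ => ?_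
  rw [← Category.assoc]
  simp [dualTensorDesc, evalRight_lTensor]

theorem tensorMap_id_dualTensorDesc {x x' y : X} (f : x ⟶ x') (s : (x' ⟶ y) ⊗[k] V) :
    tensorMap k (LinearMap.id : Module.Dual k V →ₗ[k] _) f ≫ dualTensorDesc k s =
      dualTensorDesc k ((Linear.leftComp k y f).rTensor V s) := by
  refine tensor_hom_ext k fun ξ => ?_
  rw [← Category.assoc]
  simp [dualTensorDesc, evalRight_rTensor]

end DualTensor

/-- Morphisms `Hom(z, x)^* ⊗ x ⟶ y` form a cowedge if and only if the corresponding elements of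
`Hom(x, y) ⊗ Hom(z, x)` form a dinatural family. -/
theorem cowedge_condition_iff {z y : X} (t : ∀ x : X, (x ⟶ y) ⊗[k] (z ⟶ x))
    {x x' : X} (f : x ⟶ x') :
    tensorMap k (Linear.rightComp k z f).dualMap (𝟙 x) ≫ dualTensorDesc k (t x) =
        tensorMap k LinearMap.id f ≫ dualTensorDesc k (t x') ↔
      (Linear.leftComp k y f).rTensor _ (t x') = (Linear.rightComp k z f).lTensor _ (t x) := by
  rw [dualMap_dualTensorDesc, tensorMap_id_dualTensorDesc,
    (dualTensorDesc_bijective k x y).1.eq_iff, eq_comm]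

theorem hasCoend_of_isUniversalRight {z n : X} {ω : dinatural k z n}
    (hω : IsUniversalRight k ω) : HasCoend ((dualHomTensor k X).obj z) := by
  let p (x : X) : (tensorObject k (Module.Dual k (z ⟶ x)) x).pt ⟶ n :=
    dualTensorDesc k (ω.1 x)
  let c : Cowedge ((dualHomTensor k X).obj z) := Cowedge.mk n p (fun x x' f =>
    (cowedge_condition_iff k ω.1 f).2 (ω.2 f))
  have key {y : X} (g : n ⟶ y) (x : X) : p x ≫ g =
      dualTensorDesc k ((dinMap k (𝟙 z) g ω).1 x) := by
    rw [dualTensorDesc_comp, dinMap_apply, leftComp_id]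
    rfl
  choose q hq using fun (s : Cowedge ((dualHomTensor k X).obj z)) (x : X) =>
    (dualTensorDesc_bijective k (V := z ⟶ x) x s.pt).2 (s.π x)
  let fam (s : Cowedge ((dualHomTensor k X).obj z)) : dinatural k z s.pt :=
    ⟨q s, fun x x' f => (cowedge_condition_iff k (q s) f).1 (by
      rw [hq, hq]
      exact Cowedge.condition (J := X) s f)⟩
  choose l hl using fun s : Cowedge ((dualHomTensor k X).obj z) => hω.exists_eq k (fam s)
  have hc : IsColimit c := Multicofork.IsColimit.mk c l
    (fun s x => by
      refine (key (l s) x).trans ?_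
      rw [hl]
      exact hq s x)
    (fun s m hm => by
      apply hω.injective
      rw [hl]
      ext x
      apply (dualTensorDesc_bijective k x s.pt).1
      exact (key m x).symm.trans ((hm x).trans (hq s x).symm))
  exact ⟨⟨c, hc⟩⟩

theorem isRightNakayama_rightNakayama [HasNakayamaFunctors k X] :
    IsRightNakayama k (rightNakayama k X) := by
  let p (z x : X) : (tensorObject k (Module.Dual k (z ⟶ x)) x).pt ⟶ (rightNakayama k X).obj z :=
    coend.ι ((dualHomTensor k X).obj z) x
  choose q hq using fun (z x : X) =>
    (dualTensorDesc_bijective k (V := z ⟶ x) x ((rightNakayama k X).obj z)).2 (p z x)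
  let ω (z : X) : dinatural k z ((rightNakayama k X).obj z) :=
    ⟨q z, fun x x' f => (cowedge_condition_iff k (q z) f).1 (by
      rw [hq, hq]
      exact coend.condition ((dualHomTensor k X).obj z) f)⟩
  have key {z y : X} (g : (rightNakayama k X).obj z ⟶ y) (x : X) :
      p z x ≫ g = dualTensorDesc k ((dinMap k (𝟙 z) g (ω z)).1 x) := by
    rw [← hq, dualTensorDesc_comp, dinMap_apply, leftComp_id]
    rfl
  refine ⟨ω, fun z y => ⟨fun g g' h => ?_, fun t => ?_⟩, fun z z' h => ?_⟩
  · refine coend.hom_ext (F := (dualHomTensor k X).obj z) fun x => ?_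
    refine (key g x).trans (Eq.trans ?_ (key g' x).symm)
    exact congrArg (fun t : dinatural k z y => dualTensorDesc k (t.1 x)) h
  · let d (x : X) : (tensorObject k (Module.Dual k (z ⟶ x)) x).pt ⟶ y := dualTensorDesc k (t.1 x)
    refine ⟨coend.desc (F := (dualHomTensor k X).obj z) d (fun x x' f =>
      (cowedge_condition_iff k t.1 f).2 (t.2 f)), ?_⟩
    ext x
    apply (dualTensorDesc_bijective k x y).1
    exact (key _ x).symm.trans (coend.ι_desc (F := (dualHomTensor k X).obj z) _ _ _)
  · ext x
    apply (dualTensorDesc_bijective k x _).1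
    have : p z x ≫ (rightNakayama k X).map h =
        tensorMap k (Linear.leftComp k x h).dualMap (𝟙 x) ≫ p z' x :=
      coend.ι_map _ _
    refine (key _ x).symm.trans ?_
    rw [this, ← hq, dualMap_dualTensorDesc, dinMap_apply, rightComp_id]
    rfl

end Nakayama

attribute [local instance] IsHomFiniteAdditive.finite_hom

/-! ### Abelian categories as a property of preadditive categories -/

/-- The property of a preadditive category of being abelian. `Abelian` is data that contains a
preadditive structure, so the given structure has to be identified with that one. -/
class IsAbelianCat (X : Type u) [Category.{v} X] [inst : Preadditive X] : Prop where
  exists_abelian : ∃ a : Abelian X, a.toPreadditive = inst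

section IsAbelianCat

variable (X : Type u) [Category.{v} X] [Preadditive X] [IsAbelianCat X]

instance IsAbelianCat.op : IsAbelianCat Xᵒᵖ := by
  obtain ⟨a, rfl⟩ := IsAbelianCat.exists_abelian (X := X)
  exact ⟨inferInstance, rfl⟩

theorem IsAbelianCat.hasFiniteBiproducts : HasFiniteBiproducts X := by
  obtain ⟨a, rfl⟩ := IsAbelianCat.exists_abelian (X := X)
  exact Abelian.hasFiniteBiproducts

theorem IsAbelianCat.hasFiniteLimits : HasFiniteLimits X := by
  obtain ⟨a, rfl⟩ := IsAbelianCat.exists_abelian (X := X)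
  infer_instance

theorem IsAbelianCat.hasFiniteColimits : HasFiniteColimits X := by
  obtain ⟨a, rfl⟩ := IsAbelianCat.exists_abelian (X := X)
  infer_instance

theorem IsAbelianCat.balanced : Balanced X := by
  obtain ⟨a, rfl⟩ := IsAbelianCat.exists_abelian (X := X)
  infer_instance

attribute [local instance] IsAbelianCat.hasFiniteBiproducts IsAbelianCat.hasFiniteLimits
  IsAbelianCat.hasFiniteColimits

variable {X}

theorem IsAbelianCat.exists_copresentation {x y z : X} (f : x ⟶ y) [Mono f]
    (hz : ∀ c : X, ∃ (n : ℕ) (g : c ⟶ ⨁ fun _ : Fin n => z), Mono g) :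
    ∃ (n : ℕ) (r : y ⟶ ⨁ fun _ : Fin n => z) (h : f ≫ r = 0),
      Nonempty (IsLimit (KernelFork.ofι f h)) := by
  obtain ⟨a, rfl⟩ := IsAbelianCat.exists_abelian (X := X)
  obtain ⟨n, g, hg⟩ := hz (cokernel f)
  have hf := Abelian.monoIsKernelOfCokernel
    (CokernelCofork.ofπ (cokernel.π f) (cokernel.condition f)) (cokernelIsCokernel f)
  exact ⟨n, cokernel.π f ≫ g, by simp, ⟨isKernelCompMono hf g rfl⟩⟩

theorem IsAbelianCat.exists_presentation {x y z : X} (f : x ⟶ y) [Epi f]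
    (hz : ∀ c : X, ∃ (n : ℕ) (g : (⨁ fun _ : Fin n => z) ⟶ c), Epi g) :
    ∃ (n : ℕ) (r : (⨁ fun _ : Fin n => z) ⟶ x) (h : r ≫ f = 0),
      Nonempty (IsColimit (CokernelCofork.ofπ f h)) := by
  obtain ⟨a, rfl⟩ := IsAbelianCat.exists_abelian (X := X)
  obtain ⟨n, g, hg⟩ := hz (kernel f)
  have hf := Abelian.epiIsCokernelOfKernel
    (KernelFork.ofι (kernel.ι f) (kernel.condition f)) (kernelIsKernel f)
  exact ⟨n, g ≫ kernel.ι f, by simp, ⟨isCokernelEpiComp hf g rfl⟩⟩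

end IsAbelianCat

/-! ### Serre pairs -/

/-- A pair of objects `P`, `I` with a linear form on `Hom(P, I)` that makes the pairings
`Hom(P, x) × Hom(x, I) → Hom(P, I) → k` perfect, such that `P` is a separator. Then `P` is a
projective generator, `I` is an injective cogenerator, and the two Nakayama functors interchange
`P` and `I`. -/
structure SerrePair (k : Type w) [Field k] (X : Type u) [Category.{v} X] [Preadditive X]
    [Linear k X] where
  P : X
  I : X
  form : (P ⟶ I) →ₗ[k] k
  perfect (x : X) : Function.Bijective
    (fun (g : x ⟶ I) => (form ∘ₗ Linear.rightComp k P g : Module.Dual k (P ⟶ x)))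
  separator {x y : X} (f : x ⟶ y) (hf : ∀ u : P ⟶ x, u ≫ f = 0) : f = 0

namespace SerrePair

variable {k : Type w} [Field k] {X : Type u} [Category.{v} X] [Preadditive X] [Linear k X]
  (S : SerrePair k X)

theorem form_right_ext {x : X} {g g' : x ⟶ S.I}
    (h : ∀ f : S.P ⟶ x, S.form (f ≫ g) = S.form (f ≫ g')) : g = g' :=
  (S.perfect x).1 (LinearMap.ext fun f => by simpa using h f)

theorem exists_right (x : X) (ξ : Module.Dual k (S.P ⟶ x)) :
    ∃ g : x ⟶ S.I, ∀ f, S.form (f ≫ g) = ξ f := by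
  obtain ⟨g, hg⟩ := (S.perfect x).2 ξ
  exact ⟨g, fun f => by simpa using LinearMap.congr_fun hg f⟩

theorem form_left_ext {x : X} {f f' : S.P ⟶ x}
    (h : ∀ g : x ⟶ S.I, S.form (f ≫ g) = S.form (f' ≫ g)) : f = f' := by
  rw [← sub_eq_zero, ← Module.forall_dual_apply_eq_zero_iff k]
  intro ξ
  obtain ⟨g, hg⟩ := S.exists_right x ξ
  rw [← hg, Preadditive.sub_comp, map_sub, h, sub_self]

theorem coseparator {x y : X} (f : x ⟶ y) (hf : ∀ g : y ⟶ S.I, f ≫ g = 0) : f = 0 := by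
  refine S.separator f fun u => S.form_left_ext fun g => ?_
  simp [hf]

variable [IsHomFiniteAdditive k X]

theorem exists_left (x : X) (ξ : Module.Dual k (x ⟶ S.I)) :
    ∃ f : S.P ⟶ x, ∀ g, S.form (f ≫ g) = ξ g := by
  let φ : (S.P ⟶ x) →ₗ[k] Module.Dual k (x ⟶ S.I) :=
    LinearMap.mk₂ k (fun f g => S.form (f ≫ g)) (by simp) (by simp) (by simp) (by simp)
  let ψ : (x ⟶ S.I) ≃ₗ[k] Module.Dual k (S.P ⟶ x) :=
    LinearEquiv.ofBijective φ.flip (S.perfect x)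
  have hφ : Function.Injective φ := fun f f' h =>
    S.form_left_ext fun g => LinearMap.congr_fun h g
  have h : Module.finrank k (S.P ⟶ x) = Module.finrank k (Module.Dual k (x ⟶ S.I)) := by
    rw [Subspace.dual_finrank_eq, ψ.finrank_eq, Subspace.dual_finrank_eq]
  -- the injection `Hom(P, x) → Hom(x, I)^*` is surjective for dimension reasons
  obtain ⟨f, hf⟩ := (LinearMap.injective_iff_surjective_of_finrank_eq_finrank h).1 hφ ξ
  exact ⟨f, fun g => LinearMap.congr_fun hf g⟩

/-- The opposite category has a Serre pair as well, with the two objects interchanged. -/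
def op : SerrePair k Xᵒᵖ where
  P := Opposite.op S.I
  I := Opposite.op S.P
  form := S.form ∘ₗ (homOp k S.P S.I).symm.toLinearMap
  perfect x := by
    constructor
    · intro g g' h
      apply Quiver.Hom.unop_inj
      refine S.form_left_ext fun f => ?_
      exact LinearMap.congr_fun h f.op
    · intro ξ
      obtain ⟨f, hf⟩ := S.exists_left x.unop (ξ ∘ₗ (homOp k x.unop S.I).toLinearMap)
      exact ⟨f.op, LinearMap.ext fun g => hf g.unop⟩
  separator f hf := by
    apply Quiver.Hom.unop_inj
    refine S.coseparator f.unop fun g => ?_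
    exact congrArg Quiver.Hom.unop (hf g.op)

/-- The functional `f ↦ form (f ≫ g)`. -/
def rightForm {x : X} (g : x ⟶ S.I) : Module.Dual k (S.P ⟶ x) :=
  S.form ∘ₗ Linear.rightComp k S.P g

/-- The functional `g ↦ form (f ≫ g)`. -/
def leftForm {x : X} (f : S.P ⟶ x) : Module.Dual k (x ⟶ S.I) :=
  S.form ∘ₗ Linear.leftComp k S.I f

omit [IsHomFiniteAdditive k X] in
@[simp]
theorem rightForm_apply {x : X} (g : x ⟶ S.I) (f : S.P ⟶ x) :
    S.rightForm g f = S.form (f ≫ g) := rfl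

/-- The tensor inverse to the perfect pairing `Hom(P, x) × Hom(x, I) → k`. -/
theorem exists_copairing (x : X) : ∃ s : (x ⟶ S.I) ⊗[k] (S.P ⟶ x),
    ∀ g, evalRight k s (S.rightForm g) = g := by
  let φ : (x ⟶ S.I) →ₗ[k] Module.Dual k (S.P ⟶ x) :=
    LinearMap.mk₂ k (fun g f => S.form (f ≫ g)) (by simp) (by simp) (by simp) (by simp)
  let ψ : (x ⟶ S.I) ≃ₗ[k] Module.Dual k (S.P ⟶ x) :=
    LinearEquiv.ofBijective φ (S.perfect x)
  obtain ⟨s, hs⟩ := (evalRight_bijective (V := S.P ⟶ x) k).2 ψ.symm.toLinearMap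
  exact ⟨s, fun g => by rw [hs]; exact ψ.symm_apply_apply g⟩

theorem evalRight_ext {V : Type u₁} [AddCommGroup V] [Module k V] {x : X}
    {s s' : V ⊗[k] (S.P ⟶ x)}
    (h : ∀ g, evalRight k s (S.rightForm g) = evalRight k s' (S.rightForm g)) : s = s' := by
  apply (evalRight_bijective k).1
  ext ξ
  obtain ⟨g, hg⟩ := S.exists_right x ξ
  have : ξ = S.rightForm g := LinearMap.ext fun f => (hg f).symm
  rw [this, h]

theorem evalLeft_ext {V : Type u₁} [AddCommGroup V] [Module k V] {x : X}
    {s s' : (x ⟶ S.I) ⊗[k] V}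
    (h : ∀ f, evalRight k (TensorProduct.comm k _ _ s) (S.leftForm f) =
      evalRight k (TensorProduct.comm k _ _ s') (S.leftForm f)) : s = s' := by
  apply (TensorProduct.comm k _ _).injective
  apply (evalRight_bijective k).1
  ext ξ
  obtain ⟨f, hf⟩ := S.exists_left x ξ
  have : ξ = S.leftForm f := LinearMap.ext fun g => (hf g).symm
  rw [this, h]

variable (k) in
omit [IsHomFiniteAdditive k X] [Linear k X] [Preadditive X] [Category.{v} X] in
theorem evalRight_comm {V : Type u₁} [AddCommGroup V] [Module k V] {W : Type u₂}
    [AddCommGroup W] [Module k W] (s : W ⊗[k] V) (ξ : Module.Dual k V) (η : Module.Dual k W) :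
    ξ (evalRight k (TensorProduct.comm k _ _ s) η) = η (evalRight k s ξ) := by
  induction s with
  | zero => simp
  | tmul a b => simp [mul_comm]
  | add a b ha hb => simp only [map_add, LinearMap.add_apply, ha, hb]

/-- The copairings of the pairings `Hom(P, x) × Hom(x, I) → k` form a dinatural family that
represents the dinatural families into `I` by `P` and corepresents those out of `P` by `I`. -/
theorem exists_universal : ∃ ω : dinatural k S.P S.I,
    IsUniversalLeft k ω ∧ IsUniversalRight k ω ∧
    ∀ (e : S.P ⟶ S.P) (e' : S.I ⟶ S.I), dinMap k e (𝟙 _) ω = dinMap k (𝟙 _) e' ω →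
      ∀ u, S.form (e ≫ u) = S.form (u ≫ e') := by
  choose c hc using S.exists_copairing
  have hc' (x : X) (f : S.P ⟶ x) :
      evalRight k (TensorProduct.comm k _ _ (c x)) (S.leftForm f) = f := by
    refine S.form_left_ext fun g => ?_
    have := evalRight_comm k (c x) (S.rightForm g) (S.leftForm f)
    rwa [hc] at this
  have pre {x z : X} (g : z ⟶ S.P) (ξ : Module.Dual k (z ⟶ x)) :
      evalRight k (TensorProduct.map (Linear.rightComp k x (𝟙 S.I)) (Linear.leftComp k x g)
        (c x)) ξ = evalRight k (c x) (ξ ∘ₗ Linear.leftComp k x g) := by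
    rw [rightComp_id]
    exact evalRight_lTensor k _ _ _
  have post {x y : X} (h : S.I ⟶ y) (ξ : Module.Dual k (S.P ⟶ x)) :
      evalRight k (TensorProduct.map (Linear.rightComp k x h) (Linear.leftComp k x (𝟙 S.P))
        (c x)) ξ = evalRight k (c x) ξ ≫ h := by
    rw [leftComp_id]
    exact evalRight_rTensor k _ _ _
  let ω : dinatural k S.P S.I := ⟨c, fun x x' f => by
    refine S.evalRight_ext fun g => ?_
    rw [evalRight_rTensor, evalRight_lTensor, hc]
    have : (Linear.rightComp k S.P f).dualMap (S.rightForm g) = S.rightForm (f ≫ g) := by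
      ext; simp
    rw [this, hc]
    simp⟩
  refine ⟨ω, fun z => ⟨fun g g' h => ?_, fun t => ?_⟩, fun y => ⟨fun h h' e => ?_, fun t => ?_⟩,
    fun e e' h u => ?_⟩
  -- `g : z ⟶ P` is recovered from its family by evaluating the component at `P` at `𝟙 P`
  · have key (g : z ⟶ S.P) : evalRight k (TensorProduct.comm k _ _ ((preMap k ω z g).1 S.P))
        (S.leftForm (𝟙 S.P)) = g := by
      rw [preMap_apply, dinMap_apply, rightComp_id, ← TensorProduct.map_comm,
        ← LinearMap.rTensor_def, evalRight_rTensor, hc']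
      simp
    rw [← key g, h, key]
  -- a family comes from the evaluation of its component at `P` at the form on `Hom(P, I)`
  · refine ⟨evalRight k (TensorProduct.comm k _ _ (t.1 S.P)) S.form, ?_⟩
    ext x
    refine S.evalLeft_ext fun f => ?_
    rw [preMap_apply, dinMap_apply, rightComp_id, ← TensorProduct.map_comm,
      ← LinearMap.rTensor_def, evalRight_rTensor, hc']
    have := congrArg (fun s => evalRight k (TensorProduct.comm k _ _ s) S.form) (t.2 f)
    rw [LinearMap.rTensor_def, LinearMap.lTensor_def, ← TensorProduct.map_comm,
      ← TensorProduct.map_comm, ← LinearMap.rTensor_def, ← LinearMap.lTensor_def,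
      evalRight_rTensor, evalRight_lTensor] at this
    exact this.symm
  · have key (h : S.I ⟶ y) : evalRight k ((postMap k ω y h).1 S.I) (S.rightForm (𝟙 S.I)) = h := by
      rw [postMap_apply, dinMap_apply, post, hc, Category.id_comp]
    rw [← key h, e, key]
  · refine ⟨evalRight k (t.1 S.I) S.form, ?_⟩
    ext x
    refine S.evalRight_ext fun g => ?_
    rw [postMap_apply, dinMap_apply, post, hc]
    have := congrArg (fun s => evalRight k s S.form) (t.2 g)
    rw [evalRight_rTensor, evalRight_lTensor] at this
    exact this
  -- evaluating at `form` turns the equation into `form (e ≫ -) = form (- ≫ e')`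
  · have := congrArg (fun t => evalRight k (t.1 S.I) (S.rightForm (𝟙 S.I))) h
    rw [dinMap_apply, dinMap_apply, pre, post, hc, Category.id_comp] at this
    obtain ⟨g, hg⟩ := S.exists_right S.I (S.rightForm (𝟙 S.I) ∘ₗ Linear.leftComp k S.I e)
    have hg' : S.rightForm (𝟙 S.I) ∘ₗ Linear.leftComp k S.I e = S.rightForm g :=
      LinearMap.ext fun f => (hg f).symm
    rw [hg', hc] at this
    rw [← this, hg]
    simp

variable [HasFiniteBiproducts X]

theorem exists_mono (x : X) : ∃ (n : ℕ) (f : x ⟶ ⨁ fun _ : Fin n => S.I), Mono f := by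
  let b := Module.finBasis k (x ⟶ S.I)
  refine ⟨_, biproduct.lift fun j => b j, ?_⟩
  refine Preadditive.mono_of_cancel_zero _ fun {z} h hh => S.coseparator h fun g => ?_
  have hb (j) : h ≫ b j = 0 := by
    rw [← biproduct.lift_π (fun j => b j) j, ← Category.assoc, hh, zero_comp]
  rw [← b.sum_repr g, Preadditive.comp_sum]
  simp [hb]

theorem exists_epi (x : X) : ∃ (n : ℕ) (f : (⨁ fun _ : Fin n => S.P) ⟶ x), Epi f := by
  let b := Module.finBasis k (S.P ⟶ x)
  refine ⟨_, biproduct.desc fun j => b j, ?_⟩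
  refine Preadditive.epi_of_cancel_zero _ fun {z} h hh => S.separator h fun g => ?_
  have hb (j) : b j ≫ h = 0 := by
    rw [← biproduct.ι_desc (fun j => b j) j, Category.assoc, hh, comp_zero]
  rw [← b.sum_repr g, Preadditive.sum_comp]
  simp [hb]

omit [HasFiniteBiproducts X] [IsHomFiniteAdditive k X] in
/-- `I` is injective: functionals extend along injective linear maps. -/
theorem exists_extension {x y : X} (f : x ⟶ y) [Mono f] (g : x ⟶ S.I) :
    ∃ h : y ⟶ S.I, f ≫ h = g := by
  have hinj : Function.Injective (Linear.rightComp k S.P f) := fun a b hab => by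
    simpa [cancel_mono] using hab
  obtain ⟨ξ, hξ⟩ := LinearMap.dualMap_surjective_of_injective hinj (S.rightForm g)
  obtain ⟨h, hh⟩ := S.exists_right y ξ
  refine ⟨h, S.form_right_ext fun u => ?_⟩
  have := LinearMap.congr_fun hξ u
  rw [← Category.assoc, hh]
  simpa using this

omit [HasFiniteBiproducts X] in
/-- `P` is projective, dually. -/
theorem exists_lift {x y : X} (f : x ⟶ y) [Epi f] (g : S.P ⟶ y) :
    ∃ h : S.P ⟶ x, h ≫ f = g := by
  obtain ⟨h, hh⟩ := S.op.exists_extension f.op (show Opposite.op y ⟶ S.op.I from g.op)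
  exact ⟨h.unop, congrArg Quiver.Hom.unop hh⟩

end SerrePair

/-! ### Existence of the Nakayama functors -/

section Existence

variable {k : Type w} [Field k] {X : Type u} [Category.{v} X] [Preadditive X] [Linear k X]

theorem dinMap_post_apply {z y y' : X} (h : y ⟶ y') (t : dinatural k z y) (x : X) :
    (dinMap k (𝟙 z) h t).1 x = (Linear.rightComp k x h).rTensor _ (t.1 x) := by
  rw [dinMap_apply, leftComp_id]
  rfl

theorem dinMap_post_injective {z y y' : X} (h : y ⟶ y') [Mono h] :
    Function.Injective (dinMap k (𝟙 z) h) := by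
  intro t t' e
  ext x
  have hinj : Function.Injective (Linear.rightComp k x h) := fun a b hab => by
    simpa [cancel_mono] using hab
  apply Module.Flat.rTensor_preserves_injective_linearMap (M := (z ⟶ x)) _ hinj
  rw [← dinMap_post_apply, ← dinMap_post_apply, e]

/-- Dinatural families from `z` to `y` depend on `y` in a left exact way. -/
theorem exists_dinMap_post_eq {z y y' y'' : X} (f : y ⟶ y') [Mono f] (r : y' ⟶ y'')
    (hf : f ≫ r = 0) (hr : ∀ {x : X} (g : x ⟶ y'), g ≫ r = 0 → ∃ l : x ⟶ y, l ≫ f = g)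
    (t : dinatural k z y') (ht : dinMap k (𝟙 z) r t = 0) :
    ∃ s, dinMap k (𝟙 z) f s = t := by
  have hinj (x x' : X) :
      Function.Injective ((Linear.rightComp k x f).rTensor (z ⟶ x')) := by
    refine Module.Flat.rTensor_preserves_injective_linearMap _ fun a b hab => ?_
    simpa [cancel_mono] using hab
  have hex (x : X) : Function.Exact (Linear.rightComp k x f) (Linear.rightComp k x r) := by
    intro g
    constructor
    · exact fun h => hr g h
    · rintro ⟨l, rfl⟩
      simp [hf]
  have h (x : X) : ∃ s, (Linear.rightComp k x f).rTensor (z ⟶ x) s = t.1 x := by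
    refine (Module.Flat.rTensor_exact (z ⟶ x) (hex x) _).1 ?_
    rw [← dinMap_post_apply, ht]
    rfl
  choose s hs using h
  refine ⟨⟨s, fun x x' g => ?_⟩, ?_⟩
  · apply hinj
    have h₁ : (Linear.rightComp k x f).rTensor (z ⟶ x') ∘ₗ
        (Linear.leftComp k y g).rTensor (z ⟶ x') =
        (Linear.leftComp k y' g).rTensor (z ⟶ x') ∘ₗ
          (Linear.rightComp k x' f).rTensor (z ⟶ x') := by
      ext; simp
    have h₂ : (Linear.rightComp k x f).rTensor (z ⟶ x') ∘ₗ
        (Linear.rightComp k z g).lTensor (x ⟶ y) =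
        (Linear.rightComp k z g).lTensor (x ⟶ y') ∘ₗ
          (Linear.rightComp k x f).rTensor (z ⟶ x) := by
      ext; simp
    have h₁' := LinearMap.congr_fun h₁ (s x')
    have h₂' := LinearMap.congr_fun h₂ (s x)
    simp only [LinearMap.comp_apply, hs] at h₁' h₂'
    rw [h₁', h₂', t.2 g]
  · ext x
    rw [dinMap_post_apply]
    exact hs x

variable (k) in
theorem dinMap_sum_right {ι : Type*} [Fintype ι] {z z' y y' : X} (g : z' ⟶ z) (h : ι → (y ⟶ y'))
    (t : dinatural k z y) : dinMap k g (∑ i, h i) t = ∑ i, dinMap k g (h i) t := by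
  let φ : (y ⟶ y') →+ dinatural k z' y' :=
    AddMonoidHom.mk' (fun h => dinMap k g h t) fun a b => dinMap_add_right k _ _ _ _
  exact map_sum φ h Finset.univ

/-- Representability of dinatural families into `y` passes to finite direct sums of copies
of `y`. -/
theorem exists_universalLeft_biproduct [HasFiniteBiproducts X] {n y : X} {ω : dinatural k n y}
    (hω : IsUniversalLeft k ω) (m : ℕ) :
    ∃ (n' : X) (ω' : dinatural k n' (⨁ fun _ : Fin m => y)), IsUniversalLeft k ω' := by
  let ι (j : Fin m) : y ⟶ ⨁ fun _ : Fin m => y := biproduct.ι (fun _ : Fin m => y) j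
  let π (j : Fin m) : (⨁ fun _ : Fin m => y) ⟶ y := biproduct.π (fun _ : Fin m => y) j
  let p (j : Fin m) : (⨁ fun _ : Fin m => n) ⟶ n := biproduct.π (fun _ : Fin m => n) j
  refine ⟨⨁ fun _ : Fin m => n, ∑ j, dinMap k (p j) (ι j) ω, fun z => ⟨fun g g' h => ?_,
    fun t => ?_⟩⟩
  · have key (g : z ⟶ ⨁ fun _ : Fin m => n) (j : Fin m) :
        dinMap k (𝟙 z) (π j) (dinMap k g (𝟙 _) (∑ j, dinMap k (p j) (ι j) ω)) =
          dinMap k (g ≫ p j) (𝟙 _) ω := by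
      simp only [map_sum, dinMap_dinMap, Category.id_comp, Category.comp_id]
      rw [Finset.sum_eq_single j]
      · rw [biproduct.ι_π_self]
      · intro i _ hij
        rw [biproduct.ι_π_ne _ hij]
        simpa using dinMap_smul_right k (0 : k) (g ≫ p i) (0 : y ⟶ y) ω
      · simp
    refine biproduct.hom_ext _ _ fun j => hω.injective k ?_
    have := congrArg (dinMap k (𝟙 z) (π j)) h
    rw [preMap_apply, preMap_apply, key, key] at this
    exact this
  · choose g hg using fun j => hω.exists_eq k (dinMap k (𝟙 z) (π j) t)
    refine ⟨biproduct.lift g, ?_⟩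
    rw [preMap_apply, map_sum]
    have h (j : Fin m) : dinMap k (biproduct.lift g) (𝟙 _) (dinMap k (p j) (ι j) ω) =
        dinMap k (𝟙 z) (π j ≫ ι j) t := by
      rw [← dinMap_post_post, ← hg, dinMap_dinMap, dinMap_dinMap, biproduct.lift_π]
      simp
    simp only [h]
    have hs : ∑ j, dinMap k (𝟙 z) (π j ≫ ι j) t = dinMap k (𝟙 z) (∑ j, π j ≫ ι j) t :=
      (dinMap_sum_right k (𝟙 z) (fun j => π j ≫ ι j) t).symm
    have ht : ∑ j, π j ≫ ι j = 𝟙 (⨁ fun _ : Fin m => y) := biproduct.total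
    rw [hs, ht, dinMap_id]

/-- Representability of dinatural families into an object passes to kernels. -/
theorem exists_universalLeft_kernel [HasKernels X] {y y' y'' : X} (f : y ⟶ y') [Mono f]
    (r : y' ⟶ y'') (hf : f ≫ r = 0)
    (hr : ∀ {x : X} (g : x ⟶ y'), g ≫ r = 0 → ∃ l : x ⟶ y, l ≫ f = g)
    {n' n'' : X} {ω' : dinatural k n' y'} (hω' : IsUniversalLeft k ω')
    {ω'' : dinatural k n'' y''} (hω'' : IsUniversalLeft k ω'') :
    ∃ (n : X) (ω : dinatural k n y), IsUniversalLeft k ω := by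
  obtain ⟨ρ, hρ⟩ := hω''.exists_eq k (dinMap k (𝟙 _) r ω')
  have zero_left {a b c d : X} (t : dinatural k b c) (h : c ⟶ d) :
      dinMap k (0 : a ⟶ b) h t = 0 := by
    simpa using dinMap_smul_left k (0 : k) (0 : a ⟶ b) h t
  have zero_right {a b c d : X} (t : dinatural k b c) (g : a ⟶ b) :
      dinMap k g (0 : c ⟶ d) t = 0 := by
    simpa using dinMap_smul_right k (0 : k) g (0 : c ⟶ d) t
  obtain ⟨ω, hω⟩ := exists_dinMap_post_eq f r hf hr (dinMap k (kernel.ι ρ) (𝟙 _) ω') (by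
    rw [← dinMap_pre_post, ← hρ, dinMap_pre_pre, kernel.condition, zero_left])
  refine ⟨kernel ρ, ω, fun z => ⟨fun g g' h => ?_, fun t => ?_⟩⟩
  · rw [← cancel_mono (kernel.ι ρ)]
    refine hω'.injective k ?_
    rw [← dinMap_pre_pre, ← dinMap_pre_pre, ← hω, dinMap_pre_post, dinMap_pre_post]
    exact congrArg _ h
  · obtain ⟨g', hg'⟩ := hω'.exists_eq k (dinMap k (𝟙 _) f t)
    have h0 : g' ≫ ρ = 0 := by
      refine hω''.injective k ?_
      rw [← dinMap_pre_pre, hρ, dinMap_pre_post, hg', dinMap_post_post, hf, zero_left, zero_right]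
    refine ⟨kernel.lift ρ g' h0, dinMap_post_injective f ?_⟩
    rw [preMap_apply, ← dinMap_pre_post, hω, dinMap_pre_pre, kernel.lift_ι, hg']

variable [IsHomFiniteAdditive k X] [IsAbelianCat X]

attribute [local instance] IsAbelianCat.hasFiniteBiproducts IsAbelianCat.hasFiniteLimits
  IsAbelianCat.hasFiniteColimits

/-- The dinatural families into `I` are represented by `P`, and every object is a kernel of a
morphism between direct sums of copies of `I`. -/
theorem SerrePair.exists_universalLeft (S : SerrePair k X) (y : X) :
    ∃ (n : X) (ω : dinatural k n y), IsUniversalLeft k ω := by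
  obtain ⟨ω, hω, -⟩ := S.exists_universal
  obtain ⟨n, f, hf⟩ := S.exists_mono y
  obtain ⟨m, r, hr, ⟨hl⟩⟩ := IsAbelianCat.exists_copresentation f S.exists_mono
  obtain ⟨n', ω', hω'⟩ := exists_universalLeft_biproduct hω n
  obtain ⟨n'', ω'', hω''⟩ := exists_universalLeft_biproduct hω m
  exact exists_universalLeft_kernel f r hr
    (fun g hg => ⟨_, (KernelFork.IsLimit.lift' hl g hg).2⟩) hω' hω''

theorem SerrePair.exists_universalRight (S : SerrePair k X) (z : X) :
    ∃ (n : X) (ω : dinatural k z n), IsUniversalRight k ω := by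
  obtain ⟨n, ω, hω⟩ := S.op.exists_universalLeft (Opposite.op z)
  obtain ⟨ω, rfl⟩ := (dinOp k z n.unop).surjective ω
  exact ⟨n.unop, ω, isUniversalRight_of_op hω⟩

theorem SerrePair.hasNakayamaFunctors (S : SerrePair k X) : HasNakayamaFunctors k X where
  hasEnd y := by
    obtain ⟨n, ω, hω⟩ := S.exists_universalLeft y
    exact hasEnd_of_isUniversalLeft k hω
  hasCoend z := by
    obtain ⟨n, ω, hω⟩ := S.exists_universalRight z
    exact hasCoend_of_isUniversalRight k hω

omit [IsAbelianCat X] in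
/-- A right Nakayama functor sends `P` to `I`, compatibly with endomorphisms. -/
theorem SerrePair.exists_iso (S : SerrePair k X) {R : X ⥤ X} (hR : IsRightNakayama k R) :
    ∃ s : R.obj S.P ≅ S.I, ∀ (e : S.P ⟶ S.P) (u : S.P ⟶ S.I),
      S.form (e ≫ u) = S.form (u ≫ s.inv ≫ R.map e ≫ s.hom) := by
  obtain ⟨ω, -, hω, key⟩ := S.exists_universal
  obtain ⟨ρ, hρ, nat⟩ := hR
  obtain ⟨s, hs⟩ := (hρ S.P).exists_eq k ω
  obtain ⟨s', hs'⟩ := hω.exists_eq k (ρ S.P)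
  have h₁ : s ≫ s' = 𝟙 _ := by
    refine (hρ S.P).injective k ?_
    rw [← dinMap_post_post, hs, hs', dinMap_id]
  have h₂ : s' ≫ s = 𝟙 _ := by
    refine hω.injective k ?_
    rw [← dinMap_post_post, hs', hs, dinMap_id]
  refine ⟨⟨s, s', h₁, h₂⟩, fun e u => key e _ ?_ u⟩
  dsimp only
  rw [← dinMap_post_post, ← dinMap_post_post, hs', nat, ← dinMap_pre_post, hs]

end Existence

/-! ### Finite linear categories have Serre pairs -/

section Coregular

variable (k : Type w) [Field k] (R : Type w) [Ring R] [Algebra k R]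

/-- The `k`-linear dual of an algebra `R`, as a left `R`-module: `(r • φ) s = φ (s * r)`. -/
def Coregular : Type w := Module.Dual k R

instance : AddCommGroup (Coregular k R) := inferInstanceAs (AddCommGroup (Module.Dual k R))

instance : Module k (Coregular k R) := inferInstanceAs (Module k (Module.Dual k R))

instance [Module.Finite k R] : Module.Finite k (Coregular k R) :=
  inferInstanceAs (Module.Finite k (Module.Dual k R))

/-- A linear form on `R` as an element of the coregular module. -/
def Coregular.mk : Module.Dual k R ≃ₗ[k] Coregular k R := LinearEquiv.refl k _

/-- The value of an element of the coregular module at an element of `R`. -/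
def Coregular.eval (r : R) : Coregular k R →ₗ[k] k := Module.Dual.eval k R r

variable {k R}

theorem Coregular.ext {φ ψ : Coregular k R}
    (h : ∀ r, Coregular.eval k R r φ = Coregular.eval k R r ψ) : φ = ψ :=
  LinearMap.ext h

instance : SMul R (Coregular k R) where
  smul r φ := (Coregular.mk k R).symm φ ∘ₗ LinearMap.mulRight k r

@[simp]
theorem Coregular.eval_smul (r s : R) (φ : Coregular k R) :
    Coregular.eval k R s (r • φ) = Coregular.eval k R (s * r) φ := rfl

theorem Coregular.eval_add_left (r s : R) (φ : Coregular k R) :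
    Coregular.eval k R (r + s) φ = Coregular.eval k R r φ + Coregular.eval k R s φ :=
  map_add ((Coregular.mk k R).symm φ) r s

theorem Coregular.eval_smul_left (c : k) (s : R) (φ : Coregular k R) :
    Coregular.eval k R (c • s) φ = c • Coregular.eval k R s φ :=
  map_smul ((Coregular.mk k R).symm φ) c s

instance : Module R (Coregular k R) where
  one_smul φ := Coregular.ext fun r => by simp
  mul_smul r s φ := Coregular.ext fun t => by simp [mul_assoc]
  smul_zero r := Coregular.ext fun t => by simp
  smul_add r φ ψ := Coregular.ext fun t => by simp
  add_smul r s φ := Coregular.ext fun t => by simp [mul_add, Coregular.eval_add_left]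
  zero_smul φ := Coregular.ext fun t => by
    simpa using Coregular.eval_smul_left (0 : k) (0 : R) φ

instance : IsScalarTower k R (Coregular k R) where
  smul_assoc c r φ := Coregular.ext fun t => by simp [Coregular.eval_smul_left]

instance [Module.Finite k R] : Module.Finite R (Coregular k R) :=
  Module.Finite.of_restrictScalars_finite k R _

end Coregular

section FGModule

variable (k : Type w) [Field k] (R : Type w) [Ring R] [Algebra k R]

theorem fgModuleCat_smul_apply {M N : FGModuleCat.{w} R} (c : k) (f : M ⟶ N) (x : M) :
    (c • f).hom.hom x = algebraMap k R c • f.hom.hom x := rfl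

/-- The regular and the coregular module form a Serre pair, with the form that evaluates a
morphism `R ⟶ R^*` at `1` and `1`. -/
def serrePairFGModuleCat [Module.Finite k R] : SerrePair k (FGModuleCat.{w} R) where
  P := FGModuleCat.of R R
  I := FGModuleCat.of R (Coregular k R)
  form :=
    { toFun := fun f => Coregular.eval k R 1 (f.hom.hom (1 : R))
      map_add' := fun f g => map_add (Coregular.eval k R 1) (f.hom.hom (1 : R)) (g.hom.hom (1 : R))
      map_smul' := fun c f => by
        rw [fgModuleCat_smul_apply]
        exact (Coregular.eval_smul _ _ _).trans (by
          rw [one_mul, Algebra.algebraMap_eq_smul_one, Coregular.eval_smul_left]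
          rfl) }
  perfect M := by
    let span (m : M) : FGModuleCat.of R R ⟶ M := FGModuleCat.ofHom (LinearMap.toSpanSingleton R M m)
    constructor
    · intro g g' h
      apply FGModuleCat.hom_ext
      ext m
      refine Coregular.ext fun r => ?_
      have := LinearMap.congr_fun h (span (r • m))
      change Coregular.eval k R 1 (g.hom.hom ((1 : R) • r • m)) =
        Coregular.eval k R 1 (g'.hom.hom ((1 : R) • r • m)) at this
      rw [one_smul, LinearMap.map_smul g.hom.hom, LinearMap.map_smul g'.hom.hom] at this
      have e₁ := Coregular.eval_smul r 1 (g.hom.hom m)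
      have e₂ := Coregular.eval_smul r 1 (g'.hom.hom m)
      rw [one_mul] at e₁ e₂
      exact e₁.symm.trans (this.trans e₂)
    · intro ξ
      have span_add (m m' : M) : span (m + m') = span m + span m' := by
        apply FGModuleCat.hom_ext
        ext
        exact smul_add (1 : R) m m'
      have span_smul (c : k) (m : M) : span (algebraMap k R c • m) = c • span m := by
        apply FGModuleCat.hom_ext
        ext
        rw [fgModuleCat_smul_apply]
        change (1 : R) • algebraMap k R c • m = algebraMap k R c • (1 : R) • m
        rw [one_smul, one_smul]
      -- a functional `ξ` on `Hom(R, M) = M` corresponds to the morphism `m ↦ (r ↦ ξ (r • m))`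
      let g (m : M) : Coregular k R := Coregular.mk k R
        { toFun := fun r => ξ (span (r • m))
          map_add' := fun r s => by rw [add_smul, span_add, map_add]
          map_smul' := fun c r => by
            rw [Algebra.smul_def, mul_smul, span_smul, map_smul, RingHom.id_apply] }
      let G : M →ₗ[R] Coregular k R :=
        { toFun := g
          map_add' := fun m m' => Coregular.ext fun r => by
            rw [map_add]
            change ξ (span (r • (m + m'))) = ξ (span (r • m)) + ξ (span (r • m'))
            rw [smul_add, span_add, map_add]
          map_smul' := fun s m => Coregular.ext fun r => by
            rw [RingHom.id_apply, Coregular.eval_smul]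
            change ξ (span (r • s • m)) = ξ (span ((r * s) • m))
            rw [mul_smul] }
      refine ⟨FGModuleCat.ofHom G, LinearMap.ext fun f => ?_⟩
      change ξ (span ((1 : R) • f.hom.hom (1 : R))) = ξ f
      congr 1
      apply FGModuleCat.hom_ext
      ext
      change (1 : R) • (1 : R) • f.hom.hom (1 : R) = f.hom.hom (1 : R)
      rw [one_smul, one_smul]
  separator {M N} f hf := by
    apply FGModuleCat.hom_ext
    ext m
    have := hf (FGModuleCat.ofHom (LinearMap.toSpanSingleton R M m))
    have := congrArg (fun g => g.hom.hom (1 : R)) this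
    change f.hom.hom ((1 : R) • m) = 0 at this
    rwa [one_smul] at this

end FGModule

/-- Serre pairs are transported along linear equivalences. -/
def SerrePair.ofIsEquivalence {k : Type w} [Field k] {X : Type u₁} [Category.{v₁} X]
    [Preadditive X] [Linear k X] {Y : Type u₂} [Category.{v₂} Y] [Preadditive Y] [Linear k Y]
    (S : SerrePair k Y) (F : X ⥤ Y) [F.IsEquivalence] [F.Additive] [F.Linear k] :
    SerrePair k X where
  P := F.objPreimage S.P
  I := F.objPreimage S.I
  form := S.form ∘ₗ Linear.rightComp k _ (F.objObjPreimageIso S.I).hom ∘ₗ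
    Linear.leftComp k _ (F.objObjPreimageIso S.P).inv ∘ₗ F.mapLinearMap k
  perfect x := by
    constructor
    · intro g g' h
      apply F.map_injective
      rw [← cancel_mono (F.objObjPreimageIso S.I).hom]
      refine S.form_right_ext fun f => ?_
      have := LinearMap.congr_fun h (F.preimage ((F.objObjPreimageIso S.P).hom ≫ f))
      simpa using this
    · intro ξ
      let φ : (S.P ⟶ F.obj x) →ₗ[k] (F.objPreimage S.P ⟶ x) :=
        { toFun := fun f => F.preimage ((F.objObjPreimageIso S.P).hom ≫ f)
          map_add' := fun f g => F.map_injective (by simp)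
          map_smul' := fun c f => F.map_injective (by simp) }
      obtain ⟨g, hg⟩ := S.exists_right (F.obj x) (ξ ∘ₗ φ)
      refine ⟨F.preimage (g ≫ (F.objObjPreimageIso S.I).inv), LinearMap.ext fun f => ?_⟩
      have := hg ((F.objObjPreimageIso S.P).inv ≫ F.map f)
      simpa [φ] using this
  separator f hf := by
    apply F.map_injective
    rw [F.map_zero]
    refine S.separator _ fun u => ?_
    have := congrArg F.map (hf (F.preimage ((F.objObjPreimageIso S.P).hom ≫ u)))
    simpa using this

section Finite

variable (k : Type w) [Field k] (X : Type u) [Category.{v} X] [Preadditive X] [Linear k X]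
  [IsFiniteLinear k X]

theorem nonempty_serrePair : Nonempty (SerrePair k X) := by
  obtain ⟨R, _, _, _, e, _, _⟩ := IsFiniteLinear.exists_equivalence (k := k) (X := X)
  exact ⟨(serrePairFGModuleCat k R).ofIsEquivalence e.functor⟩

include k in
theorem isAbelianCat_of_isFiniteLinear : IsAbelianCat X := by
  obtain ⟨R, _, _, _, e, _, _⟩ := IsFiniteLinear.exists_equivalence (k := k) (X := X)
  have : IsNoetherianRing R := IsNoetherianRing.of_finite k R
  have : HasFiniteProducts X := ⟨fun n => Adjunction.hasLimitsOfShape_of_equivalence e.functor⟩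
  exact ⟨abelianOfEquivalence e.functor, rfl⟩

end Finite

attribute [local instance] IsAbelianCat.hasFiniteBiproducts IsAbelianCat.hasFiniteLimits
  IsAbelianCat.hasFiniteColimits

/-! ### Exact functors are determined by their values on generators -/

section Extension

variable {k : Type w} [Field k] {X : Type u₁} [Category.{v₁} X] [Preadditive X] [Linear k X]
  [IsHomFiniteAdditive k X] [IsAbelianCat X]
  {Y : Type u₂} [Category.{v₂} Y] [Preadditive Y]

omit [IsAbelianCat X] in
theorem SerrePair.projective (S : SerrePair k X) : Projective S.P :=
  ⟨fun f g _ => S.exists_lift g f⟩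

theorem SerrePair.exists_presentation (S : SerrePair k X) (d : X) :
    ∃ (n m : ℕ) (p : (⨁ fun _ : Fin n => S.P) ⟶ d)
      (q : (⨁ fun _ : Fin m => S.P) ⟶ ⨁ fun _ : Fin n => S.P) (h : q ≫ p = 0),
      Nonempty (IsColimit (CokernelCofork.ofπ p h)) := by
  obtain ⟨n, p, hp⟩ := S.exists_epi d
  obtain ⟨m, q, h, hc⟩ := IsAbelianCat.exists_presentation p S.exists_epi
  exact ⟨n, m, p, q, h, hc⟩

omit [IsAbelianCat X] in
theorem map_biproduct_comp [HasFiniteBiproducts X] (H : X ⥤ Y) [H.Additive] {x : X} {n : ℕ} {y : Y}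
    (g : H.obj (⨁ fun _ : Fin n => x) ⟶ y) :
    ∑ j, H.map (biproduct.π (fun _ : Fin n => x) j) ≫
      H.map (biproduct.ι (fun _ : Fin n => x) j) ≫ g = g := by
  have h : H.map (∑ j, biproduct.π (fun _ : Fin n => x) j ≫ biproduct.ι (fun _ : Fin n => x) j) =
      𝟙 _ := by
    rw [biproduct.total, H.map_id]
  conv_rhs => rw [← Category.id_comp g, ← h, H.map_sum, Preadditive.sum_comp]
  simp only [H.map_comp, Category.assoc]

omit [IsAbelianCat X] in
theorem sum_comp_π_ι [HasFiniteBiproducts X] {x y : X} {n : ℕ}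
    (f : y ⟶ ⨁ fun _ : Fin n => x) : ∑ j, (f ≫ biproduct.π (fun _ : Fin n => x) j) ≫
      biproduct.ι (fun _ : Fin n => x) j = f := by
  conv_rhs => rw [← Category.comp_id f, ← biproduct.total, Preadditive.comp_sum]
  simp only [Category.assoc]

omit [IsAbelianCat X] in
theorem map_biproduct_hom_ext [HasFiniteBiproducts X] (H : X ⥤ Y) [H.Additive] {x : X} {n : ℕ}
    {y : Y} {g g' : H.obj (⨁ fun _ : Fin n => x) ⟶ y}
    (h : ∀ f : x ⟶ ⨁ fun _ : Fin n => x, H.map f ≫ g = H.map f ≫ g') : g = g' := by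
  rw [← map_biproduct_comp H g, ← map_biproduct_comp H g']
  simp only [h]

/-- Morphisms out of `H d`, for a right exact functor `H`, are detected on the morphisms
`H P ⟶ H d` coming from morphisms `P ⟶ d`. -/
theorem SerrePair.map_hom_ext (S : SerrePair k X) (H : X ⥤ Y) [H.Additive]
    [PreservesFiniteColimits H] {d : X} {y : Y} {g g' : H.obj d ⟶ y}
    (h : ∀ f : S.P ⟶ d, H.map f ≫ g = H.map f ≫ g') : g = g' := by
  obtain ⟨n, p, hp⟩ := S.exists_epi d
  rw [← cancel_epi (H.map p)]
  refine map_biproduct_hom_ext H fun f => ?_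
  rw [← H.map_comp_assoc, ← H.map_comp_assoc, h]

/-- A right exact functor `H` is determined by its value on `P` with the action of `End P`:
a morphism `H d ⟶ y` is an equivariant map `Hom(P, d) → Hom(H P, y)`. -/
theorem SerrePair.exists_map_comp_eq (S : SerrePair k X) (H : X ⥤ Y) [H.Additive]
    [PreservesFiniteColimits H] {d : X} {y : Y} (φ : (S.P ⟶ d) →+ (H.obj S.P ⟶ y))
    (hφ : ∀ (e : S.P ⟶ S.P) (f : S.P ⟶ d), φ (e ≫ f) = H.map e ≫ φ f) :
    ∃ g : H.obj d ⟶ y, ∀ f, H.map f ≫ g = φ f := by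
  obtain ⟨n, m, p, q, h, ⟨hc⟩⟩ := S.exists_presentation d
  have hp : Epi p := epi_of_isColimit_cofork hc
  have := S.projective
  let u : H.obj (⨁ fun _ : Fin n => S.P) ⟶ y :=
    ∑ j, H.map (biproduct.π (fun _ : Fin n => S.P) j) ≫
      φ (biproduct.ι (fun _ : Fin n => S.P) j ≫ p)
  have hu (f : S.P ⟶ ⨁ fun _ : Fin n => S.P) : H.map f ≫ u = φ (f ≫ p) := by
    have : f = ∑ j, (f ≫ biproduct.π (fun _ : Fin n => S.P) j) ≫
        biproduct.ι (fun _ : Fin n => S.P) j := (sum_comp_π_ι f).symm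
    conv_rhs => rw [this, Preadditive.sum_comp, map_sum]
    simp only [u, Preadditive.comp_sum, Category.assoc, ← H.map_comp_assoc, ← hφ]
  have hqu : H.map q ≫ u = 0 := by
    refine map_biproduct_hom_ext H fun f => ?_
    rw [← H.map_comp_assoc, hu, Category.assoc, h, comp_zero, map_zero, comp_zero]
  have hc' := CokernelCofork.mapIsColimit _ hc H
  obtain ⟨g, hg⟩ := CokernelCofork.IsColimit.desc' hc' u hqu
  refine ⟨g, fun f => ?_⟩
  replace hg : H.map p ≫ g = u := hg
  rw [← Projective.factorThru_comp f p, ← hu, ← hg, H.map_comp]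
  exact Category.assoc _ _ _

/-- Right exact functors with equivariantly isomorphic values on `P` are isomorphic. -/
theorem SerrePair.nonempty_iso_of_right (S : SerrePair k X) {H H' : X ⥤ Y} [H.Additive]
    [H'.Additive] [PreservesFiniteColimits H] [PreservesFiniteColimits H']
    (α : H.obj S.P ≅ H'.obj S.P)
    (hα : ∀ e : S.P ⟶ S.P, H.map e ≫ α.hom = α.hom ≫ H'.map e) : Nonempty (H ≅ H') := by
  have hα' (e : S.P ⟶ S.P) : H'.map e ≫ α.inv = α.inv ≫ H.map e := by
    rw [Iso.comp_inv_eq, Category.assoc, hα, Iso.inv_hom_id_assoc]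
  choose g hg using fun d => S.exists_map_comp_eq H (d := d) (y := H'.obj d)
    (AddMonoidHom.mk' (fun f => α.hom ≫ H'.map f) fun a b => by simp)
    (fun e f => by simp [reassoc_of% hα])
  choose g' hg' using fun d => S.exists_map_comp_eq H' (d := d) (y := H.obj d)
    (AddMonoidHom.mk' (fun f => α.inv ≫ H.map f) fun a b => by simp)
    (fun e f => by simp [reassoc_of% hα'])
  simp only [AddMonoidHom.mk'_apply] at hg hg'
  refine ⟨NatIso.ofComponents (fun d => ⟨g d, g' d, ?_, ?_⟩) ?_⟩
  · refine S.map_hom_ext H fun f => ?_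
    rw [← Category.assoc, hg, Category.assoc, hg', Category.comp_id, Iso.hom_inv_id_assoc]
  · refine S.map_hom_ext H' fun f => ?_
    rw [← Category.assoc, hg', Category.assoc, hg, Category.comp_id, Iso.inv_hom_id_assoc]
  · intro d d' h
    refine S.map_hom_ext H fun f => ?_
    dsimp only
    rw [← H.map_comp_assoc, hg, ← Category.assoc, hg, Category.assoc, H'.map_comp]

/-- Left exact functors with equivariantly isomorphic values on `I` are isomorphic. -/
theorem SerrePair.nonempty_iso_of_left (S : SerrePair k X) {H H' : X ⥤ Y} [H.Additive]
    [H'.Additive] [PreservesFiniteLimits H] [PreservesFiniteLimits H']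
    (α : H.obj S.I ≅ H'.obj S.I)
    (hα : ∀ e : S.I ⟶ S.I, H.map e ≫ α.hom = α.hom ≫ H'.map e) : Nonempty (H ≅ H') := by
  have := preservesFiniteColimits_op H
  have := preservesFiniteColimits_op H'
  obtain ⟨e⟩ := S.op.nonempty_iso_of_right (H := H'.op) (H' := H.op) α.op
    (fun e => congrArg Quiver.Hom.op (hα e.unop).symm)
  exact ⟨NatIso.removeOp e⟩

end Extension

/-! ### Left exact presheaves of vector spaces -/

/-- A left exact contravariant functor from `X` to `k`-vector spaces, given by its values. -/
structure LeftExactPresheaf (k : Type w) [Field k] {X : Type u} [Category.{v} X] [Preadditive X]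
    (F : X → Type u₁) [∀ x, AddCommGroup (F x)] [∀ x, Module k (F x)] where
  map {x y : X} (f : x ⟶ y) : F y →ₗ[k] F x
  map_id (x : X) (s : F x) : map (𝟙 x) s = s
  map_comp {x y z : X} (f : x ⟶ y) (g : y ⟶ z) (s : F z) : map (f ≫ g) s = map f (map g s)
  map_add {x y : X} (f g : x ⟶ y) (s : F y) : map (f + g) s = map f s + map g s
  injective {x y : X} (f : x ⟶ y) [Epi f] : Function.Injective (map f)
  exact {x y z : X} (f : x ⟶ y) (g : y ⟶ z) (h : f ≫ g = 0)
    (hc : IsColimit (CokernelCofork.ofπ g h)) (s : F y) (hs : map f s = 0) : ∃ s', map g s' = s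

namespace LeftExactPresheaf

variable {k : Type w} [Field k] {X : Type u} [Category.{v} X] [Preadditive X]

theorem map_zero {F : X → Type u₁} [∀ x, AddCommGroup (F x)] [∀ x, Module k (F x)]
    (f : LeftExactPresheaf k F) {x y : X} (s : F y) : f.map (0 : x ⟶ y) s = 0 := by
  have := f.map_add (0 : x ⟶ y) 0 s
  rwa [add_zero, left_eq_add] at this

theorem map_sum {F : X → Type u₁} [∀ x, AddCommGroup (F x)] [∀ x, Module k (F x)]
    (f : LeftExactPresheaf k F) {x y : X} {ι : Type*} [Fintype ι] (g : ι → (x ⟶ y)) (s : F y) :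
    f.map (∑ i, g i) s = ∑ i, f.map (g i) s := by
  let φ : (x ⟶ y) →+ F x := AddMonoidHom.mk' (fun h => f.map h s) fun a b => f.map_add a b s
  exact _root_.map_sum φ g Finset.univ

/-- A morphism between left exact presheaves that is bijective at a generator `P` is bijective. -/
theorem bijective [IsAbelianCat X] {P : X}
    (hgen : ∀ d : X, ∃ (n : ℕ) (p : (⨁ fun _ : Fin n => P) ⟶ d), Epi p)
    {F : X → Type u₁} [∀ x, AddCommGroup (F x)] [∀ x, Module k (F x)]
    {G : X → Type u₂} [∀ x, AddCommGroup (G x)] [∀ x, Module k (G x)]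
    (f : LeftExactPresheaf k F) (g : LeftExactPresheaf k G) (φ : ∀ x, F x →ₗ[k] G x)
    (nat : ∀ {x y : X} (h : x ⟶ y) (s : F y), φ x (f.map h s) = g.map h (φ y s))
    (hP : Function.Bijective (φ P)) (x : X) : Function.Bijective (φ x) := by
  have key (n : ℕ) : Function.Bijective (φ (⨁ fun _ : Fin n => P)) := by
    let ι (j : Fin n) : P ⟶ ⨁ fun _ : Fin n => P := biproduct.ι (fun _ : Fin n => P) j
    let π (j : Fin n) : (⨁ fun _ : Fin n => P) ⟶ P := biproduct.π (fun _ : Fin n => P) j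
    have total : ∑ j, π j ≫ ι j = 𝟙 _ := biproduct.total
    constructor
    · refine (injective_iff_map_eq_zero (φ _)).2 fun s hs => ?_
      have h (j) : f.map (ι j) s = 0 := by
        refine (injective_iff_map_eq_zero (φ P)).1 hP.1 _ ?_
        rw [nat, hs, _root_.map_zero]
      rw [← f.map_id _ s, ← total, f.map_sum]
      simp [f.map_comp, h]
    · intro r
      choose s hs using fun j => hP.2 (g.map (ι j) r)
      refine ⟨∑ j, f.map (π j) (s j), ?_⟩
      rw [_root_.map_sum]
      simp only [nat, hs, ← g.map_comp]
      rw [← g.map_sum, total, g.map_id]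
  obtain ⟨n, p, hp⟩ := hgen x
  obtain ⟨m, q, h, ⟨hc⟩⟩ := IsAbelianCat.exists_presentation p hgen
  constructor
  · refine (injective_iff_map_eq_zero (φ x)).2 fun s hs => ?_
    have h₁ : f.map p s = 0 := by
      refine (injective_iff_map_eq_zero (φ _)).1 (key n).1 _ ?_
      rw [nat, hs, _root_.map_zero]
    exact (injective_iff_map_eq_zero (f.map p)).1 (f.injective p) _ h₁
  · intro r
    obtain ⟨s, hs⟩ := (key n).2 (g.map p r)
    obtain ⟨s', rfl⟩ := f.exact q p h hc s (by
      refine (injective_iff_map_eq_zero (φ _)).1 (key m).1 _ ?_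
      rw [nat, hs, ← g.map_comp, h, g.map_zero])
    refine ⟨s', g.injective p ?_⟩
    rw [← nat, hs]

/-- The presheaf `x ↦ Hom(M x, y)`, for a right exact functor `M`. -/
def hom {Y : Type u₂} [Category.{v₂} Y] [Preadditive Y] [Linear k Y] (M : X ⥤ Y) [M.Additive]
    [PreservesFiniteColimits M] (y : Y) : LeftExactPresheaf k fun x => (M.obj x ⟶ y) where
  map f := Linear.leftComp k y (M.map f)
  map_id := by simp
  map_comp := by simp
  map_add := by simp
  injective f _ a b h := by simpa [cancel_epi] using h
  exact f g h hc s hs := by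
    obtain ⟨l, hl⟩ := CokernelCofork.IsColimit.desc' (CokernelCofork.mapIsColimit _ hc M) s hs
    exact ⟨l, hl⟩

/-- The tensor product of a left exact presheaf with a vector space. -/
def tensor {F : X → Type u₁} [∀ x, AddCommGroup (F x)] [∀ x, Module k (F x)]
    (f : LeftExactPresheaf k F) (V : Type u₂) [AddCommGroup V] [Module k V] :
    LeftExactPresheaf k fun x => F x ⊗[k] V where
  map g := (f.map g).rTensor V
  map_id x s := by
    have : f.map (𝟙 x) = LinearMap.id := LinearMap.ext (f.map_id x)
    rw [this, LinearMap.rTensor_id, LinearMap.id_apply]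
  map_comp g h s := by
    have : f.map (g ≫ h) = f.map g ∘ₗ f.map h := LinearMap.ext (f.map_comp g h)
    rw [this, LinearMap.rTensor_comp, LinearMap.comp_apply]
  map_add g h s := by
    have : f.map (g + h) = f.map g + f.map h := LinearMap.ext (f.map_add g h)
    rw [this, LinearMap.rTensor_add, LinearMap.add_apply]
  injective g _ := Module.Flat.rTensor_preserves_injective_linearMap _ (f.injective g)
  exact g h e hc s hs := by
    refine (Module.Flat.rTensor_exact V (f := f.map h) (g := f.map g) (fun s => ⟨?_, ?_⟩) s).1 hs
    · exact fun hs => f.exact g h e hc s hs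
    · rintro ⟨s, rfl⟩
      rw [← f.map_comp, e, f.map_zero]

/-- The tensor product of a vector space with a left exact presheaf. -/
def tensorLeft {F : X → Type u₁} [∀ x, AddCommGroup (F x)] [∀ x, Module k (F x)]
    (f : LeftExactPresheaf k F) (V : Type u₂) [AddCommGroup V] [Module k V] :
    LeftExactPresheaf k fun x => V ⊗[k] F x where
  map g := (f.map g).lTensor V
  map_id x s := by
    have : f.map (𝟙 x) = LinearMap.id := LinearMap.ext (f.map_id x)
    rw [this, LinearMap.lTensor_id, LinearMap.id_apply]
  map_comp g h s := by
    have : f.map (g ≫ h) = f.map g ∘ₗ f.map h := LinearMap.ext (f.map_comp g h)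
    rw [this, LinearMap.lTensor_comp, LinearMap.comp_apply]
  map_add g h s := by
    have : f.map (g + h) = f.map g + f.map h := LinearMap.ext (f.map_add g h)
    rw [this, LinearMap.lTensor_add, LinearMap.add_apply]
  injective g _ := Module.Flat.lTensor_preserves_injective_linearMap _ (f.injective g)
  exact g h e hc s hs := by
    refine (Module.Flat.lTensor_exact V (f := f.map h) (g := f.map g) (fun s => ⟨?_, ?_⟩) s).1 hs
    · exact fun hs => f.exact g h e hc s hs
    · rintro ⟨s, rfl⟩
      rw [← f.map_comp, e, f.map_zero]

end LeftExactPresheaf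

section Projective

variable {k : Type w} [Field k] {X : Type u} [Category.{v} X] [Preadditive X]
  [IsAbelianCat X]

theorem exists_comp_eq_of_projective (t : X) [Projective t] {x y z : X} (f : x ⟶ y) (g : y ⟶ z)
    (h : f ≫ g = 0) (hc : IsColimit (CokernelCofork.ofπ g h)) (u : t ⟶ y) (hu : u ≫ g = 0) :
    ∃ u', u' ≫ f = u := by
  obtain ⟨a, rfl⟩ := IsAbelianCat.exists_abelian (X := X)
  let T : ShortComplex X := ShortComplex.mk f g h
  have hT : T.Exact := T.exact_of_g_is_cokernel hc
  exact ⟨hT.liftFromProjective u hu, hT.liftFromProjective_comp u hu⟩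

/-- The presheaf `x ↦ Hom(t, x)^*`, for a projective object `t`. -/
def LeftExactPresheaf.dual [Linear k X] (t : X) [Projective t] :
    LeftExactPresheaf k fun x => Module.Dual k (t ⟶ x) where
  map f := (Linear.rightComp k t f).dualMap
  map_id x s := by ext; simp
  map_comp f g s := by ext; simp
  map_add f g s := by ext; simp
  injective f _ := LinearMap.dualMap_injective_of_surjective fun u =>
    ⟨Projective.factorThru u f, Projective.factorThru_comp u f⟩
  exact {x y z} f g h hc s hs := by
    have : s ∈ LinearMap.range (Linear.rightComp k t g).dualMap := by
      rw [LinearMap.range_dualMap_eq_dualAnnihilator_ker, Submodule.mem_dualAnnihilator]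
      intro u hu
      obtain ⟨u', rfl⟩ := exists_comp_eq_of_projective t f g h hc u hu
      exact LinearMap.congr_fun hs u'
    exact this

end Projective

/-! ### The universal property of the Deligne product -/

section Universal

variable {k : Type w} [Field k]
  {A : Type u₁} [Category.{v₁} A] [Preadditive A] [Linear k A]
  {B : Type u₂} [Category.{v₂} B] [Preadditive B] [Linear k B]
  {D : Type u₃} [Category.{v₃} D] [Preadditive D] [Linear k D]
  {X : Type u₄} [Category.{v₄} X] [Preadditive X] [Linear k X]

theorem IsRightExactLinear.comp {F : A ⥤ B} {G : B ⥤ D} (hF : IsRightExactLinear k F)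
    (hG : IsRightExactLinear k G) : IsRightExactLinear k (F ⋙ G) := by
  have := hF.additive
  have := hF.linear
  have := hF.preservesFiniteColimits
  have := hG.additive
  have := hG.linear
  have := hG.preservesFiniteColimits
  exact ⟨inferInstance, inferInstance, inferInstance⟩

theorem IsRightExactBilinear.comp {F : A × B ⥤ D} {G : D ⥤ X} (hF : IsRightExactBilinear k F)
    (hG : IsRightExactLinear k G) : IsRightExactBilinear k (F ⋙ G) :=
  ⟨fun b => (hF.left b).comp hG, fun a => (hF.right a).comp hG⟩

theorem isRightExactLinear_functor (e : A ≌ B) [e.functor.Additive] [e.functor.Linear k] :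
    IsRightExactLinear k e.functor :=
  ⟨inferInstance, inferInstance, inferInstance⟩

theorem isRightExactLinear_inverse (e : A ≌ B) [e.functor.Additive] [e.functor.Linear k] :
    IsRightExactLinear k e.inverse :=
  ⟨inferInstance, inferInstance, inferInstance⟩

instance isFiniteLinear_fgModuleCat (R : Type w) [Ring R] [Algebra k R] [Module.Finite k R] :
    IsFiniteLinear k (FGModuleCat.{w} R) :=
  ⟨R, inferInstance, inferInstance, inferInstance, CategoryTheory.Equivalence.refl,
    inferInstanceAs (𝟭 (FGModuleCat.{w} R)).Additive,
    inferInstanceAs ((𝟭 (FGModuleCat.{w} R)).Linear k)⟩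

/-- The universal property of the Deligne product holds for targets in all universes. -/
theorem IsDeligneProduct.exists_extension {T : A × B ⥤ D} (hT : IsDeligneProduct k T)
    [IsFiniteLinear k X] (F : A × B ⥤ X) (hF : IsRightExactBilinear k F) :
    ∃ G : D ⥤ X, IsRightExactLinear k G ∧ Nonempty (T ⋙ G ≅ F) := by
  obtain ⟨R, _, _, _, e, _, _⟩ := IsFiniteLinear.exists_equivalence (k := k) (X := X)
  obtain ⟨G, hG, ⟨α⟩⟩ := hT.exists_factorization _ (F ⋙ e.functor)
    (hF.comp (isRightExactLinear_functor e))
  exact ⟨G ⋙ e.inverse, hG.comp (isRightExactLinear_inverse e),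
    ⟨Functor.isoWhiskerRight α e.inverse ≪≫ Functor.isoWhiskerLeft F e.unitIso.symm ≪≫
      F.rightUnitor⟩⟩

theorem IsDeligneProduct.existsUnique_extension {T : A × B ⥤ D} (hT : IsDeligneProduct k T)
    [IsFiniteLinear k X] {G H : D ⥤ X} (hG : IsRightExactLinear k G)
    (hH : IsRightExactLinear k H) (α : T ⋙ G ⟶ T ⋙ H) :
    ∃! β : G ⟶ H, Functor.whiskerLeft T β = α := by
  obtain ⟨R, _, _, _, e, _, _⟩ := IsFiniteLinear.exists_equivalence (k := k) (X := X)
  obtain ⟨β, hβ, huniq⟩ := hT.existsUnique_whiskerLeft _ (G ⋙ e.functor) (H ⋙ e.functor)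
    (hG.comp (isRightExactLinear_functor e)) (hH.comp (isRightExactLinear_functor e))
    (Functor.whiskerRight α e.functor)
  have hβ' (x : A × B) : β.app (T.obj x) = e.functor.map (α.app x) :=
    congrArg (fun γ => γ.app x) hβ
  refine ⟨{ app := fun d => e.functor.preimage (β.app d), naturality := ?_ }, ?_, ?_⟩
  · intro d d' f
    apply e.functor.map_injective
    simpa using β.naturality f
  · ext x
    apply e.functor.map_injective
    exact (e.functor.map_preimage _).trans (hβ' x)
  · intro γ hγ
    have := huniq (Functor.whiskerRight γ e.functor) (NatTrans.ext (funext fun x =>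
      congrArg (fun δ => e.functor.map (NatTrans.app δ x)) hγ))
    ext d
    apply e.functor.map_injective
    exact (congrArg (fun δ => NatTrans.app δ d) this).trans (e.functor.map_preimage _).symm

/-- Natural transformations between right exact functors on a Deligne product are determined by
their values on pure tensors. -/
theorem IsDeligneProduct.ext {T : A × B ⥤ D} (hT : IsDeligneProduct k T)
    [IsFiniteLinear k X] {G H : D ⥤ X} (hG : IsRightExactLinear k G)
    (hH : IsRightExactLinear k H) {β γ : G ⟶ H}
    (h : ∀ a b, β.app (T.obj (a, b)) = γ.app (T.obj (a, b))) : β = γ :=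
  (hT.existsUnique_extension hG hH (Functor.whiskerLeft T γ)).unique
    (by ext ⟨a, b⟩; exact h a b) rfl

theorem IsDeligneProduct.nonempty_iso {T : A × B ⥤ D} (hT : IsDeligneProduct k T)
    [IsFiniteLinear k X] {G H : D ⥤ X} (hG : IsRightExactLinear k G)
    (hH : IsRightExactLinear k H) (α : T ⋙ G ≅ T ⋙ H) : Nonempty (G ≅ H) := by
  obtain ⟨β, hβ, -⟩ := hT.existsUnique_extension hG hH α.hom
  obtain ⟨γ, hγ, -⟩ := hT.existsUnique_extension hH hG α.inv
  have hβ' (a b) : β.app (T.obj (a, b)) = α.hom.app (a, b) := congrArg (fun δ => δ.app (a, b)) hβ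
  have hγ' (a b) : γ.app (T.obj (a, b)) = α.inv.app (a, b) := congrArg (fun δ => δ.app (a, b)) hγ
  refine ⟨⟨β, γ, hT.ext hG hG fun a b => ?_, hT.ext hH hH fun a b => ?_⟩⟩
  · rw [NatTrans.comp_app, hβ', hγ']
    exact α.hom_inv_id_app _
  · rw [NatTrans.comp_app, hβ', hγ']
    exact α.inv_hom_id_app _

end Universal

/-! ### Tensoring a right exact functor to vector spaces with an object -/

section TensorFunctor

variable {k : Type w} [Field k]

/-- Right exactness of a functor to vector spaces, in terms of elements. -/
structure IsRightExactVec {C : Type u₁} [Category.{v₁} C] [Preadditive C] [Linear k C]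
    (F : C ⥤ ModuleCat.{v} k) : Prop where
  additive : F.Additive
  linear : F.Linear k
  surjective {x y : C} (f : x ⟶ y) [Epi f] : Function.Surjective (F.map f)
  exact {x y z : C} (f : x ⟶ y) (g : y ⟶ z) (h : f ≫ g = 0)
    (hc : IsColimit (CokernelCofork.ofπ g h)) (s : F.obj y) (hs : F.map g s = 0) :
    ∃ s', F.map f s' = s

/-- The functor `c ↦ F c ⊗ x`. -/
def tensorFunctor {C : Type u₁} [Category.{v₁} C] {X : Type u₂} [Category.{v₂} X] [Preadditive X]
    [Linear k X] [IsHomFiniteAdditive k X] (F : C ⥤ ModuleCat.{v} k)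
    [∀ c, Module.Finite k (F.obj c)] (x : X) : C ⥤ X where
  obj c := (tensorObject k (F.obj c) x).pt
  map f := tensorMap k (F.map f).hom (𝟙 x)
  map_id c := by simp [tensorMap_id]
  map_comp f g := by simp [tensorMap_comp]

theorem exists_linearMap_comp_eq {U : Type u₁} {V : Type u₂} {W : Type u₃} [AddCommGroup U]
    [AddCommGroup V] [AddCommGroup W] [Module k U] [Module k V] [Module k W] (p : U →ₗ[k] V)
    (hp : Function.Surjective p) (φ : U →ₗ[k] W) (h : ∀ u, p u = 0 → φ u = 0) :
    ∃ ψ : V →ₗ[k] W, ∀ u, ψ (p u) = φ u := by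
  obtain ⟨s, hs⟩ := p.exists_rightInverse_of_surjective (LinearMap.range_eq_top.2 hp)
  refine ⟨φ ∘ₗ s, fun u => ?_⟩
  have h₁ : p (s (p u) - u) = 0 := by
    rw [map_sub, sub_eq_zero]
    exact LinearMap.congr_fun hs (p u)
  have := h _ h₁
  rwa [map_sub, sub_eq_zero] at this

/-- Cokernels are preserved since morphisms out of `V ⊗ x` are linear maps out of `V`. -/
theorem IsRightExactVec.tensorFunctor {C : Type u₁} [Category.{v₁} C] [Preadditive C] [Linear k C]
    [IsAbelianCat C] {X : Type u₂} [Category.{v₂} X] [Preadditive X] [Linear k X]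
    [IsHomFiniteAdditive k X] {F : C ⥤ ModuleCat.{v} k} (hF : IsRightExactVec F)
    [∀ c, Module.Finite k (F.obj c)] (x : X) : IsRightExactLinear k (tensorFunctor F x) := by
  have := hF.additive
  have := hF.linear
  have hadd : (FiniteLinear.tensorFunctor F x).Additive := ⟨fun {c d f g} => by
    refine tensor_hom_ext k fun v => ?_
    change tensorInc k (F.obj c) x v ≫ tensorMap k (F.map (f + g)).hom (𝟙 x) =
      tensorInc k (F.obj c) x v ≫
        (tensorMap k (F.map f).hom (𝟙 x) + tensorMap k (F.map g).hom (𝟙 x))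
    simp⟩
  have hlin : (FiniteLinear.tensorFunctor F x).Linear k := ⟨fun {c d} f r => by
    refine tensor_hom_ext k fun v => ?_
    change tensorInc k (F.obj c) x v ≫ tensorMap k (F.map (r • f)).hom (𝟙 x) =
      tensorInc k (F.obj c) x v ≫ (r • tensorMap k (F.map f).hom (𝟙 x))
    simp⟩
  refine ⟨hadd, hlin, ?_⟩
  have : HasFiniteBiproducts X := IsHomFiniteAdditive.hasFiniteBiproducts (k := k)
  have : HasZeroObject X := hasZeroObject_of_hasFiniteBiproducts X
  have : HasZeroObject C := hasZeroObject_of_hasFiniteBiproducts C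
  have : HasBinaryBiproducts C := hasBinaryBiproducts_of_finite_biproducts C
  have key {a b : C} (f : a ⟶ b) :
      PreservesColimit (parallelPair f 0) (FiniteLinear.tensorFunctor F x) := by
    refine preservesColimit_of_preserves_colimit_cocone (cokernelIsCokernel f) ?_
    refine (isColimitMapCoconeCoforkEquiv' (FiniteLinear.tensorFunctor F x)
      (cokernel.condition f)).symm ?_
    have hfac {z : X} (u : (tensorObject k (F.obj b) x).pt ⟶ z)
        (hu : tensorMap k (F.map f).hom (𝟙 x) ≫ u = 0) :
        ∃ l : (tensorObject k (F.obj (cokernel f)) x).pt ⟶ z,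
          tensorMap k (F.map (cokernel.π f)).hom (𝟙 x) ≫ l = u := by
      obtain ⟨ψ, hψ⟩ := exists_linearMap_comp_eq (F.map (cokernel.π f)).hom
        (hF.surjective (cokernel.π f)) (Linear.rightComp k x u ∘ₗ tensorInc k (F.obj b) x)
        (fun s hs => by
          obtain ⟨s', rfl⟩ := hF.exact f (cokernel.π f) (cokernel.condition f)
            (cokernelIsCokernel f) s hs
          have := congrArg (fun h => tensorInc k (F.obj a) x s' ≫ h) hu
          simpa [tensorInc_tensorMap_assoc] using this)
      refine ⟨tensorDesc k ψ, tensor_hom_ext k fun v => ?_⟩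
      rw [tensorInc_tensorMap_assoc, Category.id_comp, tensorInc_tensorDesc, hψ]
      rfl
    choose l hl using @hfac
    refine CokernelCofork.IsColimit.ofπ _ _ (fun u hu => l u hu) (fun u hu => hl u hu) ?_
    intro z u hu m hm
    refine tensor_hom_ext k fun v => ?_
    obtain ⟨v, rfl⟩ := hF.surjective (cokernel.π f) v
    have e := hm.trans (hl u hu).symm
    have := congrArg (fun h => tensorInc k (F.obj b) x v ≫ h) e
    have h₂ (n : (tensorObject k (F.obj (cokernel f)) x).pt ⟶ z) :
        tensorInc k (F.obj b) x v ≫ tensorMap k (F.map (cokernel.π f)).hom (𝟙 x) ≫ n =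
        tensorInc k (F.obj (cokernel f)) x (F.map (cokernel.π f) v) ≫ n := by
      rw [tensorInc_tensorMap_assoc, Category.id_comp]
    exact (h₂ m).symm.trans (this.trans (h₂ _))
  exact Functor.preservesFiniteColimits_of_preservesCokernels _

end TensorFunctor

open scoped CategoryTheory.Prod

/-! ### Morphisms between pure tensors -/

section HomTensor

variable {k : Type w} [Field k]
  {A : Type u₁} [Category.{v₁} A] [Preadditive A] [Linear k A]
  {B : Type u₂} [Category.{v₂} B] [Preadditive B] [Linear k B]
  {D : Type u₃} [Category.{v₃} D] [Preadditive D] [Linear k D]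
  {T : A × B ⥤ D}

omit [Preadditive A] [Preadditive B] [Preadditive D] in
theorem map_prod_eq (T : A × B ⥤ D) {a a' : A} {b b' : B} (f : a ⟶ a') (g : b ⟶ b') :
    T.map (f ×ₘ g) = (Prod.sectL A b ⋙ T).map f ≫ (Prod.sectR a' B ⋙ T).map g := by
  change _ = T.map (f ×ₘ 𝟙 b) ≫ T.map (𝟙 a' ×ₘ g)
  rw [← T.map_comp]
  congr 1
  ext <;> simp

/-- The linear map `Hom(a, a') ⊗ Hom(b, b') → Hom(a ⊠ b, a' ⊠ b')`, for a bilinear functor. -/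
def IsRightExactBilinear.homTensorMap (hT : IsRightExactBilinear k T) (a a' : A) (b b' : B) :
    (a ⟶ a') ⊗[k] (b ⟶ b') →ₗ[k] (T.obj (a, b) ⟶ T.obj (a', b')) :=
  have := (hT.left b).additive
  have := (hT.left b).linear
  have := (hT.right a').additive
  have := (hT.right a').linear
  let F : (a ⟶ a') →ₗ[k] (T.obj (a, b) ⟶ T.obj (a', b)) :=
    (Prod.sectL A b ⋙ T).mapLinearMap k
  let G : (b ⟶ b') →ₗ[k] (T.obj (a', b) ⟶ T.obj (a', b')) :=
    (Prod.sectR a' B ⋙ T).mapLinearMap k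
  TensorProduct.lift (LinearMap.compl₁₂ (Linear.comp _ _ _) F G)

variable (hT : IsRightExactBilinear k T)

@[simp]
theorem IsRightExactBilinear.homTensorMap_tmul {a a' : A} {b b' : B} (f : a ⟶ a') (g : b ⟶ b') :
    hT.homTensorMap a a' b b' (f ⊗ₜ g) = T.map (f ×ₘ g) := (map_prod_eq T f g).symm

theorem IsRightExactBilinear.homTensorMap_precomp {a a' a'' : A} {b b' b'' : B} (f : a ⟶ a')
    (g : b ⟶ b') (s : (a' ⟶ a'') ⊗[k] (b' ⟶ b'')) :
    hT.homTensorMap a a'' b b''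
      (TensorProduct.map (Linear.leftComp k a'' f) (Linear.leftComp k b'' g) s) =
        T.map (f ×ₘ g) ≫ hT.homTensorMap a' a'' b' b'' s := by
  induction s with
  | zero => simp
  | tmul f' g' =>
    rw [TensorProduct.map_tmul, homTensorMap_tmul, homTensorMap_tmul, ← T.map_comp]
    rfl
  | add s s' hs hs' => simp only [map_add, hs, hs', Preadditive.comp_add]

theorem IsRightExactBilinear.homTensorMap_postcomp {a a' a'' : A} {b b' b'' : B} (f : a' ⟶ a'')
    (g : b' ⟶ b'') (s : (a ⟶ a') ⊗[k] (b ⟶ b')) :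
    hT.homTensorMap a a'' b b''
      (TensorProduct.map (Linear.rightComp k a f) (Linear.rightComp k b g) s) =
        hT.homTensorMap a a' b b' s ≫ T.map (f ×ₘ g) := by
  induction s with
  | zero => simp
  | tmul f' g' =>
    rw [TensorProduct.map_tmul, homTensorMap_tmul, homTensorMap_tmul, ← T.map_comp]
    rfl
  | add s s' hs hs' => simp only [map_add, hs, hs', Preadditive.add_comp]

end HomTensor

/-! ### Right exact functors to vector spaces -/

section Vec

variable {k : Type w} [Field k]

/-- Both properties are tested on the quotient by the range of the map. -/
theorem isRightExactVec_of_isRightExactLinear {C : Type u₁} [Category.{v₁} C] [Preadditive C]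
    [Linear k C] {G : C ⥤ FGModuleCat.{w} k} (hG : IsRightExactLinear k G) :
    IsRightExactVec (G ⋙ forget₂ (FGModuleCat.{w} k) (ModuleCat.{w} k)) := by
  have := hG.additive
  have := hG.linear
  have := hG.preservesFiniteColimits
  refine ⟨⟨fun {x y f g} => ?_⟩, ⟨fun {x y} f r => ?_⟩, fun {x y} f _ => ?_,
    fun {x y z} f g h hc s hs => ?_⟩
  · exact congrArg (forget₂ (FGModuleCat.{w} k) (ModuleCat.{w} k)).map G.map_add
  · exact congrArg (forget₂ (FGModuleCat.{w} k) (ModuleCat.{w} k)).map (G.map_smul r f)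
  · let q : (G.obj y).obj →ₗ[k] _ := (LinearMap.range (G.map f).hom.hom).mkQ
    let π : G.obj y ⟶ FGModuleCat.of k ((G.obj y).obj ⧸ LinearMap.range (G.map f).hom.hom) :=
      FGModuleCat.ofHom q
    have : π = 0 := by
      rw [← cancel_epi (G.map f), comp_zero]
      ext s
      exact (Submodule.Quotient.mk_eq_zero _).2 ⟨s, rfl⟩
    intro s
    have hs : q s = 0 := congrArg (fun p : G.obj y ⟶ _ => p.hom.hom s) this
    exact (Submodule.Quotient.mk_eq_zero _).1 hs
  · let q : (G.obj y).obj →ₗ[k] _ := (LinearMap.range (G.map f).hom.hom).mkQ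
    let π : G.obj y ⟶ FGModuleCat.of k ((G.obj y).obj ⧸ LinearMap.range (G.map f).hom.hom) :=
      FGModuleCat.ofHom q
    obtain ⟨l, hl⟩ : ∃ l : G.obj z ⟶ _, G.map g ≫ l = π :=
      ⟨_, (CokernelCofork.IsColimit.desc' (CokernelCofork.mapIsColimit _ hc G) π (by
        ext s
        exact (Submodule.Quotient.mk_eq_zero _).2 ⟨s, rfl⟩)).2⟩
    have h₁ : q s = l.hom.hom ((G.map g).hom.hom s) :=
      congrArg (fun p : G.obj y ⟶ _ => p.hom.hom s) hl.symm
    have h₂ : (G.map g).hom.hom s = 0 := hs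
    rw [h₂, map_zero] at h₁
    exact (Submodule.Quotient.mk_eq_zero _).1 h₁

theorem tensorInc_injective {X : Type u₂} [Category.{v₂} X] [Preadditive X] [Linear k X]
    [IsHomFiniteAdditive k X] (V : Type u₁) [AddCommGroup V] [Module k V] [Module.Finite k V]
    {x : X} (hx : 𝟙 x ≠ 0) : Function.Injective (tensorInc k V x) := by
  obtain ⟨ξ, hξ⟩ := Module.Projective.exists_dual_eq_one k hx
  -- a functional with `ξ (𝟙 x) = 1` gives a retraction `V ⊗ Hom(x, x) → V`
  refine Function.LeftInverse.injective
    (g := fun f => TensorProduct.rid k V (ξ.lTensor V ((tensorObject k V x).equiv x f))) fun v => ?_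
  simp [equiv_tensorInc, hξ]

theorem fgModuleCat_id_ne_zero : 𝟙 (FGModuleCat.of k k) ≠ 0 := fun h =>
  one_ne_zero (congrArg (fun p : FGModuleCat.of k k ⟶ FGModuleCat.of k k => p.hom.hom (1 : k)) h)

/-- The elements of a vector space, as morphisms out of the unit object. -/
def fgModuleCatEval (M : FGModuleCat.{w} k) : (FGModuleCat.of k k ⟶ M) ≃ₗ[k] M.obj where
  toFun f := f.hom.hom (1 : k)
  map_add' _ _ := rfl
  map_smul' _ _ := rfl
  invFun m := FGModuleCat.ofHom (LinearMap.toSpanSingleton k M.obj m)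
  left_inv f := by
    ext
    exact one_smul k _
  right_inv m := one_smul k m

/-- A vector space is the underlying space of its tensor product with the unit object. -/
def tensorUnit (V : Type u₁) [AddCommGroup V] [Module k V] [Module.Finite k V] :
    V ≃ₗ[k] (tensorObject k V (FGModuleCat.of k k)).pt.obj :=
  LinearEquiv.ofBijective
    ((fgModuleCatEval _).toLinearMap ∘ₗ tensorInc k V (FGModuleCat.of k k)) (by
    constructor
    · exact (fgModuleCatEval _).injective.comp (tensorInc_injective V fgModuleCat_id_ne_zero)
    · intro m
      obtain ⟨f, rfl⟩ := (fgModuleCatEval _).surjective m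
      obtain ⟨s, rfl⟩ := ((tensorObject k V (FGModuleCat.of k k)).equiv _).symm.surjective f
      induction s with
      | zero => exact ⟨0, by simp⟩
      | tmul v g =>
        refine ⟨fgModuleCatEval _ g • v, congrArg (fgModuleCatEval _) ?_⟩
        apply ((tensorObject k V (FGModuleCat.of k k)).equiv _).injective
        rw [LinearEquiv.apply_symm_apply, equiv_tensorInc, TensorProduct.smul_tmul]
        congr 1
        ext
        exact mul_one _
      | add s t hs ht =>
        obtain ⟨v, hv⟩ := hs
        obtain ⟨v', hv'⟩ := ht
        exact ⟨v + v', by rw [map_add, hv, hv', map_add, map_add]⟩)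

theorem tensorMap_tensorUnit {V : Type u₁} [AddCommGroup V] [Module k V] [Module.Finite k V]
    {W : Type u₂} [AddCommGroup W] [Module k W] [Module.Finite k W] (φ : V →ₗ[k] W) (v : V) :
    (tensorMap k φ (𝟙 (FGModuleCat.of k k))).hom.hom (tensorUnit V v) = tensorUnit W (φ v) := by
  have := tensorInc_tensorMap k φ (𝟙 (FGModuleCat.of k k)) v
  rw [Category.id_comp] at this
  exact congrArg (fgModuleCatEval _) this

end Vec

/-! ### Right exact bilinear functors to vector spaces -/

section DeligneVec

variable {k : Type w} [Field k]
  {A : Type u₁} [Category.{v₁} A] [Preadditive A] [Linear k A] [IsAbelianCat A]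
  {B : Type u₂} [Category.{v₂} B] [Preadditive B] [Linear k B] [IsAbelianCat B]
  {D : Type u₃} [Category.{v₃} D] [Preadditive D] [Linear k D]
  {T : A × B ⥤ D}

/-- A bifunctor to finite-dimensional vector spaces that is right exact in each variable extends to
the Deligne product: `c ↦ Φ c ⊗ k` takes values in the finite linear category of
finite-dimensional vector spaces, to which the universal property applies. -/
theorem IsDeligneProduct.exists_extension_vec (hT : IsDeligneProduct k T)
    (Φ : A × B ⥤ ModuleCat.{v} k) [∀ x, Module.Finite k (Φ.obj x)]
    (hl : ∀ b, IsRightExactVec (Prod.sectL A b ⋙ Φ))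
    (hr : ∀ a, IsRightExactVec (Prod.sectR a B ⋙ Φ)) :
    ∃ (G : D ⥤ ModuleCat.{w} k) (_ : ∀ d, Module.Finite k (G.obj d)), IsRightExactVec G ∧
      ∃ χ : ∀ a b, Φ.obj (a, b) ≃ₗ[k] G.obj (T.obj (a, b)),
        ∀ {a a' b b'} (f : a ⟶ a') (g : b ⟶ b') (s : Φ.obj (a, b)),
          G.map (T.map (f ×ₘ g)) (χ a b s) = χ a' b' (Φ.map (f ×ₘ g) s) := by
  obtain ⟨G, hG, ⟨α⟩⟩ := hT.exists_extension (tensorFunctor Φ (FGModuleCat.of k k))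
    ⟨fun b =>
      have (x : A) : Module.Finite k ((Prod.sectL A b ⋙ Φ).obj x) :=
        inferInstanceAs (Module.Finite k (Φ.obj (x, b)))
      (hl b).tensorFunctor (FGModuleCat.of k k),
    fun a =>
      have (x : B) : Module.Finite k ((Prod.sectR a B ⋙ Φ).obj x) :=
        inferInstanceAs (Module.Finite k (Φ.obj (a, x)))
      (hr a).tensorFunctor (FGModuleCat.of k k)⟩
  let χ (a : A) (b : B) : Φ.obj (a, b) ≃ₗ[k] (G.obj (T.obj (a, b))).obj :=
    tensorUnit _ ≪≫ₗ LinearEquiv.ofLinearMap (α.inv.app (a, b)).hom.hom (α.hom.app (a, b)).hom.hom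
      (congrArg (fun p => p.hom.hom) (α.hom_inv_id_app (a, b)))
      (congrArg (fun p => p.hom.hom) (α.inv_hom_id_app (a, b)))
  refine ⟨G ⋙ forget₂ (FGModuleCat.{w} k) (ModuleCat.{w} k), fun d => (G.obj d).property,
    isRightExactVec_of_isRightExactLinear hG, χ, fun {a a' b b'} f g s => ?_⟩
  have := congrArg (fun p => p.hom.hom (tensorUnit _ s)) (α.inv.naturality (f ×ₘ g)).symm
  refine this.trans (congrArg (α.inv.app (a', b')).hom.hom ?_)
  exact tensorMap_tensorUnit (Φ.map (f ×ₘ g)).hom s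

omit [IsAbelianCat A] [IsAbelianCat B] in
/-- Natural transformations between right exact functors to vector spaces are determined by their
values on pure tensors. -/
theorem IsDeligneProduct.vec_ext [IsAbelianCat D] (hT : IsDeligneProduct k T)
    {G : D ⥤ ModuleCat.{v} k} {H : D ⥤ ModuleCat.{v} k}
    [∀ d, Module.Finite k (G.obj d)] [∀ d, Module.Finite k (H.obj d)]
    (hG : IsRightExactVec G) (hH : IsRightExactVec H) {β γ : G ⟶ H}
    (h : ∀ a b, β.app (T.obj (a, b)) = γ.app (T.obj (a, b))) : β = γ := by
  let t (δ : G ⟶ H) : tensorFunctor G (FGModuleCat.of k k) ⟶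
      tensorFunctor H (FGModuleCat.of k k) :=
    { app := fun d => tensorMap k (δ.app d).hom (𝟙 _)
      naturality := fun d d' f => by
        have := congrArg (fun p : G.obj d ⟶ H.obj d' => tensorMap k p.hom (𝟙 (FGModuleCat.of k k)))
          (δ.naturality f)
        simp only [tensorFunctor, tensorMap_comp, Category.comp_id]
        exact this }
  have key : t β = t γ := hT.ext (hG.tensorFunctor _) (hH.tensorFunctor _) fun a b =>
    congrArg (fun p : G.obj (T.obj (a, b)) ⟶ H.obj (T.obj (a, b)) =>
      tensorMap k p.hom (𝟙 (FGModuleCat.of k k))) (h a b)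
  ext d s
  apply (tensorUnit (k := k) (H.obj d)).injective
  refine (tensorMap_tensorUnit (β.app d).hom s).symm.trans
    (Eq.trans ?_ (tensorMap_tensorUnit (γ.app d).hom s))
  exact congrArg (fun p => p.hom.hom (tensorUnit _ s)) (congrArg (fun p => NatTrans.app p d) key)

end DeligneVec

/-! ### Morphism spaces as right exact functors -/

section HomFunctors

variable {k : Type w} [Field k]
  {A : Type u₁} [Category.{v₁} A] [Preadditive A] [Linear k A]
  {B : Type u₂} [Category.{v₂} B] [Preadditive B] [Linear k B]

variable (k) in
/-- The functor `(a, b) ↦ Hom(p, a) ⊗ Hom(q, b)`. -/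
def homTensorFunctor (p : A) (q : B) : A × B ⥤ ModuleCat.{max v₁ v₂} k where
  obj x := ModuleCat.of k ((p ⟶ x.1) ⊗[k] (q ⟶ x.2))
  map f := ModuleCat.ofHom (TensorProduct.map (Linear.rightComp k p f.1) (Linear.rightComp k q f.2))
  map_id x := by
    ext : 1
    refine TensorProduct.ext' fun f g => ?_
    simp
  map_comp f g := by
    ext : 1
    refine TensorProduct.ext' fun f g => ?_
    simp

theorem sectL_homTensorFunctor_map (p : A) (q : B) {a a' : A} (f : a ⟶ a') (b : B) :
    ((Prod.sectL A b ⋙ homTensorFunctor k p q).map f).hom =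
      (Linear.rightComp k p f).rTensor (q ⟶ b) :=
  TensorProduct.ext' fun u v => congrArg (fun v' => (u ≫ f) ⊗ₜ[k] v') (Category.comp_id v)

theorem sectR_homTensorFunctor_map (p : A) (q : B) {b b' : B} (f : b ⟶ b') (a : A) :
    ((Prod.sectR a B ⋙ homTensorFunctor k p q).map f).hom =
      (Linear.rightComp k q f).lTensor (p ⟶ a) :=
  TensorProduct.ext' fun u v => congrArg (fun u' => u' ⊗ₜ[k] (v ≫ f)) (Category.comp_id u)

theorem rightComp_surjective (p : A) [Projective p] {x y : A} (f : x ⟶ y) [Epi f] :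
    Function.Surjective (Linear.rightComp k p f) :=
  fun u => ⟨Projective.factorThru u f, Projective.factorThru_comp u f⟩

theorem rightComp_exact [IsAbelianCat A] (p : A) [Projective p] {x y z : A} (f : x ⟶ y)
    (g : y ⟶ z) (h : f ≫ g = 0) (hc : IsColimit (CokernelCofork.ofπ g h)) :
    Function.Exact (Linear.rightComp k p f) (Linear.rightComp k p g) := by
  intro u
  constructor
  · exact fun hu => exists_comp_eq_of_projective p f g h hc u hu
  · rintro ⟨u', rfl⟩
    simp [h]

theorem isRightExactVec_sectL_homTensorFunctor [IsAbelianCat A] (p : A) [Projective p] (q b : B) :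
    IsRightExactVec (Prod.sectL A b ⋙ homTensorFunctor k p q) where
  additive := ⟨fun {x y f g} => by
    have h : (Linear.rightComp k p (f + g)).rTensor (q ⟶ b) =
        (Linear.rightComp k p f).rTensor (q ⟶ b) + (Linear.rightComp k p g).rTensor (q ⟶ b) :=
      TensorProduct.ext' fun u v => by simp [TensorProduct.add_tmul]
    exact ModuleCat.hom_ext ((sectL_homTensorFunctor_map p q (f + g) b).trans (h.trans
      (congrArg₂ (· + ·) (sectL_homTensorFunctor_map p q f b).symm
        (sectL_homTensorFunctor_map p q g b).symm)))⟩
  linear := ⟨fun {x y} f r => by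
    have h : (Linear.rightComp k p (r • f)).rTensor (q ⟶ b) =
        r • (Linear.rightComp k p f).rTensor (q ⟶ b) :=
      TensorProduct.ext' fun u v => by simp [TensorProduct.smul_tmul']
    exact ModuleCat.hom_ext ((sectL_homTensorFunctor_map p q (r • f) b).trans (h.trans
      (congrArg (r • ·) (sectL_homTensorFunctor_map p q f b).symm)))⟩
  surjective f _ := by
    have := LinearMap.rTensor_surjective (q ⟶ b) (rightComp_surjective (k := k) p f)
    rw [← sectL_homTensorFunctor_map] at this
    exact this
  exact f g h hc s hs := by
    have := rTensor_exact (q ⟶ b) (rightComp_exact (k := k) p f g h hc)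
      (have : Epi g := epi_of_isColimit_cofork hc; rightComp_surjective p g)
    rw [← sectL_homTensorFunctor_map, ← sectL_homTensorFunctor_map] at this
    exact (this s).1 hs

theorem isRightExactVec_sectR_homTensorFunctor [IsAbelianCat B] (p a : A) (q : B) [Projective q] :
    IsRightExactVec (Prod.sectR a B ⋙ homTensorFunctor k p q) where
  additive := ⟨fun {x y f g} => by
    have h : (Linear.rightComp k q (f + g)).lTensor (p ⟶ a) =
        (Linear.rightComp k q f).lTensor (p ⟶ a) + (Linear.rightComp k q g).lTensor (p ⟶ a) :=
      TensorProduct.ext' fun u v => by simp [TensorProduct.tmul_add]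
    exact ModuleCat.hom_ext ((sectR_homTensorFunctor_map p q (f + g) a).trans (h.trans
      (congrArg₂ (· + ·) (sectR_homTensorFunctor_map p q f a).symm
        (sectR_homTensorFunctor_map p q g a).symm)))⟩
  linear := ⟨fun {x y} f r => by
    have h : (Linear.rightComp k q (r • f)).lTensor (p ⟶ a) =
        r • (Linear.rightComp k q f).lTensor (p ⟶ a) :=
      TensorProduct.ext' fun u v => by simp [TensorProduct.smul_tmul']
    exact ModuleCat.hom_ext ((sectR_homTensorFunctor_map p q (r • f) a).trans (h.trans
      (congrArg (r • ·) (sectR_homTensorFunctor_map p q f a).symm)))⟩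
  surjective f _ := by
    have := LinearMap.lTensor_surjective (p ⟶ a) (rightComp_surjective (k := k) q f)
    rw [← sectR_homTensorFunctor_map] at this
    exact this
  exact f g h hc s hs := by
    have := lTensor_exact (p ⟶ a) (rightComp_exact (k := k) q f g h hc)
      (have : Epi g := epi_of_isColimit_cofork hc; rightComp_surjective q g)
    rw [← sectR_homTensorFunctor_map, ← sectR_homTensorFunctor_map] at this
    exact (this s).1 hs

variable (k) in
/-- The functor `a ↦ Hom(a, c)^*`. -/
def homDualFunctor (c : A) : A ⥤ ModuleCat.{max v₁ w} k where
  obj a := ModuleCat.of k (Module.Dual k (a ⟶ c))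
  map f := ModuleCat.ofHom (Linear.leftComp k c f).dualMap
  map_id x := by
    ext s u
    exact congrArg s (Category.id_comp u)
  map_comp f g := by
    ext s u
    exact congrArg s (Category.assoc f g u)

theorem isRightExactVec_homDualFunctor (c : A) : IsRightExactVec (homDualFunctor k c) where
  additive := ⟨fun {x y f g} => ModuleCat.hom_ext (LinearMap.ext
    fun (s : Module.Dual k (x ⟶ c)) => LinearMap.ext fun (u : y ⟶ c) =>
      show s ((f + g) ≫ u) = s (f ≫ u) + s (g ≫ u) by rw [Preadditive.add_comp, map_add])⟩
  linear := ⟨fun {x y} f r => ModuleCat.hom_ext (LinearMap.ext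
    fun (s : Module.Dual k (x ⟶ c)) => LinearMap.ext fun (u : y ⟶ c) =>
      show s ((r • f) ≫ u) = r • s (f ≫ u) by rw [Linear.smul_comp, map_smul])⟩
  surjective f _ := LinearMap.dualMap_surjective_of_injective fun a b h => by
    simpa [cancel_epi] using h
  exact {x y z} f g h hc s hs := by
    have (s : Module.Dual k (y ⟶ c)) (hs : (Linear.leftComp k c g).dualMap s = 0) :
        s ∈ LinearMap.range (Linear.leftComp k c f).dualMap := by
      rw [LinearMap.range_dualMap_eq_dualAnnihilator_ker, Submodule.mem_dualAnnihilator]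
      intro u hu
      obtain ⟨l, rfl⟩ := CokernelCofork.IsColimit.desc' hc u hu
      exact LinearMap.congr_fun hs l
    exact this s hs

end HomFunctors

/-! ### The Deligne product of projective generators -/

section Generator

variable {k : Type w} [Field k]
  {A : Type u₁} [Category.{v₁} A] [Preadditive A] [Linear k A] [IsHomFiniteAdditive k A]
  [IsAbelianCat A]
  {B : Type u₂} [Category.{v₂} B] [Preadditive B] [Linear k B] [IsHomFiniteAdditive k B]
  [IsAbelianCat B]
  {D : Type u₃} [Category.{v₃} D] [Preadditive D] [Linear k D] [IsFiniteLinear k D]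
  [IsAbelianCat D]
  {T : A × B ⥤ D}

/-- The functor `Hom(p, -) ⊗ Hom(q, -)` extends to the Deligne product, where it is represented
by `p ⊠ q`. -/
theorem IsDeligneProduct.projective_and_bijective (hT : IsDeligneProduct k T) (p : A) (q : B)
    [Projective p] [Projective q] : Projective (T.obj (p, q)) ∧
      ∀ a b, Function.Bijective (hT.rightExact.homTensorMap p a q b) := by
  have (x : A × B) : Module.Finite k ((homTensorFunctor k p q).obj x) :=
    inferInstanceAs (Module.Finite k ((p ⟶ x.1) ⊗[k] (q ⟶ x.2)))
  obtain ⟨G, hfin, hG, χ, hχ⟩ := hT.exists_extension_vec (homTensorFunctor k p q)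
    (isRightExactVec_sectL_homTensorFunctor p q) (fun a =>
      isRightExactVec_sectR_homTensorFunctor p a q)
  have hadd := hG.additive
  have hlin := hG.linear
  -- `κ`, induced by `Hom(p, a) ⊗ Hom(q, b) → Hom(t, a ⊠ b)`, and the evaluation `ev` at the
  -- universal element `u` are mutually inverse, so that `G` is represented by `t`
  let t := T.obj (p, q)
  let u : G.obj t := χ p q (𝟙 p ⊗ₜ 𝟙 q)
  let α : T ⋙ tensorFunctor G t ⟶ T ⋙ 𝟭 D :=
    { app := fun x => tensorDesc k
        (hT.rightExact.homTensorMap p x.1 q x.2 ∘ₗ (χ x.1 x.2).symm.toLinearMap)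
      naturality := fun x y f => by
        refine tensor_hom_ext k fun v => ?_
        obtain ⟨s, rfl⟩ := (χ x.1 x.2).surjective v
        have h₁ := tensorInc_tensorMap_assoc k (G.map (T.map f)).hom (𝟙 t) (χ x.1 x.2 s)
          (tensorDesc k
            (hT.rightExact.homTensorMap p y.1 q y.2 ∘ₗ (χ y.1 y.2).symm.toLinearMap))
        refine h₁.trans ?_
        rw [Category.id_comp, tensorInc_tensorDesc]
        have h₂ : (χ y.1 y.2).symm (G.map (T.map f) (χ x.1 x.2 s)) =
            (homTensorFunctor k p q).map f s :=
          (LinearEquiv.symm_apply_eq _).2 (hχ f.1 f.2 s)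
        refine (congrArg (hT.rightExact.homTensorMap p y.1 q y.2) h₂).trans ?_
        refine (hT.rightExact.homTensorMap_postcomp f.1 f.2 s).trans ?_
        have h₃ : tensorInc k (G.obj (T.obj x)) t (χ x.1 x.2 s) ≫ tensorDesc k
            (hT.rightExact.homTensorMap p x.1 q x.2 ∘ₗ (χ x.1 x.2).symm.toLinearMap) =
            hT.rightExact.homTensorMap p x.1 q x.2 s :=
          (tensorInc_tensorDesc k _ _).trans
            (congrArg (hT.rightExact.homTensorMap p x.1 q x.2) ((χ x.1 x.2).symm_apply_apply s))
        exact (congrArg (· ≫ T.map f) h₃).symm.trans (Category.assoc _ _ _) }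
  obtain ⟨β, hβ, -⟩ := hT.existsUnique_extension (hG.tensorFunctor t)
    ⟨inferInstance, inferInstance, inferInstance⟩ α
  let κ (d : D) : G.obj d →ₗ[k] (t ⟶ d) :=
    Linear.rightComp k t (β.app d) ∘ₗ tensorInc k (G.obj d) t
  have κ_nat {d d' : D} (f : d ⟶ d') (v : G.obj d) : κ d' (G.map f v) = κ d v ≫ f := by
    have h₁ := congrArg (fun h => tensorInc k (G.obj d) t v ≫ h) (β.naturality f)
    have h₂ := tensorInc_tensorMap_assoc k (G.map f).hom (𝟙 t) v (β.app d')
    rw [Category.id_comp] at h₂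
    exact h₂.symm.trans (h₁.trans (Category.assoc _ _ _).symm)
  have κ_χ (a : A) (b : B) (s) : κ (T.obj (a, b)) (χ a b s) =
      hT.rightExact.homTensorMap p a q b s := by
    have h₁ : β.app (T.obj (a, b)) = α.app (a, b) := congrArg (fun δ => δ.app (a, b)) hβ
    change tensorInc k _ t (χ a b s) ≫ β.app (T.obj (a, b)) = _
    rw [h₁]
    refine (tensorInc_tensorDesc k _ _).trans ?_
    exact congrArg (hT.rightExact.homTensorMap p a q b) ((χ a b).symm_apply_apply s)
  let ev (d : D) : (t ⟶ d) →ₗ[k] G.obj d :=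
    { toFun := fun f => G.map f u
      map_add' := fun f g => by simp
      map_smul' := fun r f => by simp }
  have ev_nat {d d' : D} (f : d ⟶ d') (g : t ⟶ d) : ev d' (g ≫ f) = G.map f (ev d g) := by
    simp [ev]
  let δ : G ⟶ G :=
    { app := fun d => ModuleCat.ofHom (ev d ∘ₗ κ d)
      naturality := fun d d' f => by
        ext v
        change ev d' (κ d' (G.map f v)) = G.map f (ev d (κ d v))
        rw [κ_nat, ev_nat] }
  have hδ : δ = 𝟙 G := hT.vec_ext hG hG fun a b => by
    ext v
    obtain ⟨s, rfl⟩ := (χ a b).surjective v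
    change ev _ (κ _ (χ a b s)) = χ a b s
    rw [κ_χ]
    have : ev _ ∘ₗ hT.rightExact.homTensorMap p a q b = (χ a b).toLinearMap := by
      refine TensorProduct.ext' fun f g => ?_
      refine (congrArg (ev _) (hT.rightExact.homTensorMap_tmul f g)).trans ?_
      refine (hχ f g (𝟙 p ⊗ₜ[k] 𝟙 q)).trans (congrArg (χ a b) ?_)
      exact congrArg₂ (fun f' g' => f' ⊗ₜ[k] g') (Category.id_comp f) (Category.id_comp g)
    exact LinearMap.congr_fun this s
  have ev_κ (d : D) (v : G.obj d) : ev d (κ d v) = v :=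
    congrArg (fun δ : G ⟶ G => δ.app d v) hδ
  have κ_ev (d : D) (f : t ⟶ d) : κ d (ev d f) = f := by
    refine (κ_nat f u).trans ?_
    have : κ t u = 𝟙 t := (κ_χ p q _).trans
      ((hT.rightExact.homTensorMap_tmul (𝟙 p) (𝟙 q)).trans (T.map_id (p, q)))
    rw [this, Category.id_comp]
  refine ⟨⟨fun {x y} f e _ => ?_⟩, fun a b => ?_⟩
  · obtain ⟨v, hv⟩ := hG.surjective e (ev _ f)
    refine ⟨κ _ v, ?_⟩
    rw [← κ_nat, hv, κ_ev]
  · have : (fun s => κ (T.obj (a, b)) (χ a b s)) = hT.rightExact.homTensorMap p a q b :=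
      funext (κ_χ a b)
    rw [← this]
    exact (Function.bijective_iff_has_inverse.2 ⟨ev _, ev_κ _, κ_ev _⟩).comp (χ a b).bijective

end Generator

/-! ### The Deligne product has a Serre pair -/

section Generator

variable {k : Type w} [Field k]

/-- A projective object with nonzero morphisms to every nonzero object is a generator: the cokernel
of the evaluation `Hom(t, d) ⊗ t ⟶ d` receives no nonzero morphisms from `t`. -/
theorem exists_epi_of_projective {X : Type u} [Category.{v} X] [Preadditive X] [Linear k X]
    [IsHomFiniteAdditive k X] [IsAbelianCat X] (t : X) [Projective t]
    (ht : ∀ c : X, (∀ u : t ⟶ c, u = 0) → 𝟙 c = 0) (d : X) :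
    ∃ (n : ℕ) (p : (⨁ fun _ : Fin n => t) ⟶ d), Epi p := by
  let b := Module.finBasis k (t ⟶ d)
  let p : (⨁ fun _ : Fin (Module.finrank k (t ⟶ d)) => t) ⟶ d := biproduct.desc fun j => b j
  refine ⟨_, p, ?_⟩
  have hu (u : t ⟶ d) : u ≫ cokernel.π p = 0 := by
    have hb (j) : b j ≫ cokernel.π p = 0 := by
      rw [← biproduct.ι_desc (fun j => b j) j, Category.assoc]
      exact (congrArg _ (cokernel.condition p)).trans comp_zero
    rw [← b.sum_repr u, Preadditive.sum_comp]
    simp [hb]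
  have h0 : 𝟙 (cokernel p) = 0 := ht _ fun u => by
    rw [← Projective.factorThru_comp u (cokernel.π p), hu]
  have hπ : cokernel.π p = 0 := by
    rw [← Category.comp_id (cokernel.π p), h0, comp_zero]
  refine Preadditive.epi_of_cancel_zero _ fun {z} g hg => ?_
  rw [← cokernel.π_desc p g hg, hπ, zero_comp]

variable
  {A : Type u₁} [Category.{v₁} A] [Preadditive A] [Linear k A] [IsHomFiniteAdditive k A]
  [IsAbelianCat A]
  {B : Type u₂} [Category.{v₂} B] [Preadditive B] [Linear k B] [IsHomFiniteAdditive k B]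
  [IsAbelianCat B]
  {D : Type u₃} [Category.{v₃} D] [Preadditive D] [Linear k D] [IsFiniteLinear k D]
  [IsAbelianCat D]
  {T : A × B ⥤ D} (S : SerrePair k A) (S' : SerrePair k B)

/-- Objects without morphisms from `P ⊠ P'` receive no nonzero morphisms from any `a ⊠ b`, and
then the functor `Hom(-, c)^*` vanishes. -/
theorem IsDeligneProduct.id_eq_zero (hT : IsDeligneProduct k T) (c : D)
    (hc : ∀ u : T.obj (S.P, S'.P) ⟶ c, u = 0) : 𝟙 c = 0 := by
  have h (a : A) (b : B) (g : T.obj (a, b) ⟶ c) : g = 0 := by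
    have := (hT.rightExact.left b).additive
    have := (hT.rightExact.left b).preservesFiniteColimits
    have := (hT.rightExact.right S.P).additive
    have := (hT.rightExact.right S.P).preservesFiniteColimits
    refine S.map_hom_ext (Prod.sectL A b ⋙ T) fun f => ?_
    refine S'.map_hom_ext (Prod.sectR S.P B ⋙ T) fun f' => ?_
    exact (hc _).trans (hc _).symm
  have (d : D) : Module.Finite k ((homDualFunctor k c).obj d) :=
    inferInstanceAs (Module.Finite k (Module.Dual k (d ⟶ c)))
  have key : 𝟙 (homDualFunctor k c) = 0 :=
    hT.vec_ext (isRightExactVec_homDualFunctor c) (isRightExactVec_homDualFunctor c)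
      fun a b => by
        refine ModuleCat.hom_ext (LinearMap.ext fun s => LinearMap.ext fun u => ?_)
        rw [h a b u]
        exact (LinearMap.map_zero _).trans (LinearMap.map_zero _).symm
  rw [← Module.forall_dual_apply_eq_zero_iff k]
  intro ξ
  have h₁ : (𝟙 (homDualFunctor k c) : homDualFunctor k c ⟶ _).app c ξ =
      (0 : homDualFunctor k c ⟶ homDualFunctor k c).app c ξ := by rw [key]
  have h₂ : ξ = 0 := h₁
  rw [h₂, LinearMap.zero_apply]

theorem IsDeligneProduct.exists_epi (hT : IsDeligneProduct k T) (d : D) :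
    ∃ (n : ℕ) (p : (⨁ fun _ : Fin n => T.obj (S.P, S'.P)) ⟶ d), Epi p :=
  have := S.projective
  have := S'.projective
  have := (hT.projective_and_bijective S.P S'.P).1
  exists_epi_of_projective (k := k) _ (hT.id_eq_zero S S') d

include S S' in
/-- Morphisms between pure tensors are tensors of morphisms: this holds for morphisms out of
`P ⊠ P'`, and both sides are left exact in `a` and in `b`. -/
theorem IsDeligneProduct.homTensorMap_bijective (hT : IsDeligneProduct k T) (a a' : A) (b b' : B) :
    Function.Bijective (hT.rightExact.homTensorMap a a' b b') := by
  have := S.projective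
  have := S'.projective
  have h₁ (a : A) : Function.Bijective (hT.rightExact.homTensorMap a a' S'.P b') := by
    have := (hT.rightExact.left S'.P).additive
    have := (hT.rightExact.left S'.P).preservesFiniteColimits
    refine LeftExactPresheaf.bijective S.exists_epi
      ((LeftExactPresheaf.hom (k := k) (𝟭 A) a').tensor (S'.P ⟶ b'))
      (LeftExactPresheaf.hom (k := k) (Prod.sectL A S'.P ⋙ T) (T.obj (a', b')))
      (fun x => hT.rightExact.homTensorMap x a' S'.P b') (fun {x y} h s => ?_)
      ((hT.projective_and_bijective S.P S'.P).2 a' b') a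
    have := hT.rightExact.homTensorMap_precomp h (𝟙 S'.P) s
    rw [leftComp_id] at this
    exact this
  have := (hT.rightExact.right a).additive
  have := (hT.rightExact.right a).preservesFiniteColimits
  refine LeftExactPresheaf.bijective S'.exists_epi
    ((LeftExactPresheaf.hom (k := k) (𝟭 B) b').tensorLeft (a ⟶ a'))
    (LeftExactPresheaf.hom (k := k) (Prod.sectR a B ⋙ T) (T.obj (a', b')))
    (fun x => hT.rightExact.homTensorMap a a' x b') (fun {x y} h s => ?_) (h₁ a) b
  have := hT.rightExact.homTensorMap_precomp (𝟙 a) h s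
  rw [leftComp_id] at this
  exact this

/-- The linear form on `Hom(P ⊠ P', I ⊠ I') = Hom(P, I) ⊗ Hom(P', I')`. -/
def IsDeligneProduct.form (hT : IsDeligneProduct k T) :
    (T.obj (S.P, S'.P) ⟶ T.obj (S.I, S'.I)) →ₗ[k] k :=
  TensorProduct.lift ((LinearMap.mul k k).compl₁₂ S.form S'.form) ∘ₗ
    (LinearEquiv.ofBijective _ (hT.homTensorMap_bijective S S' S.P S.I S'.P S'.I)).symm.toLinearMap

theorem IsDeligneProduct.form_map (hT : IsDeligneProduct k T) (f : S.P ⟶ S.I) (g : S'.P ⟶ S'.I) :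
    hT.form S S' (T.map (f ×ₘ g)) = S.form f * S'.form g := by
  have : (LinearEquiv.ofBijective _ (hT.homTensorMap_bijective S S' S.P S.I S'.P S'.I)).symm
      (T.map (f ×ₘ g)) = f ⊗ₜ g :=
    (LinearEquiv.symm_apply_eq _).2 (hT.rightExact.homTensorMap_tmul f g).symm
  exact (congrArg (TensorProduct.lift ((LinearMap.mul k k).compl₁₂ S.form S'.form)) this).trans
    (by simp)

/-- For `x = P ⊠ P'` the pairing is the tensor product of the two given perfect pairings. -/
theorem IsDeligneProduct.form_perfect (hT : IsDeligneProduct k T) :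
    Function.Bijective fun g : T.obj (S.P, S'.P) ⟶ T.obj (S.I, S'.I) =>
      (hT.form S S' ∘ₗ Linear.rightComp k _ g :
        Module.Dual k (T.obj (S.P, S'.P) ⟶ T.obj (S.P, S'.P))) := by
  let e₁ := LinearEquiv.ofBijective _ (hT.homTensorMap_bijective S S' S.P S.I S'.P S'.I)
  let e₂ := LinearEquiv.ofBijective _ (hT.homTensorMap_bijective S S' S.P S.P S'.P S'.P)
  let φ : (S.P ⟶ S.I) →ₗ[k] Module.Dual k (S.P ⟶ S.P) :=
    LinearMap.mk₂ k (fun g f => S.form (f ≫ g)) (by simp) (by simp) (by simp) (by simp)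
  let φ' : (S'.P ⟶ S'.I) →ₗ[k] Module.Dual k (S'.P ⟶ S'.P) :=
    LinearMap.mk₂ k (fun g f => S'.form (f ≫ g)) (by simp) (by simp) (by simp) (by simp)
  let c := TensorProduct.congr (LinearEquiv.ofBijective φ (S.perfect _))
    (LinearEquiv.ofBijective φ' (S'.perfect _)) ≪≫ₗ TensorProduct.dualDistribEquiv k _ _
  let ψ : (T.obj (S.P, S'.P) ⟶ T.obj (S.I, S'.I)) →ₗ[k]
      Module.Dual k (T.obj (S.P, S'.P) ⟶ T.obj (S.P, S'.P)) :=
    LinearMap.mk₂ k (fun g f => hT.form S S' (f ≫ g)) (by simp) (by simp) (by simp) (by simp)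
  have key : e₂.toLinearMap.dualMap ∘ₗ ψ ∘ₗ e₁.toLinearMap = c.toLinearMap := by
    refine TensorProduct.ext' fun g g' => TensorProduct.ext' fun f f' => ?_
    have h₁ : e₁ (g ⊗ₜ g') = T.map (g ×ₘ g') := hT.rightExact.homTensorMap_tmul g g'
    have h₂ : e₂ (f ⊗ₜ f') = T.map (f ×ₘ f') := hT.rightExact.homTensorMap_tmul f f'
    change hT.form S S' (e₂ (f ⊗ₜ f') ≫ e₁ (g ⊗ₜ g')) = S.form (f ≫ g) * S'.form (f' ≫ g')
    rw [h₁, h₂, ← T.map_comp]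
    exact hT.form_map S S' (f ≫ g) (f' ≫ g')
  have h (g) : ψ g = (e₁.symm ≪≫ₗ c ≪≫ₗ e₂.symm.dualMap) g := by
    obtain ⟨s, rfl⟩ := e₁.surjective g
    have := LinearMap.congr_fun key s
    ext f
    obtain ⟨r, rfl⟩ := e₂.surjective f
    have := LinearMap.congr_fun this r
    simpa using this
  have := (e₁.symm ≪≫ₗ c ≪≫ₗ e₂.symm.dualMap).bijective
  rwa [← funext h] at this

/-- The Deligne product of two Serre pairs. -/
def IsDeligneProduct.serrePair (hT : IsDeligneProduct k T) : SerrePair k D where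
  P := T.obj (S.P, S'.P)
  I := T.obj (S.I, S'.I)
  form := hT.form S S'
  perfect := by
    have := S.projective
    have := S'.projective
    have := (hT.projective_and_bijective S.P S'.P).1
    -- both `Hom(x, I ⊠ I')` and `Hom(P ⊠ P', x)^*` are left exact in `x`, and `P ⊠ P'` generates
    refine LeftExactPresheaf.bijective (hT.exists_epi S S')
      (LeftExactPresheaf.hom (k := k) (𝟭 D) (T.obj (S.I, S'.I)))
      (LeftExactPresheaf.dual (k := k) (T.obj (S.P, S'.P)))
      (fun x => LinearMap.mk₂ k (fun g f => hT.form S S' (f ≫ g))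
        (by simp) (by simp) (by simp) (by simp)) (fun {x y} h g => ?_) (hT.form_perfect S S')
    ext f
    exact congrArg (hT.form S S') (Category.assoc f h g).symm
  separator {x y} f hf := by
    obtain ⟨n, p, hp⟩ := hT.exists_epi S S' x
    rw [← cancel_epi p, comp_zero]
    refine biproduct.hom_ext' _ _ fun j => ?_
    rw [← Category.assoc, hf, comp_zero]

end Generator

/-! ### Nakayama functors of the Deligne product -/

section Product

variable {k : Type w} [Field k]

theorem IsRightExactLinear.of_iso {A : Type u₁} [Category.{v₁} A] [Preadditive A] [Linear k A]
    {X : Type u₂} [Category.{v₂} X] [Preadditive X] [Linear k X] {F G : A ⥤ X}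
    (hF : IsRightExactLinear k F) (e : F ≅ G) : IsRightExactLinear k G := by
  have := hF.additive
  have := hF.linear
  have := hF.preservesFiniteColimits
  exact ⟨Functor.additive_of_iso e, Functor.linear_of_iso k e,
    preservesFiniteColimits_of_natIso e⟩

/-- A morphism that becomes invertible under `Hom(P, -)` is invertible. -/
theorem SerrePair.isIso_of_bijective {X : Type u} [Category.{v} X] [Preadditive X] [Linear k X]
    [IsAbelianCat X] (S : SerrePair k X) {x y : X} (f : x ⟶ y)
    (hf : Function.Bijective fun u : S.P ⟶ x => u ≫ f) : IsIso f := by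
  have := IsAbelianCat.balanced X
  have : Mono f := Preadditive.mono_of_cancel_zero _ fun h hh => S.separator h fun u =>
    hf.1 (by simp [hh])
  have : Epi f := Preadditive.epi_of_cancel_zero _ fun h hh => S.separator h fun u => by
    obtain ⟨u', rfl⟩ := hf.2 u
    simp [hh]
  exact isIso_of_mono_of_epi f

/-- The linear isomorphism `Hom(z, R y) ≅ Hom(L z, y)` of an adjunction `L ⊣ R`. -/
def adjunctionEquiv {X : Type u} [Category.{v} X] [Preadditive X] [Linear k X] {L R : X ⥤ X}
    [L.Additive] [L.Linear k] (adj : L ⊣ R) (z y : X) : (z ⟶ R.obj y) ≃ₗ[k] (L.obj z ⟶ y) :=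
  { (adj.homEquiv z y).symm with
    map_add' := fun f g => by simp [Adjunction.homEquiv_counit]
    map_smul' := fun r f => by simp [Adjunction.homEquiv_counit] }

variable
  {A : Type u₁} [Category.{v₁} A] [Preadditive A] [Linear k A] [IsHomFiniteAdditive k A]
  [IsAbelianCat A]
  {B : Type u₂} [Category.{v₂} B] [Preadditive B] [Linear k B] [IsHomFiniteAdditive k B]
  [IsAbelianCat B]
  {D : Type u₃} [Category.{v₃} D] [Preadditive D] [Linear k D] [IsFiniteLinear k D]
  [IsAbelianCat D]
  {T : A × B ⥤ D} (S : SerrePair k A) (S' : SerrePair k B)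

omit [IsHomFiniteAdditive k A] [IsAbelianCat A] [IsHomFiniteAdditive k B] [IsAbelianCat B]
  [IsFiniteLinear k D] [IsAbelianCat D] in
theorem IsRightExactBilinear.prod_comp (hT : IsRightExactBilinear k T) {F : A ⥤ A} {G : B ⥤ B}
    (hF : IsRightExactLinear k F) (hG : IsRightExactLinear k G) :
    IsRightExactBilinear k (F.prod G ⋙ T) where
  left b := (hF.comp (hT.left (G.obj b))).of_iso
    (NatIso.ofComponents (fun _ => Iso.refl _) fun f => by
      have h : T.map (F.map f ×ₘ 𝟙 (G.obj b)) = T.map (F.map f ×ₘ G.map (𝟙 b)) := by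
        rw [G.map_id]
      exact (Category.comp_id _).trans (h.trans (Category.id_comp _).symm))
  right a := (hG.comp (hT.right (F.obj a))).of_iso
    (NatIso.ofComponents (fun _ => Iso.refl _) fun f => by
      have h : T.map (𝟙 (F.obj a) ×ₘ G.map f) = T.map (F.map (𝟙 a) ×ₘ G.map f) := by
        rw [F.map_id]
      exact (Category.comp_id _).trans (h.trans (Category.id_comp _).symm))

include S S' in
/-- Equivariance for the endomorphisms of `a ⊠ b` can be checked on those of the form `f ⊠ g`. -/
theorem IsDeligneProduct.map_comp_eq (hT : IsDeligneProduct k T) {F F' : D ⥤ D} [F.Additive]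
    [F'.Additive] {a : A} {b : B} (α : F.obj (T.obj (a, b)) ⟶ F'.obj (T.obj (a, b)))
    (hα : ∀ (f : a ⟶ a) (g : b ⟶ b),
      F.map (T.map (f ×ₘ g)) ≫ α = α ≫ F'.map (T.map (f ×ₘ g)))
    (e : T.obj (a, b) ⟶ T.obj (a, b)) : F.map e ≫ α = α ≫ F'.map e := by
  obtain ⟨s, rfl⟩ := (hT.homTensorMap_bijective S S' a a b b).2 e
  induction s with
  | zero => simp
  | tmul f g =>
    rw [IsRightExactBilinear.homTensorMap_tmul]
    exact hα f g
  | add s t hs ht => simp only [map_add, Functor.map_add, Preadditive.add_comp,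
      Preadditive.comp_add, hs, ht]

include S S' in
/-- Left exact functors on a Deligne product are determined by their restriction to pure tensors,
since `I ⊠ I'` is an injective cogenerator. -/
theorem IsDeligneProduct.nonempty_iso_of_left (hT : IsDeligneProduct k T) {G H : D ⥤ D}
    (hG : IsLeftExactLinear k G) (hH : IsLeftExactLinear k H) (α : T ⋙ G ≅ T ⋙ H) :
    Nonempty (G ≅ H) := by
  have := hG.additive
  have := hH.additive
  have := hG.preservesFiniteLimits
  have := hH.preservesFiniteLimits
  exact (hT.serrePair S S').nonempty_iso_of_left (α.app (S.I, S'.I))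
    (hT.map_comp_eq S S' (a := S.I) (b := S'.I) (α.hom.app (S.I, S'.I))
      fun f g => α.hom.naturality (f ×ₘ g))

variable {RA LA : A ⥤ A} {RB LB : B ⥤ B} {RD LD : D ⥤ D}

include S S' in
/-- Both functors send `P ⊠ P'` to `I ⊠ I'`; the action of endomorphisms is determined by the
linear form on `Hom(P ⊠ P', I ⊠ I')`, which is the product of those for the factors. -/
theorem IsDeligneProduct.nonempty_iso_rightNakayama (hT : IsDeligneProduct k T)
    (hRA : IsRightNakayama k RA) (hRB : IsRightNakayama k RB) (hRD : IsRightNakayama k RD)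
    (hA : IsRightExactLinear k RA) (hB : IsRightExactLinear k RB)
    (hD : IsRightExactLinear k RD) : Nonempty (T ⋙ RD ≅ RA.prod RB ⋙ T) := by
  obtain ⟨H, hH, ⟨χ⟩⟩ := hT.exists_extension (RA.prod RB ⋙ T) (hT.rightExact.prod_comp hA hB)
  obtain ⟨s, hs⟩ := S.exists_iso hRA
  obtain ⟨s', hs'⟩ := S'.exists_iso hRB
  obtain ⟨σ, hσ⟩ := (hT.serrePair S S').exists_iso hRD
  have := hD.additive
  have := hD.preservesFiniteColimits
  have := hH.additive
  have := hH.preservesFiniteColimits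
  let r : RD.obj (T.obj (S.P, S'.P)) ⟶ T.obj (S.I, S'.I) := σ.hom
  let r' : T.obj (S.I, S'.I) ⟶ RD.obj (T.obj (S.P, S'.P)) := σ.inv
  have hr : r ≫ r' = 𝟙 _ := σ.hom_inv_id
  let τ : H.obj (T.obj (S.P, S'.P)) ≅ T.obj (S.I, S'.I) :=
    χ.app (S.P, S'.P) ≪≫ T.mapIso (s.prod s')
  have hform (f : S.P ⟶ S.P) (g : S'.P ⟶ S'.P) (u : T.obj (S.P, S'.P) ⟶ T.obj (S.I, S'.I)) :
      hT.form S S' (T.map (f ×ₘ g) ≫ u) = hT.form S S'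
        (u ≫ T.map ((s.inv ≫ RA.map f ≫ s.hom) ×ₘ (s'.inv ≫ RB.map g ≫ s'.hom))) := by
    obtain ⟨t, rfl⟩ := (hT.homTensorMap_bijective S S' S.P S.I S'.P S'.I).2 u
    induction t with
    | zero => simp
    | tmul u u' =>
      rw [IsRightExactBilinear.homTensorMap_tmul, ← T.map_comp, ← T.map_comp]
      refine (hT.form_map S S' (f ≫ u) (g ≫ u')).trans
        (Eq.trans ?_ (hT.form_map S S' (u ≫ _) (u' ≫ _)).symm)
      rw [hs, hs']
    | add t t' ht ht' => simp only [map_add, Preadditive.add_comp, Preadditive.comp_add, ht, ht']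
  -- the endomorphism of `I ⊠ I'` given by `f ⊠ g` is determined by the form
  have key (f : S.P ⟶ S.P) (g : S'.P ⟶ S'.P) : r' ≫ RD.map (T.map (f ×ₘ g)) ≫ r =
      T.map ((s.inv ≫ RA.map f ≫ s.hom) ×ₘ (s'.inv ≫ RB.map g ≫ s'.hom)) :=
    (hT.serrePair S S').form_right_ext fun u =>
      (hσ (T.map (f ×ₘ g)) u).symm.trans (hform f g u)
  have hτ (f : S.P ⟶ S.P) (g : S'.P ⟶ S'.P) : H.map (T.map (f ×ₘ g)) ≫ τ.hom =
      τ.hom ≫ T.map ((s.inv ≫ RA.map f ≫ s.hom) ×ₘ (s'.inv ≫ RB.map g ≫ s'.hom)) := by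
    have h₁ : H.map (T.map (f ×ₘ g)) ≫ χ.hom.app (S.P, S'.P) =
      χ.hom.app (S.P, S'.P) ≫ T.map (RA.map f ×ₘ RB.map g) := χ.hom.naturality (f ×ₘ g)
    change H.map (T.map (f ×ₘ g)) ≫ χ.hom.app (S.P, S'.P) ≫ T.map (s.hom ×ₘ s'.hom) =
      (χ.hom.app (S.P, S'.P) ≫ T.map (s.hom ×ₘ s'.hom)) ≫ _
    rw [reassoc_of% h₁, Category.assoc, ← T.map_comp, ← T.map_comp]
    congr 2
    ext <;> simp
  obtain ⟨ε⟩ := (hT.serrePair S S').nonempty_iso_of_right (H := RD) (H' := H) (σ ≪≫ τ.symm)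
    (hT.map_comp_eq S S' (a := S.P) (b := S'.P) (r ≫ τ.inv) fun f g => by
      rw [← cancel_mono τ.hom, Category.assoc, Category.assoc, Category.assoc, Category.assoc,
        hτ, Iso.inv_hom_id_assoc, Iso.inv_hom_id, Category.comp_id, ← key,
        reassoc_of% hr])
  exact ⟨Functor.isoWhiskerLeft T ε ≪≫ χ⟩

include S S' in
/-- The comparison morphism `L a ⊠ L b ⟶ L (a ⊠ b)` is the mate of the isomorphism for the left
adjoints; it is invertible because morphisms between pure tensors are tensors of morphisms. -/
theorem IsDeligneProduct.nonempty_iso_rightAdjoint (hT : IsDeligneProduct k T)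
    (hA : IsRightExactLinear k RA) (hB : IsRightExactLinear k RB)
    (hD : IsRightExactLinear k RD) (adjA : RA ⊣ LA) (adjB : RB ⊣ LB) (adjD : RD ⊣ LD)
    (ψ : T ⋙ RD ≅ RA.prod RB ⋙ T) : Nonempty (T ⋙ LD ≅ LA.prod LB ⋙ T) := by
  have := hA.additive
  have := hA.linear
  have := hB.additive
  have := hB.linear
  have := hD.additive
  have := hD.linear
  let ψ₁ (a : A) (b : B) : RD.obj (T.obj (a, b)) ≅ T.obj (RA.obj a, RB.obj b) := ψ.app (a, b)
  have ψ_nat {a a' : A} {b b' : B} (f : a ⟶ a') (g : b ⟶ b') :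
      RD.map (T.map (f ×ₘ g)) ≫ (ψ₁ a' b').hom = (ψ₁ a b).hom ≫ T.map (RA.map f ×ₘ RB.map g) :=
    ψ.hom.naturality (f ×ₘ g)
  let θ (a : A) (b : B) : T.obj (LA.obj a, LB.obj b) ⟶ LD.obj (T.obj (a, b)) :=
    adjD.homEquiv _ _ ((ψ₁ _ _).hom ≫ T.map (adjA.counit.app a ×ₘ adjB.counit.app b))
  have hθ (a : A) (b : B) (p : A) (q : B) :
      Function.Bijective fun u : T.obj (p, q) ⟶ T.obj (LA.obj a, LB.obj b) => u ≫ θ a b := by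
    let e₁ := LinearEquiv.ofBijective _ (hT.homTensorMap_bijective S S' p (LA.obj a) q (LB.obj b))
    let e₂ := LinearEquiv.ofBijective _ (hT.homTensorMap_bijective S S' (RA.obj p) a (RB.obj q) b)
    let c := TensorProduct.congr (adjunctionEquiv (k := k) adjA p a)
      (adjunctionEquiv (k := k) adjB q b)
    -- up to the adjunctions and `ψ`, composition with `θ` is the isomorphism
    -- `Hom(p, L a) ⊗ Hom(q, L b) ≅ Hom(R p, a) ⊗ Hom(R q, b)`
    have h (s) : RD.map (e₁ s) ≫ (ψ₁ _ _).hom ≫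
        T.map (adjA.counit.app a ×ₘ adjB.counit.app b) = (ψ₁ p q).hom ≫ e₂ (c s) := by
      induction s with
      | zero => simp
      | tmul f g =>
        have h₁ : e₁ (f ⊗ₜ g) = T.map (f ×ₘ g) := hT.rightExact.homTensorMap_tmul f g
        have h₂ : e₂ (c (f ⊗ₜ g)) = T.map ((RA.map f ≫ adjA.counit.app a) ×ₘ
            (RB.map g ≫ adjB.counit.app b)) := by
          refine (hT.rightExact.homTensorMap_tmul ((adjA.homEquiv _ _).symm f)
            ((adjB.homEquiv _ _).symm g)).trans ?_
          rw [Adjunction.homEquiv_counit, Adjunction.homEquiv_counit]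
        rw [h₁, h₂, reassoc_of% ψ_nat, ← T.map_comp]
        rfl
      | add s t hs ht =>
        simp only [map_add, Functor.map_add, Preadditive.add_comp, Preadditive.comp_add, hs, ht]
    have h' (u : T.obj (p, q) ⟶ T.obj (LA.obj a, LB.obj b)) : u ≫ θ a b =
        adjD.homEquiv _ _ ((ψ₁ p q).symm.homFromEquiv (e₂ (c (e₁.symm u)))) := by
      refine (adjD.homEquiv_naturality_left _ _).symm.trans (congrArg _ ?_)
      rw [← e₁.apply_symm_apply u, h, e₁.apply_symm_apply]
      rfl
    rw [funext h']
    exact (adjD.homEquiv _ _).bijective.comp ((ψ₁ p q).symm.homFromEquiv.bijective.comp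
      (e₂.bijective.comp (c.bijective.comp e₁.symm.bijective)))
  have hiso (a : A) (b : B) : IsIso (θ a b) :=
    (hT.serrePair S S').isIso_of_bijective _ (hθ a b S.P S'.P)
  refine ⟨(NatIso.ofComponents (fun x => @asIso _ _ _ _ (θ x.1 x.2) (hiso x.1 x.2))
    fun {x y} f => ?_).symm⟩
  change T.map (LA.map f.1 ×ₘ LB.map f.2) ≫ θ y.1 y.2 = θ x.1 x.2 ≫ LD.map (T.map f)
  simp only [θ]
  rw [← adjD.homEquiv_naturality_left, ← adjD.homEquiv_naturality_right, reassoc_of% ψ_nat,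
    Category.assoc, ← T.map_comp, ← T.map_comp]
  congr 3
  ext <;> simp

end Product

end

end FiniteLinear

theorem proposition3p12 {k : Type w} [Field k] [IsAlgClosed k]
    {A : Type u₁} [Category.{v₁} A] [Preadditive A] [Linear k A] [IsFiniteLinear k A] :
    -- the Deligne product
    (∀ {B : Type u₂} [Category.{v₂} B] [Preadditive B] [Linear k B] [IsFiniteLinear k B]
      {D : Type u₃} [Category.{v₃} D] [Preadditive D] [Linear k D] [IsFiniteLinear k D]
      (T : A × B ⥤ D), IsDeligneProduct k T →
      ∃ (_ : HasNakayamaFunctors k A) (_ : HasNakayamaFunctors k B)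
        (_ : HasNakayamaFunctors k D),
        (IsLeftExactProduct k T (leftNakayama k A) (leftNakayama k B) (leftNakayama k D) ∧
          ∀ H : D ⥤ D, IsLeftExactProduct k T (leftNakayama k A) (leftNakayama k B) H →
            Nonempty (leftNakayama k D ≅ H)) ∧
        (IsRightExactProduct k T (rightNakayama k A) (rightNakayama k B) (rightNakayama k D) ∧
          ∀ H : D ⥤ D, IsRightExactProduct k T (rightNakayama k A) (rightNakayama k B) H →
            Nonempty (rightNakayama k D ≅ H))) ∧
    -- the opposite category
    (∃ (_ : HasNakayamaFunctors k A) (_ : HasNakayamaFunctors k Aᵒᵖ),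
      Nonempty (leftNakayama k Aᵒᵖ ≅ (rightNakayama k A).op) ∧
      Nonempty (rightNakayama k Aᵒᵖ ≅ (leftNakayama k A).op)) := by
  have := isAbelianCat_of_isFiniteLinear k A
  obtain ⟨S⟩ := nonempty_serrePair k A
  have hA := S.hasNakayamaFunctors
  have hAl := isLeftNakayama_leftNakayama k (X := A)
  have hAr := isRightNakayama_rightNakayama k (X := A)
  have hO := S.op.hasNakayamaFunctors
  refine ⟨fun {B} _ _ _ _ {D} _ _ _ _ T hT => ?_, hA, hO,
    (isLeftNakayama_leftNakayama k).nonempty_iso hAr.op,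
    (isRightNakayama_rightNakayama k).nonempty_iso hAl.op⟩
  have := isAbelianCat_of_isFiniteLinear k B
  have := isAbelianCat_of_isFiniteLinear k D
  obtain ⟨S'⟩ := nonempty_serrePair k B
  have hB := S'.hasNakayamaFunctors
  have hBl := isLeftNakayama_leftNakayama k (X := B)
  have hBr := isRightNakayama_rightNakayama k (X := B)
  have hD := (hT.serrePair S S').hasNakayamaFunctors
  have hDl := isLeftNakayama_leftNakayama k (X := D)
  have hDr := isRightNakayama_rightNakayama k (X := D)
  have rA := hAr.isRightExactLinear hAl
  have rB := hBr.isRightExactLinear hBl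
  have rD := hDr.isRightExactLinear hDl
  have lD := hDl.isLeftExactLinear hDr
  obtain ⟨adjA⟩ := nonempty_adjunction hAr hAl
  obtain ⟨adjB⟩ := nonempty_adjunction hBr hBl
  obtain ⟨adjD⟩ := nonempty_adjunction hDr hDl
  obtain ⟨ψ⟩ := hT.nonempty_iso_rightNakayama S S' hAr hBr hDr rA rB rD
  obtain ⟨θ⟩ := hT.nonempty_iso_rightAdjoint S S' rA rB rD adjA adjB adjD ψ
  exact ⟨hA, hB, hD,
    ⟨⟨hAl.isLeftExactLinear hAr, hBl.isLeftExactLinear hBr, lD, ⟨θ⟩⟩, fun H hH =>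
      hT.nonempty_iso_of_left S S' lD hH.prod (θ ≪≫ hH.iso.some.symm)⟩,
    ⟨⟨rA, rB, rD, ⟨ψ⟩⟩, fun H hH => hT.nonempty_iso rD hH.prod (ψ ≪≫ hH.iso.some.symm)⟩⟩
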